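/- **Setting.** Let $\mathcal I$ be a set whose elements are encoded by bit strings, and let $X=(X(I))_{I\in\mathcal I}$ be a family of simplicial sets whose simplices are encoded by bit strings; $\mathrm{size}(\cdot)$ is the number of bits of an encoding. "Polynomial-time in each fixed dimension" means: computed by one algorithm, uniform in the dimension $k$ and in $I$, whose running time for each fixed $k$ is at most a polynomial (depending only on $k$) in $\mathrm{size}(I)$ plus the size of the rest of the input. Chains are given as lists of the basis elements with nonzero coefficient together with their coefficients in binary. $X$ is *locally polynomial-time* if its face and degeneracy operators are polynomial-time in each fixed dimension. $C_*(X)$ is the normalized chain complex, with basis the nondegenerate simplices. A *discrete vector field* on a simplicial set is a set of pairs $(\sigma,\tau)$ of nondegenerate simplices such that $\sigma=\partial_i\tau$ for exactly one $i$ and no simplex occurs in two pairs; $\sigma$ is called a *source*, $\tau=V(\sigma)$ a *target*, and the nondegenerate simplices in no pair are *critical*. Its *$V\partial$-graph* has as vertices the nondegenerate simplices and as edges the pairs of $V$ and all $(\tau,\sigma)$ with $\tau$ a target, $\sigma$ a source or critical face of $\tau$, and $(\sigma,\tau)\notin V$. $V$ is *admissible* if this graph has no directed cycle and no infinite directed path.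 Let $V_\#$ be the homomorphism sending a source $\sigma=\partial_iV(\sigma)$ to $(-1)^{i+1}V(\sigma)$ and every other simplex to $0$, let $\Phi=1+V_\#\partial+\partial V_\#$, and let $\Phi^\infty$ be the stabilization of the powers of $\Phi$. The *critical complex* $C^{\rm crit}_*$ has the critical simplices as basis and differential $j\circ\partial\circ\Phi^\infty$, where $j$ restricts a chain to the critical simplices. A family $V$ of admissible discrete vector fields on the $X(I)$ is *polynomially bounded* if (1) classifying a nondegenerate simplex $\sigma$ as source, target or critical, and returning $V(\sigma)$ if it is a source, is polynomial-time in each fixed dimension, and (2) for each fixed $k$ and each nondegenerate $k$-simplex $\sigma$, the sum of the sizes of all simplices reachable from $\sigma$ by a directed path in the $V\partial$-graph is at most a polynomial in $\mathrm{size}(I)+\mathrm{size}(\sigma)$. **Theorem.** Let $X$ be locally polynomial-time and let $V$ be a polynomially bounded family of admissible discrete vector fields on $X$. Suppose that for each $k$ the sum of the sizes of all critical $k$-simplices of $X(I)$ is finite and at most a polynomial in $\mathrm{size}(I)$. Then the critical complexes $C^{\rm crit}_*(I)$ are well-defined chain complexes; their differentials are polynomial-time in each fixed dimension; their rank in each degree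 is finite and at most a polynomial in $\mathrm{size}(I)$; and for all $I$ there are reductions $(f,g,h)$ from $C_*(X(I))$ to $C^{\rm crit}_*(I)$ (that is, $f,g$ are chain maps, $fg=1$, $1-gf=\partial h+h\partial$, $fh=0$, $hg=0$, $hh=0$) with $f,g,h$ polynomial-time in each fixed dimension. If, moreover, for each fixed $k$ the list of the critical $k$-simplices of $X(I)$ can be computed from $I$ in polynomial time, then this list gives the distinguished bases of $C^{\rm crit}_*(I)$ in polynomial time, and hence $X$ has *polynomial-time homology*: $X$ is locally polynomial-time, and there are reductions, with all three maps polynomial-time in each fixed dimension, from the $C_*(X(I))$ to based free chain complexes whose differentials and whose lists of basis elements are polynomial-time in each fixed dimension. -/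

import Mathlib

open CategoryTheory

namespace PolyTimeHomology

universe v u

/-! ### The model of computation

Data are binary trees; programs are built from projections, pairing, composition, branching and
unbounded loops. Every elementary operation is charged the full size of the tree it reads or
copies, so that a run of cost `m` only touches trees of total size `O(m)` and is simulated by a
multi-tape Turing machine in time polynomial in `m`. Conversely a configuration of a Turing machine
is a tuple of lists of symbols, and each step is a fixed program of cost linear in its size.
Hence polynomial cost here is the same as polynomial time on a Turing machine. -/

/-- Binary trees: the data on which programs work. -/
inductive BTree : Type
  | nil : BTree
  | node : BTree → BTree → BTree

namespace BTree

/-- The number of nodes and leaves of a tree. -/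
def size : BTree → ℕ
  | nil => 1
  | node a b => a.size + b.size + 1

/-- The left subtree. -/
def left : BTree → BTree
  | nil => nil
  | node a _ => a

/-- The right subtree. -/
def right : BTree → BTree
  | nil => nil
  | node _ b => b

/-- A finite list of trees, as a tree. -/
def ofList : List BTree → BTree
  | [] => nil
  | t :: l => node t (ofList l)

/-- A bit, as a tree. -/
def ofBool : Bool → BTree
  | false => nil
  | true => node nil nil

/-- A bit string, as a tree; its size is linear in the number of bits. -/
def ofBits (w : List Bool) : BTree := ofList (w.map ofBool)

/-- A natural number in unary (used for dimensions, indices of face operators and tags). -/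
def ofNat : ℕ → BTree
  | 0 => nil
  | n + 1 => node nil (ofNat n)

/-- An integer in binary: its sign bit, and the binary digits of its absolute value. -/
def ofInt (z : ℤ) : BTree := node (ofBool (decide (z < 0))) (ofBits (Nat.bits z.natAbs))

end BTree

/-- Programs. -/
inductive Prog : Type
  | ident : Prog
  | nil : Prog
  | fst : Prog
  | snd : Prog
  | pair : Prog → Prog → Prog
  | comp : Prog → Prog → Prog
  | cond : Prog → Prog → Prog → Prog
  | loop : Prog → Prog → Prog

/-- `p.Runs x y m`: on input `x` the program `p` halts with output `y` at cost `m`.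
`comp p q` runs `q`, then `p`. `cond c p q` runs `c`, then `p` if the result of `c` is not `nil`,
and `q` if it is `nil`. `loop c p` replaces the current tree by its image under `p` as long as
the result of `c` on it is not `nil`. -/
inductive Prog.Runs : Prog → BTree → BTree → ℕ → Prop
  | ident (x : BTree) : Runs .ident x x x.size
  | nil (x : BTree) : Runs .nil x .nil x.size
  | fst (x : BTree) : Runs .fst x x.left x.size
  | snd (x : BTree) : Runs .snd x x.right x.size
  | pair {p q : Prog} {x y z : BTree} {m n : ℕ} :
      Runs p x y m → Runs q x z n → Runs (.pair p q) x (.node y z) (m + n + x.size)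
  | comp {p q : Prog} {x y z : BTree} {m n : ℕ} :
      Runs q x y m → Runs p y z n → Runs (.comp p q) x z (m + n)
  | cond_node {c p q : Prog} {x a b z : BTree} {m n : ℕ} :
      Runs c x (.node a b) m → Runs p x z n → Runs (.cond c p q) x z (m + n + x.size)
  | cond_nil {c p q : Prog} {x z : BTree} {m n : ℕ} :
      Runs c x .nil m → Runs q x z n → Runs (.cond c p q) x z (m + n + x.size)
  | loop_nil {c p : Prog} {x : BTree} {m : ℕ} :
      Runs c x .nil m → Runs (.loop c p) x x (m + x.size)
  | loop_node {c p : Prog} {x a b y z : BTree} {m n r : ℕ} :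
      Runs c x (.node a b) m → Runs p x y n → Runs (.loop c p) y z r →
        Runs (.loop c p) x z (m + n + r + x.size)

/-- A computational problem for every `k : ℕ` (the dimension), with set of instances `A k`;
`inp k a t` says that the tree `t` is an admissible input for the instance `a`, and `out k a t`
that `t` is a correct answer for `a`. It is polynomial-time in each dimension if a single
program solves all instances of all dimensions, in time that, for each fixed `k`, is bounded by
a polynomial in the size of the input. -/
def PolyTime {A : ℕ → Type*} (inp out : ∀ k, A k → BTree → Prop) : Prop :=
  ∃ p : Prog, ∀ k, ∃ P : Polynomial ℕ, ∀ (a : A k) (t : BTree), inp k a t →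
    ∃ (t' : BTree) (m : ℕ), p.Runs t t' m ∧ m ≤ P.eval t.size ∧ out k a t'

/-- The encoding of a subset by the encodings of its elements. -/
noncomputable def restrictEncoding {α : Type*} (e : Computability.Encoding α Bool) (s : Set α) :
    Computability.Encoding s Bool where
  encode x := e.encode x.1
  decode w := by
    classical
    exact (e.decode w).bind fun x => if h : x ∈ s then some ⟨x, h⟩ else none
  decode_encode x := by simp

/-! ### Chain complexes of based free abelian groups, and reductions -/

/-- A chain complex (in degrees `≥ 0`) of free abelian groups with distinguished bases. -/
structure FreeComplex where
  /-- the distinguished basis in degree `k` -/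
  Basis : ℕ → Type u
  /-- the differential from degree `k + 1` to degree `k` -/
  d : ∀ k, (Basis (k + 1) →₀ ℤ) →ₗ[ℤ] (Basis k →₀ ℤ)
  d_comp_d : ∀ k, d k ∘ₗ d (k + 1) = 0

/-- The group of `k`-chains. -/
abbrev FreeComplex.Chain (C : FreeComplex.{u}) (k : ℕ) : Type u := C.Basis k →₀ ℤ

/-- A reduction `(f, g, h)` from `C` to `D`. -/
structure Reduction (C D : FreeComplex.{u}) where
  f : ∀ k, C.Chain k →ₗ[ℤ] D.Chain k
  g : ∀ k, D.Chain k →ₗ[ℤ] C.Chain k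
  h : ∀ k, C.Chain k →ₗ[ℤ] C.Chain (k + 1)
  f_comm : ∀ k, f k ∘ₗ C.d k = D.d k ∘ₗ f (k + 1)
  g_comm : ∀ k, g k ∘ₗ D.d k = C.d k ∘ₗ g (k + 1)
  f_comp_g : ∀ k, f k ∘ₗ g k = LinearMap.id
  homotopy_zero : LinearMap.id - g 0 ∘ₗ f 0 = C.d 0 ∘ₗ h 0
  homotopy_succ : ∀ k, LinearMap.id - g (k + 1) ∘ₗ f (k + 1) =
    C.d (k + 1) ∘ₗ h (k + 1) + h k ∘ₗ C.d k
  f_comp_h : ∀ k, f (k + 1) ∘ₗ h k = 0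
  h_comp_g : ∀ k, h k ∘ₗ g k = 0
  h_comp_h : ∀ k, h (k + 1) ∘ₗ h k = 0

/-! ### The normalized chain complex of a simplicial set -/

section Normalized

open Simplicial

variable (X : SSet.{u})

open Classical in
/-- The chain `1 · σ` of a nondegenerate simplex `σ`; degenerate simplices are ignored. -/
noncomputable def simplexChain (k : ℕ) (σ : X _⦋k⦌) : X.nonDegenerate k →₀ ℤ :=
  if h : σ ∈ X.nonDegenerate k then Finsupp.single ⟨σ, h⟩ 1 else 0

/-- The differential of the normalized chain complex: the alternating sum of the faces. -/
noncomputable def boundary (k : ℕ) :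
    (X.nonDegenerate (k + 1) →₀ ℤ) →ₗ[ℤ] (X.nonDegenerate k →₀ ℤ) :=
  Finsupp.linearCombination ℤ fun σ : X.nonDegenerate (k + 1) =>
    ∑ i : Fin (k + 2), (-1 : ℤ) ^ (i : ℕ) • simplexChain X k (X.δ i σ.1)

lemma simplexChain_of_degenerate {k : ℕ} {σ : X _⦋k⦌} (h : σ ∈ X.degenerate k) :
    simplexChain X k σ = 0 := by
  simp [simplexChain, (X.mem_degenerate_iff_notMem_nonDegenerate σ).1 h]

lemma sum_faces_of_degenerate {k : ℕ} {σ : X _⦋k + 1⦌} (h : σ ∈ X.degenerate (k + 1)) :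
    ∑ i : Fin (k + 2), (-1 : ℤ) ^ (i : ℕ) • simplexChain X k (X.δ i σ) = 0 := by
  rw [SSet.degenerate_eq_iUnion_range_σ] at h
  obtain ⟨j, τ, rfl⟩ := Set.mem_iUnion.1 h
  have hne : j.castSucc ≠ j.succ := j.castSucc_lt_succ.ne
  rw [Fintype.sum_eq_add j.castSucc j.succ hne]
  · simp [pow_succ]
  · rintro i ⟨h1, h2⟩
    have h0 : simplexChain X k (X.δ i (X.σ j τ)) = 0 := by
      apply simplexChain_of_degenerate
      obtain _ | k := k
      · exfalso
        have := j.isLt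
        have := i.isLt
        simp only [ne_eq, Fin.ext_iff, Fin.val_castSucc, Fin.val_succ] at h1 h2
        omega
      · rcases lt_or_gt_of_ne h1 with hlt | hgt
        · have hj : j ≠ 0 := by rintro rfl; simp at hlt
          have hi : i ≠ Fin.last _ := (lt_of_lt_of_le hlt (Fin.le_last _)).ne
          obtain ⟨j, rfl⟩ := Fin.exists_succ_eq.2 hj
          obtain ⟨i, rfl⟩ := Fin.exists_castSucc_eq.2 hi
          rw [SSet.δ_comp_σ_of_le_apply]
          · exact X.σ_mem_degenerate _ _
          · simp only [Fin.lt_def, Fin.le_def, Fin.val_castSucc, Fin.val_succ] at hlt ⊢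
            omega
        · have hj : j ≠ Fin.last _ := by
            rintro rfl
            have := i.isLt
            simp only [ne_eq, Fin.ext_iff, Fin.val_succ, Fin.val_last, Fin.lt_def,
              Fin.val_castSucc] at h2 hgt
            omega
          have hi : i ≠ 0 := by rintro rfl; simp at hgt
          obtain ⟨j, rfl⟩ := Fin.exists_castSucc_eq.2 hj
          obtain ⟨i, rfl⟩ := Fin.exists_succ_eq.2 hi
          rw [SSet.δ_comp_σ_of_gt_apply]
          · exact X.σ_mem_degenerate _ _
          · simp only [ne_eq, Fin.ext_iff, Fin.lt_def, Fin.val_castSucc,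
              Fin.val_succ] at h2 hgt ⊢
            omega
    rw [h0, smul_zero]

lemma boundary_simplexChain {k : ℕ} (σ : X _⦋k + 1⦌) :
    boundary X k (simplexChain X (k + 1) σ) =
      ∑ i : Fin (k + 2), (-1 : ℤ) ^ (i : ℕ) • simplexChain X k (X.δ i σ) := by
  by_cases h : σ ∈ X.nonDegenerate (k + 1)
  · simp [simplexChain, h, boundary]
  · have h' := (X.mem_degenerate_iff_notMem_nonDegenerate σ).2 h
    rw [sum_faces_of_degenerate X h', simplexChain_of_degenerate X h', map_zero]

lemma boundary_comp_boundary (k : ℕ) : boundary X k ∘ₗ boundary X (k + 1) = 0 := by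
  ext1 σ
  ext1
  simp only [LinearMap.comp_apply, Finsupp.lsingle_apply, LinearMap.zero_apply]
  simp only [boundary, Finsupp.linearCombination_single, one_smul]
  change boundary X k _ = 0
  simp only [map_sum, map_smul, boundary_simplexChain, Finset.smul_sum, smul_smul, ← pow_add]
  rw [← Finset.sum_product']
  let P := Fin (k + 3) × Fin (k + 2)
  let S : Finset P := Finset.univ.filter fun ij : P => (ij.1 : ℕ) ≤ (ij.2 : ℕ)
  rw [Finset.univ_product_univ, ← Finset.sum_add_sum_compl S, ← eq_neg_iff_add_eq_zero,
    ← Finset.sum_neg_distrib]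
  refine Finset.sum_bij
    (fun ij hij => (ij.2.succ, ij.1.castLT
      (lt_of_le_of_lt (Finset.mem_filter.1 hij).2 ij.2.isLt))) ?_ ?_ ?_ ?_
  · rintro ⟨i, j⟩ hij
    have h := (Finset.mem_filter.1 hij).2
    simp only [S, Finset.mem_compl, Finset.mem_filter, Finset.mem_univ, true_and, Fin.val_succ,
      Fin.val_castLT, not_le]
    exact Nat.lt_succ_of_le h
  · rintro ⟨i, j⟩ hij ⟨i', j'⟩ hij' h
    have h1 := congrArg Fin.val (congrArg Prod.fst h)
    have h2 := congrArg Fin.val (congrArg Prod.snd h)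
    simp only [Fin.val_succ, Fin.val_castLT] at h1 h2
    exact Prod.ext (Fin.ext h2) (Fin.ext (Nat.succ_injective h1))
  · rintro ⟨i, j⟩ hij
    simp only [S, Finset.mem_compl, Finset.mem_filter, Finset.mem_univ, true_and, not_le] at hij
    have hi : i ≠ 0 := by rintro rfl; simp at hij
    refine ⟨(j.castSucc, i.pred hi), ?_, ?_⟩
    · simp only [S, Finset.mem_filter, Finset.mem_univ, true_and, Fin.val_castSucc, Fin.val_pred]
      omega
    · simp
  · rintro ⟨i, j⟩ hij
    have h := (Finset.mem_filter.1 hij).2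
    simp only [Fin.val_succ, Fin.val_castLT]
    have := SSet.δ_comp_δ''_apply (S := X) (i := i) (j := j) h σ.1
    rw [this, show (j : ℕ) + 1 + (i : ℕ) = (i : ℕ) + j + 1 by omega, pow_succ]
    simp

/-- The normalized chain complex `C_*(X)`. -/
noncomputable def normalizedComplex : FreeComplex.{u} where
  Basis k := X.nonDegenerate k
  d := boundary X
  d_comp_d := boundary_comp_boundary X

end Normalized

/-! ### Discrete vector fields -/

/-- A discrete vector field on `X`: a set of pairs `(σ, τ)` of nondegenerate simplices, where `σ` is
a regular face of `τ` (that is, `σ` is the `i`-th face of `τ` for exactly one `i`), and no simplex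
occurs in two different pairs. -/
structure DiscreteVectorField (X : SSet.{u}) where
  /-- the pairs whose first member has dimension `k` -/
  pairs : ∀ k, Set (X.nonDegenerate k × X.nonDegenerate (k + 1))
  regular : ∀ {k σ τ}, (σ, τ) ∈ pairs k → ∃! i : Fin (k + 2), X.δ i τ.1 = σ.1
  target_unique : ∀ {k σ τ τ'}, (σ, τ) ∈ pairs k → (σ, τ') ∈ pairs k → τ = τ'
  source_unique : ∀ {k σ σ' τ}, (σ, τ) ∈ pairs k → (σ', τ) ∈ pairs k → σ = σ'
  source_ne_target : ∀ {k σ τ σ' τ'}, (σ, τ) ∈ pairs (k + 1) → (σ', τ') ∈ pairs k → σ ≠ τ'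

namespace DiscreteVectorField

variable {X : SSet.{u}} (V : DiscreteVectorField X)

/-- Source simplices. -/
def IsSource (k : ℕ) (σ : X.nonDegenerate k) : Prop := ∃ τ, (σ, τ) ∈ V.pairs k

/-- Target simplices. -/
def IsTarget : ∀ k : ℕ, X.nonDegenerate k → Prop
  | 0, _ => False
  | k + 1, τ => ∃ σ, (σ, τ) ∈ V.pairs k

/-- Critical simplices. -/
def critical (k : ℕ) : Set (X.nonDegenerate k) := {σ | ¬ V.IsSource k σ ∧ ¬ V.IsTarget k σ}

/-- The edges of the `V∂`-graph, whose vertices are the nondegenerate simplices. -/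
inductive Edge : (Σ k, X.nonDegenerate k) → (Σ k, X.nonDegenerate k) → Prop
  | up {k : ℕ} {σ : X.nonDegenerate k} {τ : X.nonDegenerate (k + 1)} :
      (σ, τ) ∈ V.pairs k → Edge ⟨k, σ⟩ ⟨k + 1, τ⟩
  | down {k : ℕ} {τ : X.nonDegenerate (k + 1)} {σ : X.nonDegenerate k} :
      V.IsTarget (k + 1) τ → (∃ i : Fin (k + 2), X.δ i τ.1 = σ.1) →
      (V.IsSource k σ ∨ σ ∈ V.critical k) → (σ, τ) ∉ V.pairs k → Edge ⟨k + 1, τ⟩ ⟨k, σ⟩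

/-- `V` is admissible if its `V∂`-graph has no directed cycle and no infinite directed path. -/
def Admissible : Prop :=
  (¬ ∃ x, Relation.TransGen V.Edge x x) ∧
    ¬ ∃ s : ℕ → Σ k, X.nonDegenerate k, ∀ n, V.Edge (s n) (s (n + 1))

/-- The set of simplices reachable from `x` by a directed path in the `V∂`-graph. -/
def reach (x : Σ k, X.nonDegenerate k) : Set (Σ k, X.nonDegenerate k) :=
  {y | Relation.ReflTransGen V.Edge x y}

open Classical in
/-- The homomorphism `V_#`: it sends a source simplex `σ` to `(-1)^(i+1) V(σ)`, where `i` is the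
unique index with `σ = ∂_i V(σ)`, and all other simplices to `0`. -/
noncomputable def raise (k : ℕ) : (X.nonDegenerate k →₀ ℤ) →ₗ[ℤ] (X.nonDegenerate (k + 1) →₀ ℤ) :=
  Finsupp.linearCombination ℤ fun σ : X.nonDegenerate k =>
    if h : ∃ τ, (σ, τ) ∈ V.pairs k then
      Finsupp.single h.choose ((-1 : ℤ) ^ (((V.regular h.choose_spec).choose : ℕ) + 1))
    else 0

/-- The map `Φ = 1 + V_# ∘ ∂ + ∂ ∘ V_#`. -/
noncomputable def Phi : ∀ k : ℕ, Module.End ℤ (X.nonDegenerate k →₀ ℤ)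
  | 0 => LinearMap.id + boundary X 0 ∘ₗ V.raise 0
  | k + 1 => LinearMap.id + V.raise k ∘ₗ boundary X k + boundary X (k + 1) ∘ₗ V.raise (k + 1)

/-- The critical complex: the free abelian groups on the critical simplices, and the differential
`j ∘ ∂ ∘ Φ^∞`, where `Φ^∞` is the stabilization of the powers of `Φ` and `j` restricts a chain to
the critical simplices. -/
structure CriticalComplex where
  d : ∀ k, (V.critical (k + 1) →₀ ℤ) →ₗ[ℤ] (V.critical k →₀ ℤ)
  d_comp_d : ∀ k, d k ∘ₗ d (k + 1) = 0
  d_single : ∀ (k : ℕ) (σ : V.critical (k + 1)), ∀ᶠ N : ℕ in Filter.atTop,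
    d k (Finsupp.single σ 1) = Finsupp.lsubtypeDomain (R := ℤ) (V.critical k)
      (boundary X k ((V.Phi (k + 1) ^ N) (Finsupp.single σ.1 1)))

/-- The critical complex as a complex of based free abelian groups. -/
def CriticalComplex.toFreeComplex {V : DiscreteVectorField X} (K : V.CriticalComplex) :
    FreeComplex.{u} where
  Basis k := V.critical k
  d := K.d
  d_comp_d := K.d_comp_d

end DiscreteVectorField

/-! ### Parameterized, encoded objects and their polynomial-time versions -/

/-- A chain complex parameterized by `ι`, with an encoding of the distinguished basis elements by
bit strings. -/
structure EncComplex (ι : Type v) where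
  cx : ι → FreeComplex.{u}
  enc : ∀ I k, Computability.Encoding ((cx I).Basis k) Bool

open Simplicial in
/-- A simplicial set parameterized by `ι`, with an encoding of the simplices by bit strings. -/
structure EncSSet (ι : Type v) where
  sset : ι → SSet.{u}
  enc : ∀ I k, Computability.Encoding ((sset I) _⦋k⦌) Bool

variable {ι : Type v} (eI : Computability.Encoding ι Bool)

/-- The input consisting of a number `k`, a parameter `I` and a datum `t`. -/
def input (k : ℕ) (I : ι) (t : BTree) : BTree :=
  .node (.ofNat k) (.node (.ofBits (eI.encode I)) t)

namespace EncComplex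

variable {eI} (E F : EncComplex.{v, u} ι)

/-- `t` represents the chain `c`: it lists the basis elements with nonzero coefficient in `c`,
without repetition and in any order, together with their coefficients in binary. -/
def Represents {I : ι} {k : ℕ} (c : (E.cx I).Chain k) (t : BTree) : Prop :=
  ∃ l : List ((E.cx I).Basis k), l.Nodup ∧ (∀ b, b ∈ l ↔ c b ≠ 0) ∧
    t = .ofList (l.map fun b => .node (.ofBits ((E.enc I k).encode b)) (.ofInt (c b)))

/-- A family of homomorphisms from the `a k`-chains of `E` to the `b k`-chains of `F` is
polynomial-time: given `I` and an `a k`-chain, its image is computed, for each fixed `k`, in time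
polynomial in the size of `I` and of the chain. -/
def MapPolyTime (eI : Computability.Encoding ι Bool) {E F : EncComplex.{v, u} ι} {a b : ℕ → ℕ}
    (φ : ∀ I k, (E.cx I).Chain (a k) →ₗ[ℤ] (F.cx I).Chain (b k)) : Prop :=
  PolyTime (A := fun k => Σ I, (E.cx I).Chain (a k))
    (fun k x t => ∃ s, E.Represents x.2 s ∧ t = input eI (a k) x.1 s)
    (fun k x t => F.Represents (φ x.1 k x.2) t)

/-- Locally polynomial-time chain complexes. -/
def LocallyPolyTime (eI : Computability.Encoding ι Bool) (E : EncComplex.{v, u} ι) : Prop :=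
  MapPolyTime eI (E := E) (F := E) (a := fun k => k + 1) (b := fun k => k) fun I k => (E.cx I).d k

/-- The rank in each degree is finite and bounded by a polynomial in the size of `I`. -/
def RankPolyBounded (eI : Computability.Encoding ι Bool) (E : EncComplex.{v, u} ι) : Prop :=
  ∀ k, ∃ P : Polynomial ℕ, ∀ I, Finite ((E.cx I).Basis k) ∧
    Nat.card ((E.cx I).Basis k) ≤ P.eval (eI.encode I).length

/-- For each fixed `k`, the list of all elements of the distinguished basis in degree `k` is
computed in time polynomial in the size of `I`. -/
def BasisPolyTime (eI : Computability.Encoding ι Bool) (E : EncComplex.{v, u} ι) : Prop :=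
  PolyTime (A := fun _ => ι)
    (fun k I t => t = input eI k I .nil)
    (fun k I t => ∃ l : List ((E.cx I).Basis k), l.Nodup ∧ (∀ b, b ∈ l) ∧
      t = .ofList (l.map fun b => .ofBits ((E.enc I k).encode b)))

/-- There are reductions from `E I` to `F I`, for all parameters `I`, with all three maps
polynomial-time in each fixed dimension. -/
def PolyTimeReducible (eI : Computability.Encoding ι Bool) (E F : EncComplex.{v, u} ι) : Prop :=
  ∃ ρ : ∀ I, Reduction (E.cx I) (F.cx I),
    MapPolyTime eI (E := E) (F := F) (a := fun k => k) (b := fun k => k) (fun I k => (ρ I).f k) ∧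
    MapPolyTime eI (E := F) (F := E) (a := fun k => k) (b := fun k => k) (fun I k => (ρ I).g k) ∧
    MapPolyTime eI (E := E) (F := E) (a := fun k => k) (b := fun k => k + 1) (fun I k => (ρ I).h k)

end EncComplex

namespace EncSSet

variable (X : EncSSet.{v, u} ι)

/-- The parameterized normalized chain complex `C_*(X)`; its basis elements, the nondegenerate
simplices, are encoded as in `X`. -/
noncomputable def chains : EncComplex.{v, u} ι where
  cx I := normalizedComplex (X.sset I)
  enc I k := restrictEncoding (X.enc I k) ((X.sset I).nonDegenerate k)

open Simplicial in
/-- The code of a simplex, as a tree. -/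
def code {I : ι} {k : ℕ} (σ : (X.sset I) _⦋k⦌) : BTree := .ofBits ((X.enc I k).encode σ)

open Simplicial in
/-- The size of a simplex: the number of bits of its code. -/
def size {I : ι} {k : ℕ} (σ : (X.sset I) _⦋k⦌) : ℕ := ((X.enc I k).encode σ).length

open Simplicial in
/-- Locally polynomial-time simplicial sets: the face and degeneracy operators are computed, for
each fixed dimension, in polynomial time. -/
def LocallyPolyTime : Prop :=
  PolyTime (A := fun k => Σ I, Fin (k + 2) × (X.sset I) _⦋k + 1⦌)
    (fun k x t => t = input eI (k + 1) x.1 (.node (.ofNat x.2.1) (X.code x.2.2)))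
    (fun _ x t => t = X.code ((X.sset x.1).δ x.2.1 x.2.2)) ∧
  PolyTime (A := fun k => Σ I, Fin (k + 1) × (X.sset I) _⦋k⦌)
    (fun k x t => t = input eI k x.1 (.node (.ofNat x.2.1) (X.code x.2.2)))
    (fun _ x t => t = X.code ((X.sset x.1).σ x.2.1 x.2.2))

/-- Simplicial sets with polynomial-time homology. -/
def HasPolyTimeHomology : Prop :=
  X.LocallyPolyTime eI ∧ ∃ E : EncComplex.{v, u} ι,
    E.LocallyPolyTime eI ∧ E.BasisPolyTime eI ∧ X.chains.PolyTimeReducible eI E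

variable {X} (V : ∀ I, DiscreteVectorField (X.sset I))

/-- `V` is classified in polynomial time: given a nondegenerate simplex `σ`, it is decided, in
polynomial time for each fixed dimension, whether `σ` is a source, a target or critical, and in the
first case `V(σ)` is returned as well. -/
def ClassifyPolyTime : Prop :=
  PolyTime (A := fun k => Σ I, (X.sset I).nonDegenerate k)
    (fun k x t => t = input eI k x.1 (X.code x.2.1))
    (fun k x t =>
      (∃ τ, (x.2, τ) ∈ (V x.1).pairs k ∧ t = .node (.ofNat 0) (X.code τ.1)) ∨
      ((V x.1).IsTarget k x.2 ∧ t = .node (.ofNat 1) .nil) ∨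
      (x.2 ∈ (V x.1).critical k ∧ t = .node (.ofNat 2) .nil))

/-- For each fixed dimension, the sum of the sizes of all simplices reachable from `σ` is bounded by
a polynomial in the size of `I` plus the size of `σ`. -/
def ReachPolyBounded : Prop :=
  ∀ k, ∃ P : Polynomial ℕ, ∀ (I : ι) (σ : (X.sset I).nonDegenerate k),
    ((V I).reach ⟨k, σ⟩).Finite ∧
    ∑ᶠ y ∈ (V I).reach ⟨k, σ⟩, X.size y.2.1 ≤ P.eval ((eI.encode I).length + X.size σ.1)

/-- Polynomially bounded (admissible) discrete vector fields. -/
def PolyBounded : Prop :=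
  (∀ I, (V I).Admissible) ∧ ClassifyPolyTime eI V ∧ ReachPolyBounded eI V

/-- For each fixed dimension, the sum of the sizes of all critical simplices is bounded by a
polynomial in the size of `I`. -/
def CriticalPolyBounded : Prop :=
  ∀ k, ∃ P : Polynomial ℕ, ∀ I : ι, ((V I).critical k).Finite ∧
    ∑ᶠ σ ∈ (V I).critical k, X.size σ.1 ≤ P.eval (eI.encode I).length

/-- The list of all `k`-dimensional critical simplices is computed, for each fixed `k`, in time
polynomial in the size of `I`. -/
def CriticalPolyTime : Prop :=
  PolyTime (A := fun _ => ι)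
    (fun k I t => t = input eI k I .nil)
    (fun k I t => ∃ l : List ((X.sset I).nonDegenerate k), l.Nodup ∧
      (∀ σ, σ ∈ l ↔ σ ∈ (V I).critical k) ∧ t = .ofList (l.map fun σ => X.code σ.1))

/-- The critical complexes as a parameterized complex; critical simplices are encoded as in `X`. -/
noncomputable def critComplex {V : ∀ I, DiscreteVectorField (X.sset I)}
    (K : ∀ I, (V I).CriticalComplex) : EncComplex.{v, u} ι where
  cx I := (K I).toFreeComplex
  enc I k := restrictEncoding (restrictEncoding (X.enc I k) ((X.sset I).nonDegenerate k))
    ((V I).critical k)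

end EncSSet

end PolyTimeHomology

/-!
# Algebraic discrete Morse theory in polynomial time

**The reduction.** Let `V_#` send a source simplex `σ = ∂_i V(σ)` to `(-1)^(i+1) V(σ)` and all other
simplices to `0`. Then `1 + ∂ V_#` replaces a source `σ` by the other faces of `V(σ)`, with signs,
and fixes targets and critical simplices. A source that appears in this way is the next one on a
gradient path. As there are no directed cycles and only finitely many simplices can be reached from
`σ`, the number `rank σ` of reachable simplices of the same dimension drops along such a path, and
the powers of `1 + ∂ V_#` applied to a chain become constant, with a limit that contains no sources.
Hence `h = -∑ V_# (1 + ∂ V_#)^n` is a finite sum on each chain, and the limit is `1 - ∂ h`.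
Telescoping gives `h ∂ V_# = V_#` (`homotopy_boundary_raise`), and therefore `h ∂ h = h`. Put
`f = j (1 - ∂ h)` and `g = 1 - h ∂` on critical chains. A chain without sources is the sum of a
critical chain and a chain of targets, and `h ∂` is the identity on targets, which yields
`g f = 1 - ∂ h - h ∂` (`incl_proj`). The identities of a reduction follow formally. The powers of `Φ`
applied to a critical chain become equal to `g` (`Phi_pow_eq_incl`), and `j ∂ g = f ∂ g = f ∂` on
critical chains, so that the differential `j ∂ Φ^∞` of the critical complex is `f ∂`.

**The algorithm.** The maps `f` and `h` are computed by one loop (`computes_proj_homotopy`), which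
applies `1 + ∂ V_#` to the whole chain at once, and adds up the terms of `h`, until no source is
left; `g` and the differential are obtained from `h` and `f` by means of `∂`. There may be
exponentially many gradient paths, but the number of rounds is at most the number of reachable
simplices, because it is bounded by the rank. After each round the targets are removed from the
chain; they contribute neither to `V_#` nor to `j`. What remains, and the terms of `h`, consist of
reachable simplices, whose sizes have a polynomial sum. The sum of the absolute values of the
coefficients grows by a factor of at most `k + 3` in each round, so that the coefficients have
polynomially many bits. In the boundary the degenerate faces have to be recognized: `σ` is degenerate
if and only if `s_j ∂_j σ = σ` for some `j`.

**Programs.** A statement `Computes Γ x y` says that one program takes the memory `x a` to `y a` for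
all members `a` of a family of instances, in time polynomial with respect to a `Scale`, that is, in
the size of the instances for each fixed dimension. Such statements compose, and no programs are
written down: pairing, branching, loops with a given test (`Computes.loop`) and loops over lists
(`Computes.fold`, `Computes.flatMap`) yield binary arithmetic, the normalization of lists of signed
simplices to chains (`ComputesChain.of_list`), and linear maps given on basis elements
(`ComputesChain.linear`). The body of a loop is again a statement of this kind, about the larger
family of all situations in which the body may be executed, measured by the instance that the loop
started from. The bounds for loops thereby remain polynomial.
-/

namespace PolyTimeHomology

universe v u w w'

open CategoryTheory BTree

/-! ### Polynomially bounded quantities -/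

/-- A measure of the complexity of the members of a family `A` of instances: a dimension, in which
no uniformity is required, and a size, in which quantities are to be polynomial. -/
structure Scale (A : Type w) where
  /-- the dimension of an instance -/
  dim : A → ℕ
  /-- the size of an instance -/
  size : A → ℕ

namespace Scale

variable {A : Type w} {B : Type w'} {Γ : Scale A}

/-- `f` is bounded, for each fixed dimension, by a polynomial in the size. -/
def Bdd (Γ : Scale A) (f : A → ℕ) : Prop :=
  ∀ k, ∃ P : Polynomial ℕ, ∀ a, Γ.dim a = k → f a ≤ P.eval (Γ.size a)

/-- The instances of a family `B` derived from instances in `A` are measured as the latter. -/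
def comap (Γ : Scale A) (φ : B → A) : Scale B := ⟨fun b => Γ.dim (φ b), fun b => Γ.size (φ b)⟩

lemma Bdd.mono {f g : A → ℕ} (hg : Γ.Bdd g) (h : ∀ a, f a ≤ g a) : Γ.Bdd f := fun k => by
  obtain ⟨P, hP⟩ := hg k
  exact ⟨P, fun a ha => (h a).trans (hP a ha)⟩

lemma Bdd.add {f g : A → ℕ} (hf : Γ.Bdd f) (hg : Γ.Bdd g) : Γ.Bdd fun a => f a + g a := fun k => by
  obtain ⟨P, hP⟩ := hf k
  obtain ⟨Q, hQ⟩ := hg k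
  exact ⟨P + Q, fun a ha => by simpa using add_le_add (hP a ha) (hQ a ha)⟩

lemma Bdd.mul {f g : A → ℕ} (hf : Γ.Bdd f) (hg : Γ.Bdd g) : Γ.Bdd fun a => f a * g a := fun k => by
  obtain ⟨P, hP⟩ := hf k
  obtain ⟨Q, hQ⟩ := hg k
  exact ⟨P * Q, fun a ha => by simpa using Nat.mul_le_mul (hP a ha) (hQ a ha)⟩

lemma bdd_of_dim (g : ℕ → ℕ) : Γ.Bdd fun a => g (Γ.dim a) :=
  fun k => ⟨Polynomial.C (g k), fun a ha => by simp [ha]⟩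

lemma bdd_const (n : ℕ) : Γ.Bdd fun _ => n := bdd_of_dim fun _ => n

lemma bdd_size : Γ.Bdd Γ.size := fun _ => ⟨Polynomial.X, fun a _ => by simp⟩

lemma eval_le_eval (P : Polynomial ℕ) {m n : ℕ} (h : m ≤ n) : P.eval m ≤ P.eval n := by
  induction P using Polynomial.induction_on' with
  | add p q hp hq => simpa using add_le_add hp hq
  | monomial k c => simpa using Nat.mul_le_mul_left c (Nat.pow_le_pow_left h k)

lemma Bdd.eval {f : A → ℕ} (hf : Γ.Bdd f) (P : ℕ → Polynomial ℕ) :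
    Γ.Bdd fun a => (P (Γ.dim a)).eval (f a) := fun k => by
  obtain ⟨Q, hQ⟩ := hf k
  refine ⟨(P k).comp Q, fun a ha => ?_⟩
  rw [Polynomial.eval_comp]
  subst ha
  exact eval_le_eval _ (hQ a rfl)

lemma Bdd.comap {f : A → ℕ} (hf : Γ.Bdd f) (φ : B → A) : (Γ.comap φ).Bdd fun b => f (φ b) :=
  fun k => by
  obtain ⟨P, hP⟩ := hf k
  exact ⟨P, fun b hb => hP _ hb⟩

lemma Bdd.exists_of_comap {φ : B → A} {f : B → ℕ} (hf : (Γ.comap φ).Bdd f) :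
    ∃ g, Γ.Bdd g ∧ ∀ b, f b ≤ g (φ b) := by
  choose P hP using hf
  exact ⟨fun a => (P (Γ.dim a)).eval (Γ.size a), Bdd.eval bdd_size P, fun b => hP _ b rfl⟩

/-- The integer `κ a` takes, for each fixed dimension, finitely many values. -/
def DimBdd (Γ : Scale A) (κ : A → ℕ) : Prop := ∃ g : ℕ → ℕ, ∀ a, κ a ≤ g (Γ.dim a)

lemma DimBdd.bdd {κ : A → ℕ} (h : Γ.DimBdd κ) : Γ.Bdd κ := by
  obtain ⟨g, hg⟩ := h
  exact (bdd_of_dim g).mono hg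

lemma DimBdd.comap {κ : A → ℕ} (h : Γ.DimBdd κ) (φ : B → A) :
    (Γ.comap φ).DimBdd fun b => κ (φ b) := by
  obtain ⟨g, hg⟩ := h
  exact ⟨g, fun b => hg _⟩

lemma DimBdd.map {κ : A → ℕ} (h : Γ.DimBdd κ) {g : ℕ → ℕ} (hg : Monotone g) :
    Γ.DimBdd fun a => g (κ a) := by
  obtain ⟨b, hb⟩ := h
  exact ⟨fun k => g (b k), fun a => hg (hb a)⟩

/-- Polynomials that bound a quantity for each value of a parameter with finitely many values in
each dimension yield a polynomial bound. -/
lemma DimBdd.eval {κ f : A → ℕ} (hκ : Γ.DimBdd κ) (hf : Γ.Bdd f) (P : ℕ → Polynomial ℕ) :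
    Γ.Bdd fun a => (P (κ a)).eval (f a) := by
  obtain ⟨g, hg⟩ := hκ
  refine (hf.eval fun k => ∑ j ∈ Finset.range (g k + 1), P j).mono fun a => ?_
  rw [Polynomial.eval_finsetSum]
  exact Finset.single_le_sum (f := fun j => (P j).eval (f a)) (fun _ _ => Nat.zero_le _)
    (Finset.mem_range.2 (Nat.lt_succ_of_le (hg a)))

end Scale

/-! ### Running programs -/

namespace BTree

lemma size_pos (t : BTree) : 0 < t.size := by cases t <;> simp [size]

lemma size_left_le (t : BTree) : t.left.size ≤ t.size := by
  cases t <;> simp only [size, left] <;> omega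

lemma size_right_le (t : BTree) : t.right.size ≤ t.size := by
  cases t <;> simp only [size, right] <;> omega

end BTree

lemma Prog.Runs.size_le {p : Prog} {x y : BTree} {m : ℕ} (h : p.Runs x y m) :
    x.size ≤ m ∧ y.size ≤ m := by
  induction h with
  | ident x => simp
  | nil x => exact ⟨le_rfl, x.size_pos⟩
  | fst x => exact ⟨le_rfl, x.size_left_le⟩
  | snd x => exact ⟨le_rfl, x.size_right_le⟩
  | @pair p q x y z m n _ _ h1 h2 =>
    have := x.size_pos
    simp only [BTree.size]
    omega
  | comp _ _ h1 h2 => omega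
  | cond_node _ _ h1 h2 => omega
  | cond_nil _ _ h1 h2 => omega
  | loop_nil _ h1 => omega
  | loop_node _ _ _ h1 h2 h3 => omega

/-- `y a` is computed from `x a` by one program, in time polynomial for each fixed dimension. The
index `a` carries the mathematical data that are encoded in the memory `x a`; the program sees only
`x a`. -/
def Computes {A : Type w} (Γ : Scale A) (x y : A → BTree) : Prop :=
  ∃ (p : Prog) (m : A → ℕ), Γ.Bdd m ∧ ∀ a, p.Runs (x a) (y a) (m a)

namespace Computes

variable {A : Type w} {B : Type w'} {Γ : Scale A} {x y z : A → BTree}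

lemma of_le {p : Prog} {b : A → ℕ} (hb : Γ.Bdd b) (h : ∀ a, ∃ m ≤ b a, p.Runs (x a) (y a) m) :
    Computes Γ x y := by
  choose m hm h using h
  exact ⟨p, m, hb.mono hm, h⟩

lemma bdd_in (h : Computes Γ x y) : Γ.Bdd fun a => (x a).size := by
  obtain ⟨p, m, hm, h⟩ := h
  exact hm.mono fun a => (h a).size_le.1

lemma bdd_out (h : Computes Γ x y) : Γ.Bdd fun a => (y a).size := by
  obtain ⟨p, m, hm, h⟩ := h
  exact hm.mono fun a => (h a).size_le.2

lemma refl (h : Γ.Bdd fun a => (x a).size) : Computes Γ x x :=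
  ⟨.ident, _, h, fun _ => .ident _⟩

lemma trans (h : Computes Γ x y) (h' : Computes Γ y z) : Computes Γ x z := by
  obtain ⟨p, m, hm, h⟩ := h
  obtain ⟨q, n, hn, h'⟩ := h'
  exact ⟨.comp q p, _, hm.add hn, fun a => .comp (h a) (h' a)⟩

lemma input (h : Computes Γ x y) : Computes Γ x x := refl h.bdd_in

lemma nil (h : Computes Γ x x) : Computes Γ x fun _ => .nil :=
  ⟨.nil, _, h.bdd_in, fun _ => .nil _⟩

lemma left (h : Computes Γ x y) : Computes Γ x fun a => (y a).left :=
  h.trans ⟨.fst, _, h.bdd_out, fun _ => .fst _⟩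

lemma right (h : Computes Γ x y) : Computes Γ x fun a => (y a).right :=
  h.trans ⟨.snd, _, h.bdd_out, fun _ => .snd _⟩

lemma fst (h : Computes Γ x fun a => .node (y a) (z a)) : Computes Γ x y := h.left

lemma snd (h : Computes Γ x fun a => .node (y a) (z a)) : Computes Γ x z := h.right

lemma node (h : Computes Γ x y) (h' : Computes Γ x z) :
    Computes Γ x fun a => .node (y a) (z a) := by
  have hx := h.bdd_in
  obtain ⟨p, m, hm, h⟩ := h
  obtain ⟨q, n, hn, h'⟩ := h'
  exact ⟨.pair p q, _, (hm.add hn).add hx, fun a => .pair (h a) (h' a)⟩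

lemma const (t : BTree) (h : Computes Γ x x) : Computes Γ x fun _ => t := by
  induction t with
  | nil => exact h.nil
  | node a b ha hb => exact ha.node hb

lemma comap (h : Computes Γ x y) (φ : B → A) :
    Computes (Γ.comap φ) (fun b => x (φ b)) (fun b => y (φ b)) := by
  obtain ⟨p, m, hm, h⟩ := h
  exact ⟨p, _, hm.comap φ, fun b => h _⟩

/-- Anything computed before is available in an extended memory. -/
lemma lift {φ : B → A} {e : B → BTree} (h : Computes Γ x y) {z : B → BTree}
    (he : Computes (Γ.comap φ) z fun b => .node (x (φ b)) (e b)) :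
    Computes (Γ.comap φ) z fun b => y (φ b) :=
  he.fst.trans (h.comap φ)

lemma congr {y' : A → BTree} (h : Computes Γ x y) (e : ∀ a, y a = y' a) : Computes Γ x y' := by
  rwa [← funext e]

/-- Branching, where the two branches live on two families that cover all instances. -/
lemma cond {A₀ : Type*} {A₁ : Type*} {c : A → BTree} {φ₀ : A₀ → A} {φ₁ : A₁ → A}
    (hc : Computes Γ x c)
    (h₀ : Computes (Γ.comap φ₀) (fun b => x (φ₀ b)) (fun b => y (φ₀ b)))
    (h₁ : Computes (Γ.comap φ₁) (fun b => x (φ₁ b)) (fun b => y (φ₁ b)))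
    (hcov : ∀ a, (c a = .nil ∧ ∃ b, φ₀ b = a) ∨ (c a ≠ .nil ∧ ∃ b, φ₁ b = a)) :
    Computes Γ x y := by
  have hx := hc.bdd_in
  obtain ⟨p, m, hm, hp⟩ := hc
  obtain ⟨q, n₀, hn₀, hq⟩ := h₀
  obtain ⟨r, n₁, hn₁, hr⟩ := h₁
  obtain ⟨g₀, hg₀, h₀⟩ := hn₀.exists_of_comap
  obtain ⟨g₁, hg₁, h₁⟩ := hn₁.exists_of_comap
  refine of_le (p := .cond p r q) ((hm.add (hg₀.add hg₁)).add hx) fun a => ?_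
  have hpa := hp a
  rcases hcov a with ⟨h, b, rfl⟩ | ⟨h, b, rfl⟩
  · rw [h] at hpa
    have := h₀ b
    exact ⟨_, by omega, .cond_nil hpa (hq b)⟩
  · obtain ⟨u, v, huv⟩ : ∃ u v, c (φ₁ b) = .node u v := by
      cases hcb : c (φ₁ b) with
      | nil => exact absurd hcb h
      | node u v => exact ⟨u, v, rfl⟩
    rw [huv] at hpa
    have := h₁ b
    exact ⟨_, by omega, .cond_node hpa (hr b)⟩

/-- Branching on a bit. -/
lemma bcond {c : A → Bool} (hc : Computes Γ x fun a => ofBool (c a))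
    (h₀ : Computes (Γ.comap (Subtype.val : {a // c a = false} → A)) (fun b => x b.1)
      (fun b => y b.1))
    (h₁ : Computes (Γ.comap (Subtype.val : {a // c a = true} → A)) (fun b => x b.1)
      (fun b => y b.1)) :
    Computes Γ x y := by
  refine cond hc h₀ h₁ fun a => ?_
  cases h : c a
  · exact .inl ⟨rfl, ⟨a, h⟩, rfl⟩
  · exact .inr ⟨by simp [ofBool], ⟨a, h⟩, rfl⟩

lemma ite {c : A → Bool} (hc : Computes Γ x fun a => ofBool (c a)) (hy : Computes Γ x y)
    (hz : Computes Γ x z) : Computes Γ x fun a => if c a = true then y a else z a :=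
  bcond hc ((hz.comap Subtype.val).congr fun b => by simp [b.2])
    ((hy.comap Subtype.val).congr fun b => by simp [b.2])

/-- A function of a bit. -/
lemma bool {c : A → Bool} {f : A → Bool → BTree} (hc : Computes Γ x fun a => ofBool (c a))
    (h : ∀ b, Computes Γ x fun a => f a b) : Computes Γ x fun a => f a (c a) :=
  (hc.ite (h true) (h false)).congr fun a => by cases c a <;> rfl

lemma not {c : A → Bool} (hc : Computes Γ x fun a => ofBool (c a)) :
    Computes Γ x fun a => ofBool (!c a) :=
  hc.bool (f := fun _ b => ofBool !b) fun _ => .const _ hc.input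

lemma and {c d : A → Bool} (hc : Computes Γ x fun a => ofBool (c a))
    (hd : Computes Γ x fun a => ofBool (d a)) : Computes Γ x fun a => ofBool (c a && d a) :=
  hc.bool (f := fun a b => ofBool (b && d a)) fun b => by
    cases b
    · exact .const _ hc.input
    · simpa using hd

lemma or {c d : A → Bool} (hc : Computes Γ x fun a => ofBool (c a))
    (hd : Computes Γ x fun a => ofBool (d a)) : Computes Γ x fun a => ofBool (c a || d a) :=
  hc.bool (f := fun a b => ofBool (b || d a)) fun b => by
    cases b
    · simpa using hd
    · exact .const _ hc.input

open Classical in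
/-- Testing whether a tree is `nil`. -/
lemma isNil (h : Computes Γ x y) : Computes Γ x fun a => ofBool (decide (y a = .nil)) := by
  refine cond (φ₀ := (Subtype.val : {a // y a = .nil} → A))
    (φ₁ := (Subtype.val : {a // y a ≠ .nil} → A)) h
    ((const (ofBool true) (h.input.comap _)).congr fun b => by simp [b.2])
    ((const (ofBool false) (h.input.comap _)).congr fun b => by simp [b.2]) fun a => ?_
  by_cases ha : y a = .nil
  · exact .inl ⟨ha, ⟨a, ha⟩, rfl⟩
  · exact .inr ⟨ha, ⟨a, ha⟩, rfl⟩

/-- Loops that run until a test `c` fails. For the instance `a`, the predicate `R a n` holds for the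
admissible memories after `n` rounds. The test has to fail exactly after `N a` rounds, and the body
has to be computed on admissible memories only, where it may use the instance and the number of the
round. -/
theorem loop {R : A → ℕ → BTree → Prop} {N b : A → ℕ} {c : BTree → BTree}
    (hN : Γ.Bdd N) (hb : Γ.Bdd b) (hR : ∀ a n t, R a n t → n ≤ N a → t.size ≤ b a)
    (hc : Computes (Γ.comap (fun q : {q : A × ℕ × BTree // R q.1 q.2.1 q.2.2 ∧ q.2.1 ≤ N q.1} =>
      q.1.1)) (fun q => q.1.2.2) (fun q => c q.1.2.2))
    (hcN : ∀ a n t, R a n t → n ≤ N a → (c t = .nil ↔ n = N a))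
    (h0 : Computes Γ x y) (h0R : ∀ a, R a 0 (y a))
    {z : {q : A × ℕ × BTree // R q.1 q.2.1 q.2.2 ∧ q.2.1 < N q.1} → BTree}
    (hz : Computes (Γ.comap fun q => q.1.1) (fun q => q.1.2.2) z)
    (hzR : ∀ q, R q.1.1 (q.1.2.1 + 1) (z q)) :
    ∃ o, Computes Γ x o ∧ ∀ a, R a (N a) (o a) := by
  classical
  let s : A → ℕ → BTree := fun a n => Nat.rec (y a)
    (fun n t => if h : R a n t ∧ n < N a then z ⟨(a, n, t), h⟩ else .nil) n
  have hs : ∀ a n, n ≤ N a → R a n (s a n) := by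
    intro a n
    induction n with
    | zero => exact fun _ => h0R a
    | succ n ih =>
      intro hn
      have h : R a n (s a n) ∧ n < N a := ⟨ih (by omega), hn⟩
      have : s a (n + 1) = z ⟨(a, n, s a n), h⟩ := dif_pos h
      rw [this]
      exact hzR ⟨(a, n, s a n), h⟩
  have hs' : ∀ a n (h : R a n (s a n) ∧ n < N a), s a (n + 1) = z ⟨(a, n, s a n), h⟩ :=
    fun a n h => dif_pos h
  refine ⟨fun a => s a (N a), h0.trans ?_, fun a => hs a _ le_rfl⟩
  obtain ⟨p, m, hm, hp⟩ := hc
  obtain ⟨q, r, hr, hq⟩ := hz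
  obtain ⟨m', hm', hmm⟩ := hm.exists_of_comap
  obtain ⟨r', hr', hrr⟩ := hr.exists_of_comap
  have key : ∀ a j, j ≤ N a → ∃ i ≤ (j + 1) * (m' a + r' a + b a),
      (Prog.loop p q).Runs (s a (N a - j)) (s a (N a)) i := by
    intro a j
    induction j with
    | zero =>
      intro _
      have h := hs a _ le_rfl
      have h1 := hp ⟨(a, N a, s a (N a)), h, le_rfl⟩
      have h2 := hmm ⟨(a, N a, s a (N a)), h, le_rfl⟩
      have h3 := hR a _ _ h le_rfl
      simp only [(hcN a _ _ h le_rfl).2 rfl] at h1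
      refine ⟨_, ?_, .loop_nil h1⟩
      simp only [Nat.sub_zero] at h2 ⊢
      omega
    | succ j ih =>
      intro hj
      obtain ⟨i, hi, hrun⟩ := ih (by omega)
      have hlt : N a - (j + 1) < N a := by omega
      have h := hs a _ hlt.le
      have h1 := hp ⟨(a, N a - (j + 1), s a (N a - (j + 1))), h, hlt.le⟩
      have h2 := hmm ⟨(a, N a - (j + 1), s a (N a - (j + 1))), h, hlt.le⟩
      have h3 := hR a _ _ h hlt.le
      have h4 := hq ⟨(a, N a - (j + 1), s a (N a - (j + 1))), h, hlt⟩
      have h5 := hrr ⟨(a, N a - (j + 1), s a (N a - (j + 1))), h, hlt⟩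
      have e : z ⟨(a, N a - (j + 1), s a (N a - (j + 1))), h, hlt⟩ = s a (N a - j) := by
        have : N a - j = N a - (j + 1) + 1 := by omega
        rw [this]
        exact (hs' _ _ ⟨h, hlt⟩).symm
      rw [e] at h4
      have hne : c (s a (N a - (j + 1))) ≠ .nil := fun h' =>
        absurd ((hcN a _ _ h hlt.le).1 h') hlt.ne
      obtain ⟨u, v, huv⟩ : ∃ u v, c (s a (N a - (j + 1))) = .node u v := by
        cases hcb : c (s a (N a - (j + 1))) with
        | nil => exact absurd hcb hne
        | node u v => exact ⟨u, v, rfl⟩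
      simp only [huv] at h1
      refine ⟨_, ?_, .loop_node h1 h4 hrun⟩
      simp only at h2 h5 ⊢
      have : (j + 1 + 1) * (m' a + r' a + b a) =
        (j + 1) * (m' a + r' a + b a) + (m' a + r' a + b a) := by ring
      omega
  refine of_le (p := .loop p q)
    ((hN.add (Scale.bdd_const 1)).mul ((hm'.add hr').add hb)) fun a => ?_
  obtain ⟨i, hi, h⟩ := key a (N a) le_rfl
  rw [Nat.sub_self] at h
  exact ⟨i, hi, h⟩

end Computes

/-! ### Loops over lists -/

namespace BTree

lemma size_ofList_cons (t : BTree) (l : List BTree) :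
    (ofList (t :: l)).size = t.size + (ofList l).size + 1 := rfl

lemma length_lt_size_ofList (l : List BTree) : l.length < (ofList l).size := by
  induction l with
  | nil => simp [ofList, size]
  | cons t l ih => rw [size_ofList_cons, List.length_cons]; have := t.size_pos; omega

lemma size_le_of_mem {l : List BTree} {t : BTree} (h : t ∈ l) : t.size ≤ (ofList l).size := by
  induction l with
  | nil => simp at h
  | cons a l ih =>
    rw [size_ofList_cons]
    rcases List.mem_cons.1 h with rfl | h
    · omega
    · have := ih h; omega

lemma size_ofList_append (l l' : List BTree) :
    (ofList (l ++ l')).size + 1 = (ofList l).size + (ofList l').size := by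
  induction l with
  | nil => simp [ofList, size]; omega
  | cons t l ih => simp only [List.cons_append, size_ofList_cons]; omega

lemma size_ofList_reverse (l : List BTree) : (ofList l.reverse).size = (ofList l).size := by
  induction l with
  | nil => rfl
  | cons t l ih =>
    have := size_ofList_append l.reverse [t]
    rw [List.reverse_cons, size_ofList_cons]
    simp only [ofList, size] at this ⊢
    omega

lemma size_ofList_drop_le (l : List BTree) (n : ℕ) :
    (ofList (l.drop n)).size ≤ (ofList l).size := by
  have := size_ofList_append (l.take n) (l.drop n)
  rw [List.take_append_drop] at this
  have := (ofList (l.take n)).size_pos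
  omega

lemma size_ofList_flatMap_le {T : Type*} (l : List T) (f : T → List BTree) (b : ℕ)
    (h : ∀ t ∈ l, (ofList (f t)).size ≤ b) : (ofList (l.flatMap f)).size ≤ l.length * b + 1 := by
  induction l with
  | nil => simp [ofList, size]
  | cons t l ih =>
    have := size_ofList_append (f t) (l.flatMap f)
    have h1 := h t (by simp)
    have h2 := ih fun t ht => h t (by simp [ht])
    rw [List.flatMap_cons, List.length_cons, Nat.succ_mul]
    omega

end BTree

namespace Computes

variable {A : Type w} {Γ : Scale A} {x y z : A → BTree}

/-- The instances for the body of a loop over the lists `l a`: the current element of the list, and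
any state of admissible size. -/
abbrev FoldStep {T S : A → Type*} (l : ∀ a, List (T a)) (eS : ∀ a, S a → BTree) (b : A → ℕ) :=
  {q : Σ a, T a × S a // q.2.1 ∈ l q.1 ∧ (eS q.1 q.2.2).size ≤ b q.1}

/-- Loops over a list with an accumulator. In the body, the memory consists of the memory before the
loop, the current element and the accumulator. -/
theorem fold {T S : A → Type*} {l : ∀ a, List (T a)} {e : ∀ a, T a → BTree}
    {f : ∀ a, S a → T a → S a} {i : ∀ a, S a} {eS : ∀ a, S a → BTree} (b : A → ℕ) (hb : Γ.Bdd b)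
    (hl : Computes Γ x fun a => ofList ((l a).map (e a)))
    (hi : Computes Γ x fun a => eS a (i a))
    (hs : ∀ a n, (eS a (((l a).take n).foldl (f a) (i a))).size ≤ b a)
    (hf : ∀ (mem : FoldStep l eS b → BTree) (_ : Computes (Γ.comap fun q => q.1.1) mem fun q =>
        .node (x q.1.1) (.node (e q.1.1 q.1.2.1) (eS q.1.1 q.1.2.2))),
      Computes (Γ.comap fun q => q.1.1) mem fun q => eS q.1.1 (f q.1.1 q.1.2.2 q.1.2.1)) :
    Computes Γ x fun a => eS a ((l a).foldl (f a) (i a)) := by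
  have hx := hl.bdd_in
  have hlb := hl.bdd_out
  -- The memory holds what was there before the loop, the rest of the list, and the accumulator.
  let st : A → ℕ → BTree := fun a n => .node (x a) (.node (ofList (((l a).map (e a)).drop n))
    (eS a (((l a).take n).foldl (f a) (i a))))
  let R : A → ℕ → BTree → Prop := fun a n t => t = st a n
  have hst : ∀ a n, (st a n).size ≤ (x a).size + (ofList ((l a).map (e a))).size + b a + 2 := by
    intro a n
    have h1 := hs a n
    have h2 := size_ofList_drop_le ((l a).map (e a)) n
    simp only [st, size]
    omega
  have hbd := ((hx.add hlb).add hb).add (Scale.bdd_const (Γ := Γ) 2)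
  have hmem : (Γ.comap fun q : FoldStep l eS b => q.1.1).Bdd fun q =>
      (BTree.node (x q.1.1) (.node (e q.1.1 q.1.2.1) (eS q.1.1 q.1.2.2))).size := by
    refine (hbd.comap _).mono fun q => ?_
    have h1 := size_le_of_mem (List.mem_map_of_mem (f := e q.1.1) q.2.1)
    have h2 := q.2.2
    simp only [size]
    omega
  have hbody := hf _ (refl hmem)
  have key : ∃ o, Computes Γ x o ∧ ∀ a, R a ((l a).length) (o a) := by
    let N : A → ℕ := fun a => (l a).length
    have hget : ∀ q : {q : A × ℕ × BTree // R q.1 q.2.1 q.2.2 ∧ q.2.1 < N q.1},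
        (l q.1.1)[q.1.2.1]'(q.2.2) ∈ l q.1.1 := fun q => List.getElem_mem _
    let ψ : {q : A × ℕ × BTree // R q.1 q.2.1 q.2.2 ∧ q.2.1 < N q.1} → FoldStep l eS b := fun q =>
      ⟨⟨q.1.1, (l q.1.1)[q.1.2.1]'(q.2.2), ((l q.1.1).take q.1.2.1).foldl (f _) (i _)⟩,
        hget q, hs _ _⟩
    have hψ := hbody.comap ψ
    have hidb : Computes (Γ.comap fun q : {q : A × ℕ × BTree // R q.1 q.2.1 q.2.2 ∧ q.2.1 < N q.1}
        => q.1.1) (fun q => q.1.2.2) fun q => q.1.2.2 :=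
      refl ((hbd.comap _).mono fun q => by rw [q.2.1]; exact hst _ _)
    have hid : Computes (Γ.comap fun q : {q : A × ℕ × BTree // R q.1 q.2.1 q.2.2 ∧ q.2.1 < N q.1}
        => q.1.1) (fun q => q.1.2.2) fun q => st q.1.1 q.1.2.1 := hidb.congr fun q => q.2.1
    have hid' := hid.congr (y' := fun q => .node (x q.1.1)
        (.node (.node (e q.1.1 ((l q.1.1)[q.1.2.1]'(q.2.2)))
          (ofList (((l q.1.1).map (e q.1.1)).drop (q.1.2.1 + 1))))
        (eS q.1.1 (((l q.1.1).take q.1.2.1).foldl (f _) (i _))))) fun q => by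
      have hlt : q.1.2.1 < ((l q.1.1).map (e q.1.1)).length := by simpa [N] using q.2.2
      simp only [st, BTree.node.injEq, true_and, and_true]
      rw [List.drop_eq_getElem_cons hlt, ofList, List.getElem_map]
    have hz := hid'.fst.node (hid'.snd.fst.snd.node
      ((hid'.fst.node (hid'.snd.fst.fst.node hid'.snd.snd)).trans hψ))
    refine loop (N := N) (c := fun t => t.right.left)
      (hlb.mono fun a => ?_) hbd (fun a n t h _ => h ▸ hst a n) ?_ ?_
      (h0 := hx_node hl hi) (fun a => ?_) hz (fun q => ?_)
    · have := length_lt_size_ofList ((l a).map (e a))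
      rw [List.length_map] at this
      exact this.le
    · exact (refl ((hbd.comap _).mono fun q => by rw [q.2.1]; exact hst _ _)).right.left
    · rintro a n t rfl hn
      simp only [st, BTree.right, BTree.left]
      constructor
      · intro h
        by_contra hne
        have hlt : n < ((l a).map (e a)).length := by
          rw [List.length_map]
          exact lt_of_le_of_ne hn hne
        rw [List.drop_eq_getElem_cons hlt, ofList] at h
        cases h
      · rintro rfl
        rw [List.drop_of_length_le (by simp [N]), ofList]
    · simp [R, st]
    · simp only [R, st, BTree.node.injEq, true_and, ψ]
      have hlt : q.1.2.1 < (l q.1.1).length := q.2.2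
      rw [← List.take_concat_get' _ _ hlt, List.foldl_append]
      rfl
  obtain ⟨o, ho, hoR⟩ := key
  refine (ho.right.right).congr fun a => ?_
  rw [hoR a]
  simp [st, BTree.right]
where
  hx_node {u v : A → BTree} (h1 : Computes Γ x u) (h2 : Computes Γ x v) :
      Computes Γ x fun a => .node (x a) (.node (u a) (v a)) := h1.input.node (h1.node h2)

end Computes

namespace Computes

variable {A : Type w} {Γ : Scale A} {x y z : A → BTree}

lemma cons {t : A → BTree} {l : A → List BTree} (ht : Computes Γ x t)
    (hl : Computes Γ x fun a => ofList (l a)) : Computes Γ x fun a => ofList (t a :: l a) :=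
  ht.node hl

lemma nilList (h : Computes Γ x x) : Computes Γ x fun _ => ofList [] := h.nil

lemma revAppend {l l' : A → List BTree} (h : Computes Γ x fun a => ofList (l a))
    (h' : Computes Γ x fun a => ofList (l' a)) :
    Computes Γ x fun a => ofList ((l a).reverse ++ l' a) := by
  have hrev : ∀ (l l' : List BTree), l.foldl (fun s t => t :: s) l' = l.reverse ++ l' := by
    intro l
    induction l with
    | nil => simp
    | cons t l ih => intro l'; simp [ih]
  have hl : Computes Γ x fun a => ofList ((l a).map id) := by simpa using h
  refine (fold (S := fun _ => List BTree) (f := fun _ s t => t :: s) (eS := fun _ => ofList)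
    _ (h.bdd_out.add h'.bdd_out) hl h' (fun a n => ?_) fun mem hm =>
      hm.snd.fst.node hm.snd.snd).congr fun a => by rw [hrev]
  rw [hrev]
  have h1 := size_ofList_append ((l a).take n).reverse (l' a)
  have h2 := size_ofList_append ((l a).take n) ((l a).drop n)
  rw [List.take_append_drop] at h2
  rw [size_ofList_reverse] at h1
  have := (ofList ((l a).drop n)).size_pos
  omega

lemma reverse {l : A → List BTree} (h : Computes Γ x fun a => ofList (l a)) :
    Computes Γ x fun a => ofList (l a).reverse := by
  have := h.revAppend (l' := fun _ => []) (h.input.nil)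
  simpa using this

lemma append {l l' : A → List BTree} (h : Computes Γ x fun a => ofList (l a))
    (h' : Computes Γ x fun a => ofList (l' a)) : Computes Γ x fun a => ofList (l a ++ l' a) := by
  simpa using h.reverse.revAppend h'

/-- The instances for the body of a loop over the lists `l a` without an accumulator. -/
abbrev Elem {T : A → Type*} (l : ∀ a, List (T a)) := {q : Σ a, T a // q.2 ∈ l q.1}

/-- Concatenating the lists that are computed from the elements of a list. As the elements are
treated separately, the size of the result need not be bounded beforehand. -/
theorem flatMap {T : A → Type*} {l : ∀ a, List (T a)} {e : ∀ a, T a → BTree}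
    {f : ∀ a, T a → List BTree} (hl : Computes Γ x fun a => ofList ((l a).map (e a)))
    (hf : ∀ (mem : Elem l → BTree) (_ : Computes (Γ.comap fun q => q.1.1) mem fun q =>
      .node (x q.1.1) (e q.1.1 q.1.2)),
      Computes (Γ.comap fun q => q.1.1) mem fun q => ofList (f q.1.1 q.1.2)) :
    Computes Γ x fun a => ofList ((l a).flatMap (f a)) := by
  have hmem : (Γ.comap fun q : Elem l => q.1.1).Bdd fun q =>
      (BTree.node (x q.1.1) (e q.1.1 q.1.2)).size := by
    refine (((hl.bdd_in.add hl.bdd_out).add (Scale.bdd_const 1)).comap _).mono fun q => ?_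
    have h1 := size_le_of_mem (List.mem_map_of_mem (f := e q.1.1) q.2)
    simp only [size]
    omega
  have hbody := hf _ (refl hmem)
  obtain ⟨g, hg, hfg⟩ := hbody.bdd_out.exists_of_comap
  have hb := (hl.bdd_out.mul hg).add (Scale.bdd_const (Γ := Γ) 1)
  have hflat : ∀ a (l : List (T a)) (s : List BTree),
      l.foldl (fun s t => s ++ f a t) s = s ++ l.flatMap (f a) := by
    intro a l
    induction l with
    | nil => simp
    | cons t l ih => intro s; simp [ih]
  refine (fold (S := fun _ => List BTree) (f := fun a s t => s ++ f a t) (eS := fun _ => ofList)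
    (i := fun _ => []) _ hb hl hl.input.nil (fun a n => ?_) fun mem hm => ?_).congr fun a => by
      rw [hflat]; rfl
  · rw [hflat, List.nil_append]
    refine (size_ofList_flatMap_le _ _ (g a) fun t ht =>
      hfg ⟨⟨a, t⟩, List.mem_of_mem_take ht⟩).trans ?_
    have h1 := length_lt_size_ofList ((l a).map (e a))
    have h2 : ((l a).take n).length ≤ (l a).length := by simp
    rw [List.length_map] at h1
    have := Nat.mul_le_mul_right (g a) (h2.trans h1.le)
    omega
  · have h1 := hm.fst.node hm.snd.fst
    exact hm.snd.snd.append (h1.trans (hbody.comap fun q : FoldStep l _ _ =>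
      (⟨⟨q.1.1, q.1.2.1⟩, q.2.1⟩ : Elem l)))

theorem map {T : A → Type*} {l : ∀ a, List (T a)} {e : ∀ a, T a → BTree}
    {f : ∀ a, T a → BTree} (hl : Computes Γ x fun a => ofList ((l a).map (e a)))
    (hf : ∀ (mem : Elem l → BTree) (_ : Computes (Γ.comap fun q => q.1.1) mem fun q =>
      .node (x q.1.1) (e q.1.1 q.1.2)),
      Computes (Γ.comap fun q => q.1.1) mem fun q => f q.1.1 q.1.2) :
    Computes Γ x fun a => ofList ((l a).map (f a)) := by
  refine (flatMap (f := fun a t => [f a t]) hl fun mem hm => (hf mem hm).cons hm.input.nil).congr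
    fun a => ?_
  congr 1
  exact List.map_eq_flatMap.symm

theorem filter {T : A → Type*} {l : ∀ a, List (T a)} {e : ∀ a, T a → BTree}
    {p : ∀ a, T a → Bool} (hl : Computes Γ x fun a => ofList ((l a).map (e a)))
    (hp : ∀ (mem : Elem l → BTree) (_ : Computes (Γ.comap fun q => q.1.1) mem fun q =>
      .node (x q.1.1) (e q.1.1 q.1.2)),
      Computes (Γ.comap fun q => q.1.1) mem fun q => ofBool (p q.1.1 q.1.2)) :
    Computes Γ x fun a => ofList (((l a).filter (p a)).map (e a)) := by
  refine (flatMap (f := fun a t => if p a t = true then [e a t] else []) hl fun mem hm =>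
    ((hp mem hm).ite (hm.snd.cons hm.input.nilList) hm.input.nilList).congr fun q => ?_).congr
    fun a => ?_
  · split_ifs <;> rfl
  · congr 1
    induction l a with
    | nil => rfl
    | cons t l ih =>
      rw [List.flatMap_cons, ih, List.filter_cons]
      split_ifs <;> simp

lemma any {T : A → Type*} {l : ∀ a, List (T a)} {e : ∀ a, T a → BTree}
    {p : ∀ a, T a → Bool} (hl : Computes Γ x fun a => ofList ((l a).map (e a)))
    (hp : ∀ (mem : Elem l → BTree) (_ : Computes (Γ.comap fun q => q.1.1) mem fun q =>
      .node (x q.1.1) (e q.1.1 q.1.2)),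
      Computes (Γ.comap fun q => q.1.1) mem fun q => ofBool (p q.1.1 q.1.2)) :
    Computes Γ x fun a => ofBool ((l a).any (p a)) := by
  classical
  refine ((filter hl hp).isNil.not).congr fun a => ?_
  congr 1
  induction l a with
  | nil => simp [ofList]
  | cons t l ih =>
    rw [List.filter_cons, List.any_cons]
    cases p a t
    · simpa using ih
    · simp [ofList]

end Computes

/-! ### Arithmetic -/

namespace BTree

lemma ofNat_eq_ofList (n : ℕ) : ofNat n = ofList (List.replicate n nil) := by
  induction n with
  | zero => rfl
  | succ n ih => rw [ofNat, ih]; rfl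

lemma size_ofNat (n : ℕ) : (ofNat n).size = 2 * n + 1 := by
  induction n with
  | zero => rfl
  | succ n ih => simp only [ofNat, size, ih]; ring

lemma size_ofBool_le (b : Bool) : (ofBool b).size ≤ 3 := by cases b <;> simp [ofBool, size]

lemma size_ofBits_le (w : List Bool) : (ofBits w).size ≤ 4 * w.length + 1 := by
  induction w with
  | nil => simp [ofBits, ofList, size]
  | cons b w ih =>
    have := size_ofBool_le b
    have h : (ofBits (b :: w)).size = (ofBool b).size + (ofBits w).size + 1 := rfl
    rw [h, List.length_cons]
    omega

lemma length_lt_size_ofBits (w : List Bool) : w.length < (ofBits w).size := by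
  simpa [ofBits] using length_lt_size_ofList (w.map ofBool)

/-- A natural number in binary. -/
def ofBin (n : ℕ) : BTree := ofBits n.bits

lemma bits_eq {n : ℕ} (h : n ≠ 0) : n.bits = n.bodd :: (n / 2).bits := by
  have h0 := Nat.bit_bodd_div2 n
  rw [Nat.div2_val] at h0
  conv_lhs => rw [← h0]
  refine Nat.bits_append_bit _ _ fun h' => ?_
  rw [h'] at h0
  cases hb : n.bodd
  · rw [hb] at h0; exact absurd h0.symm h
  · rfl

lemma ofBin_left (n : ℕ) : (ofBin n).left = ofBool n.bodd := by
  rcases eq_or_ne n 0 with rfl | h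
  · simp [ofBin, ofBits, ofList, left, ofBool]
  · rw [ofBin, bits_eq h]; rfl

lemma ofBin_right (n : ℕ) : (ofBin n).right = ofBin (n / 2) := by
  rcases eq_or_ne n 0 with rfl | h
  · simp [ofBin, ofBits, ofList, right]
  · rw [ofBin, bits_eq h]; rfl

lemma ofBin_eq_nil {n : ℕ} : ofBin n = nil ↔ n = 0 := by
  constructor
  · intro h
    by_contra hn
    rw [ofBin, bits_eq hn] at h
    cases h
  · rintro rfl; simp [ofBin, ofBits, ofList]

lemma ofBin_bit (b : Bool) (n : ℕ) :
    ofBin (Nat.bit b n) = if (!b && decide (n = 0)) = true then nil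
      else node (ofBool b) (ofBin n) := by
  by_cases h : n = 0 ∧ b = false
  · obtain ⟨rfl, rfl⟩ := h
    simp [ofBin, ofBits, ofList]
  · rw [if_neg (by simpa [and_comm] using h), ofBin, Nat.bits_append_bit n b
      fun hn => by simpa [hn] using h]
    rfl

lemma size_ofBin_le (n : ℕ) : (ofBin n).size ≤ 4 * n.size + 1 := by
  rw [← Nat.size_eq_bits_len]
  exact size_ofBits_le _

lemma natSize_lt_size_ofBin (n : ℕ) : n.size < (ofBin n).size := by
  rw [← Nat.size_eq_bits_len]
  exact length_lt_size_ofBits _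

lemma ofInt_eq (z : ℤ) : ofInt z = node (ofBool (decide (z < 0))) (ofBin z.natAbs) := rfl

lemma size_ofInt_le {z : ℤ} {q : ℕ} (h : z.natAbs < 2 ^ q) : (ofInt z).size ≤ 4 * q + 5 := by
  have h1 := size_ofBool_le (decide (z < 0))
  have h2 := size_ofBin_le z.natAbs
  have h3 := Nat.size_le.2 h
  rw [ofInt_eq, size]
  omega

lemma natAbs_lt_two_pow_size (z : ℤ) : z.natAbs < 2 ^ (ofInt z).size := by
  refine (Nat.lt_size_self _).trans_le (Nat.pow_le_pow_right (by norm_num) ?_)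
  have := natSize_lt_size_ofBin z.natAbs
  rw [ofInt_eq, size]
  omega

end BTree

namespace Computes

variable {A : Type w} {Γ : Scale A} {x y z : A → BTree}

/-- The list of the numbers below `n`, together with their parities. -/
lemma range {n : A → ℕ} (h : Computes Γ x fun a => ofNat (n a)) :
    Computes Γ x fun a => ofList ((List.range (n a)).map fun i =>
      .node (ofNat i) (ofBool i.bodd)) := by
  let g : ℕ → BTree := fun i => .node (ofNat i) (ofBool i.bodd)
  let eS : ℕ → BTree := fun i =>
    .node (ofNat i) (.node (ofBool i.bodd) (ofList ((List.range i).reverse.map g)))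
  have hl : Computes Γ x fun a => ofList ((List.replicate (n a) BTree.nil).map id) :=
    h.congr fun a => by rw [List.map_id, ofNat_eq_ofList]
  have hit : ∀ (l : List BTree), l.foldl (fun s _ => s + 1) 0 = l.length := fun l => by
    simp [List.foldl_const]
  have hn := h.bdd_out
  have hsz : ∀ i, (eS i).size ≤ (2 * i + 10) * (2 * i + 10) := by
    intro i
    have h1 := size_ofList_flatMap_le (List.range i).reverse (fun i => [g i]) (2 * i + 8)
      fun j hj => by
        have h2 := size_ofNat j
        have h3 := size_ofBool_le j.bodd
        simp only [List.mem_reverse, List.mem_range] at hj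
        simp only [g, ofList, size]
        omega
    rw [← List.map_eq_flatMap, List.length_reverse, List.length_range] at h1
    have h2 := size_ofNat i
    have h3 := size_ofBool_le i.bodd
    simp only [eS, size]
    nlinarith
  have hb := (hn.add (Scale.bdd_const (Γ := Γ) 10)).mul (hn.add (Scale.bdd_const (Γ := Γ) 10))
  have key := fold (S := fun _ => ℕ) (f := fun _ s _ => s + 1) (eS := fun _ => eS)
    (i := fun _ => 0) _ hb hl (const (eS 0) h.input) (fun a k => ?_) fun mem hm => ?_
  · refine (key.snd.snd.reverse).congr fun a => ?_
    rw [hit, List.length_replicate, ← List.map_reverse, List.reverse_reverse]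
  · rw [hit]
    refine (hsz _).trans ?_
    have h1 : ((List.replicate (n a) BTree.nil).take k).length ≤ n a := by simp
    have h2 := size_ofNat (n a)
    exact Nat.mul_le_mul (by omega) (by omega)
  · have hs := hm.snd.snd
    have h1 := hs.fst
    have h2 := hs.snd.fst
    have h3 := hs.snd.snd
    refine ((h1.input.nil.node h1).node (h2.not.node ((h1.node h2).cons h3))).congr fun q => ?_
    simp [eS, g, ofNat, List.range_succ, ofList]

/-- Comparison of bit strings. -/
lemma eqBits {u v : A → List Bool} (hu : Computes Γ x fun a => ofBits (u a))
    (hv : Computes Γ x fun a => ofBits (v a)) :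
    Computes Γ x fun a => ofBool (decide (u a = v a)) := by
  classical
  -- The state is the part of `v` that is still to be compared, or `none` after a mismatch.
  let f : Option (List Bool) → Bool → Option (List Bool) := fun s b =>
    s.bind fun r => if r.head? = some b then some r.tail else none
  let eS : Option (List Bool) → BTree := fun s => s.elim .nil fun r => .node .nil (ofBits r)
  have hf : ∀ (u v r : List Bool), u.foldl f (some v) = some r ↔ v = u ++ r := by
    intro u
    induction u with
    | nil => intro v r; simp
    | cons b u ih =>
      intro v r
      have hnone : u.foldl f none = none := by
        clear ih
        induction u with
        | nil => rfl
        | cons c u ih => exact ih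
      rcases v with _ | ⟨c, v⟩
      · simp [f, hnone]
      · by_cases hcb : c = b
        · subst hcb
          simp only [List.foldl_cons, f, Option.bind_some, List.head?_cons, List.tail_cons,
            if_true, List.cons_append, List.cons.injEq, true_and]
          exact ih v r
        · simp [f, hcb, hnone]
  have hb := hv.bdd_out.add (Scale.bdd_const (Γ := Γ) 2)
  have key := fold (S := fun _ => Option (List Bool)) (T := fun _ => Bool) (l := u)
    (e := fun _ => ofBool) (f := fun _ => f) (eS := fun _ => eS) (i := fun a => some (v a)) _ hb hu
    (hu.input.nil.node hv) (fun a n => ?_) fun mem hm => ?_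
  · refine (((key.isNil.or key.right.isNil.not).not).congr fun a => ?_)
    congr 1
    have h := hf (u a) (v a)
    rcases hs : (u a).foldl f (some (v a)) with _ | r
    · have h' := h []
      rw [hs] at h'
      have : u a ≠ v a := fun e => by simp [e] at h'
      simp [eS, this]
    · have h' := (h r).1 hs
      rw [h']
      rcases r with _ | ⟨c, r⟩
      · simp [eS, BTree.right, ofBits, ofList]
      · simp [eS, BTree.right, ofBits, ofList]
  · rcases hs : ((u a).take n).foldl f (some (v a)) with _ | r
    · simp [eS, size]
    · have h := (hf _ _ _).1 hs
      have h2 := size_ofList_append (((u a).take n).map ofBool) (r.map ofBool)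
      rw [← List.map_append, ← h] at h2
      have := (ofList (((u a).take n).map ofBool)).size_pos
      simp only [eS, size, Option.elim, ofBits]
      omega
  · have hs := hm.snd.snd
    have hd := hm.snd.fst
    have h1 := hs.isNil
    have h2 := hs.right
    -- For a remaining part `c :: r` of `v`, the bits `c` and `b` are compared.
    have hc : Computes (Γ.comap fun q => q.1.1) mem fun q : FoldStep u (fun _ => eS) _ =>
        ofBool ((q.1.2.2.bind List.head?).getD false) := h2.left.congr fun q => by
      rcases q.1.2.2 with _ | _ | ⟨c, r⟩ <;> rfl
    have heq : Computes (Γ.comap fun q => q.1.1) mem fun q : FoldStep u (fun _ => eS) _ =>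
        ofBool ((q.1.2.2.bind List.head?).getD false == q.1.2.1) :=
      hc.bool (f := fun q b => ofBool (b == q.1.2.1)) fun b => by
        cases b
        · exact hd.not.congr fun q => by cases q.1.2.1 <;> rfl
        · exact hd.congr fun q => by cases q.1.2.1 <;> rfl
    refine ((h1.or (h2.isNil.or heq.not)).ite hs.input.nil
      (hs.input.nil.node h2.right)).congr fun q => ?_
    rcases q.1.2.2 with _ | _ | ⟨c, r⟩
    · simp [eS, f]
    · simp [eS, f, ofBits, ofList, BTree.right]
    · by_cases hcb : c = q.1.2.1
      · simp [eS, f, hcb, ofBits, ofList, BTree.right]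
      · simp [eS, f, hcb, ofBits, ofList, BTree.right]

lemma half {n : A → ℕ} (h : Computes Γ x fun a => ofBin (n a)) :
    Computes Γ x fun a => ofBin (n a / 2) := h.right.congr fun _ => ofBin_right _

lemma bodd {n : A → ℕ} (h : Computes Γ x fun a => ofBin (n a)) :
    Computes Γ x fun a => ofBool (n a).bodd := h.left.congr fun _ => ofBin_left _

lemma natBit {n : A → ℕ} {b : A → Bool} (hb : Computes Γ x fun a => ofBool (b a))
    (h : Computes Γ x fun a => ofBin (n a)) : Computes Γ x fun a => ofBin (Nat.bit (b a) (n a)) :=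
  ((hb.not.and (h.isNil.congr (y' := fun a => ofBool (decide (n a = 0))) fun a => by
    simp [ofBin_eq_nil])).ite h.input.nil (hb.node h)).congr fun a => by rw [ofBin_bit]

end Computes

/-- One step of the schoolbook addition (for `s = false`) or subtraction (for `s = true`) of binary
numbers. The state consists of the parts of the two numbers that are not yet processed, the carry,
and the digits obtained so far, the most significant digit first. -/
def ripple (s : Bool) (q : ℕ × ℕ × Bool × List Bool) : ℕ × ℕ × Bool × List Bool :=
  let c := q.1.bodd ^^ s
  let d := q.2.1.bodd
  (q.1 / 2, q.2.1 / 2, (c && d) || (q.2.2.1 && (c || d)),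
    ((q.1.bodd ^^ d) ^^ q.2.2.1) :: q.2.2.2)

/-- The number with digits `w`, the most significant digit first, and `z` before these digits. -/
def digitsVal (w : List Bool) (z : ℤ) : ℤ := w.foldl (fun z b => 2 * z + (b.toNat : ℤ)) z

/-- The number represented by a state of `ripple`. -/
def rippleVal (s : Bool) (q : ℕ × ℕ × Bool × List Bool) : ℤ :=
  digitsVal q.2.2.2 (q.1 + (if s then -1 else 1) * (q.2.1 + (q.2.2.1.toNat : ℤ)))

lemma rippleVal_ripple (s : Bool) (q : ℕ × ℕ × Bool × List Bool) :
    rippleVal s (ripple s q) = rippleVal s q := by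
  obtain ⟨a, b, c, w⟩ := q
  have ha := Nat.bodd_add_div2 a
  have hb := Nat.bodd_add_div2 b
  rw [Nat.div2_val] at ha hb
  simp only [rippleVal, ripple, digitsVal, List.foldl_cons]
  congr 1
  generalize a / 2 = a' at *
  generalize b / 2 = b' at *
  generalize a.bodd = a₀ at *
  generalize b.bodd = b₀ at *
  subst ha hb
  cases s <;> cases a₀ <;> cases b₀ <;> cases c <;> simp <;> ring

lemma rippleVal_iterate (s : Bool) (q : ℕ × ℕ × Bool × List Bool) (n : ℕ) :
    rippleVal s ((ripple s)^[n] q) = rippleVal s q := by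
  induction n with
  | zero => rfl
  | succ n ih => rw [Function.iterate_succ_apply', rippleVal_ripple, ih]

lemma ripple_iterate (s : Bool) (q : ℕ × ℕ × Bool × List Bool) (n : ℕ) :
    ((ripple s)^[n] q).1 = q.1 / 2 ^ n ∧ ((ripple s)^[n] q).2.1 = q.2.1 / 2 ^ n ∧
      ((ripple s)^[n] q).2.2.2.length = q.2.2.2.length + n := by
  induction n with
  | zero => simp
  | succ n ih =>
    rw [Function.iterate_succ_apply']
    simp only [ripple, ih, List.length_cons, pow_succ, Nat.div_div_eq_div_mul]
    exact ⟨trivial, trivial, rfl⟩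

/-- The final state of `ripple` on two numbers. -/
def rippleEnd (s : Bool) (m n : ℕ) : ℕ × ℕ × Bool × List Bool :=
  (ripple s)^[m.size + n.size] (m, n, false, [])

lemma digitsVal_rippleEnd (s : Bool) (m n : ℕ) :
    digitsVal (rippleEnd s m n).2.2.2
      ((if s then -1 else 1) * ((rippleEnd s m n).2.2.1.toNat : ℤ)) =
      m + (if s then -1 else 1) * n := by
  have h := rippleVal_iterate s (m, n, false, []) (m.size + n.size)
  obtain ⟨h1, h2, -⟩ := ripple_iterate s (m, n, false, []) (m.size + n.size)
  simp only [rippleVal] at h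
  rw [h1, h2] at h
  have e1 : m / 2 ^ (m.size + n.size) = 0 := Nat.div_eq_of_lt
    (m.lt_size_self.trans_le (Nat.pow_le_pow_right (by norm_num) (by omega)))
  have e2 : n / 2 ^ (m.size + n.size) = 0 := Nat.div_eq_of_lt
    (n.lt_size_self.trans_le (Nat.pow_le_pow_right (by norm_num) (by omega)))
  simp only [e1, e2] at h
  simpa [digitsVal, rippleEnd] using h

lemma digitsVal_natCast (w : List Bool) (n : ℕ) :
    digitsVal w n = (w.foldl (fun n b => Nat.bit b n) n : ℕ) := by
  induction w generalizing n with
  | nil => rfl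
  | cons b w ih =>
    have := ih (Nat.bit b n)
    simp only [digitsVal, List.foldl_cons] at this ⊢
    rw [← this]
    congr 1
    cases b <;> simp [Nat.bit]

lemma digitsVal_neg (w : List Bool) {z : ℤ} (h : z < 0) : digitsVal w z < 0 := by
  induction w generalizing z with
  | nil => exact h
  | cons b w ih => exact ih (by cases b <;> simp <;> omega)

lemma foldl_bit_rippleEnd_false (m n : ℕ) : (rippleEnd false m n).2.2.2.foldl
    (fun n b => Nat.bit b n) (rippleEnd false m n).2.2.1.toNat = m + n := by
  have h := digitsVal_rippleEnd false m n
  simp only [Bool.false_eq_true, if_false, one_mul] at h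
  rw [digitsVal_natCast] at h
  exact_mod_cast h

lemma rippleEnd_true (m n : ℕ) : (rippleEnd true m n).2.2.1 = decide (m < n) := by
  have h := digitsVal_rippleEnd true m n
  cases hc : (rippleEnd true m n).2.2.1
  · rw [hc] at h
    have h' := digitsVal_natCast (rippleEnd true m n).2.2.2 0
    simp at h h'
    rw [h] at h'
    symm
    simp
    omega
  · rw [hc] at h
    have h' := digitsVal_neg (rippleEnd true m n).2.2.2 (z := -1) (by norm_num)
    simp at h h'
    rw [h] at h'
    symm
    simp
    omega

lemma foldl_bit_rippleEnd_true {m n : ℕ} (hmn : n ≤ m) : (rippleEnd true m n).2.2.2.foldl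
    (fun n b => Nat.bit b n) 0 = m - n := by
  have h := digitsVal_rippleEnd true m n
  rw [rippleEnd_true, decide_eq_false (by omega)] at h
  have h' := digitsVal_natCast (rippleEnd true m n).2.2.2 0
  simp at h h'
  omega

lemma foldl_bit_lt (w : List Bool) (n : ℕ) :
    w.foldl (fun n b => Nat.bit b n) n < (n + 1) * 2 ^ w.length := by
  induction w generalizing n with
  | nil => simp
  | cons b w ih =>
    refine (ih _).trans_le ?_
    rw [List.length_cons, pow_succ', ← mul_assoc]
    refine Nat.mul_le_mul_right _ ?_
    cases b <;> simp [Nat.bit] <;> omega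

namespace Computes

variable {A : Type w} {Γ : Scale A} {x y z : A → BTree}

/-- The encoding of the states of `ripple`. -/
def ofRipple (q : ℕ × ℕ × Bool × List Bool) : BTree :=
  .node (ofBin q.1) (.node (ofBin q.2.1) (.node (ofBool q.2.2.1) (ofBits q.2.2.2)))

lemma rippleEnd (s : Bool) {m n : A → ℕ} (hm : Computes Γ x fun a => ofBin (m a))
    (hn : Computes Γ x fun a => ofBin (n a)) :
    Computes Γ x fun a => ofRipple (PolyTimeHomology.rippleEnd s (m a) (n a)) := by
  have hclock : Computes Γ x fun a =>
      ofList (((m a).bits ++ (n a).bits).map ofBool) :=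
    (hm.append hn).congr fun a => by rw [List.map_append]
  have hstart : Computes Γ x fun a => ofRipple (m a, n a, false, []) :=
    hm.node (hn.node (hm.input.nil.node hm.input.nil))
  have hb := (hm.bdd_out.add hn.bdd_out).mul (Scale.bdd_const (Γ := Γ) 20)
  have hsz : ∀ m n k, k ≤ m.size + n.size → (ofRipple ((ripple s)^[k] (m, n, false, []))).size ≤
      ((ofBin m).size + (ofBin n).size) * 20 := by
    intro m n k hk
    obtain ⟨h1, h2, h3⟩ := ripple_iterate s (m, n, false, []) k
    have h4 := size_ofBin_le ((ripple s)^[k] (m, n, false, [])).1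
    have h5 := size_ofBin_le ((ripple s)^[k] (m, n, false, [])).2.1
    have h6 := size_ofBool_le ((ripple s)^[k] (m, n, false, [])).2.2.1
    have h7 := size_ofBits_le ((ripple s)^[k] (m, n, false, [])).2.2.2
    have h8 := Nat.size_le_size (Nat.div_le_self m (2 ^ k))
    have h9 := Nat.size_le_size (Nat.div_le_self n (2 ^ k))
    have h10 := natSize_lt_size_ofBin m
    have h11 := natSize_lt_size_ofBin n
    rw [← h1] at h8
    rw [← h2] at h9
    simp only [List.length_nil] at h3
    simp only [ofRipple, size]
    omega
  refine (fold (S := fun _ => ℕ × ℕ × Bool × List Bool) (T := fun _ => Bool)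
    (f := fun _ q _ => ripple s q) (eS := fun _ => ofRipple) _ hb hclock hstart
    (fun a k => ?_) fun mem hmem => ?_).congr fun a => ?_
  · rw [List.foldl_const]
    refine hsz _ _ _ ?_
    rw [← Nat.size_eq_bits_len, ← Nat.size_eq_bits_len, List.length_take, List.length_append]
    exact min_le_right _ _
  · have hs := hmem.snd.snd
    have h1 := hs.fst
    have h2 := hs.snd.fst
    have h3 := hs.snd.snd.fst
    have h4 := hs.snd.snd.snd
    have h5 : ∀ s, Computes (Γ.comap fun q => q.1.1) mem fun q => ofBool (q.1.2.2.1.bodd ^^ s) := by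
      intro s
      cases s
      · simpa using h1.bodd
      · simpa using h1.bodd.not
    have hxor : ∀ {c d : FoldStep (fun a => (m a).bits ++ (n a).bits) (fun _ => ofRipple)
        (fun a => ((ofBin (m a)).size + (ofBin (n a)).size) * 20) → Bool},
        (Computes (Γ.comap fun q => q.1.1) mem fun q => ofBool (c q)) →
        (Computes (Γ.comap fun q => q.1.1) mem fun q => ofBool (d q)) →
        Computes (Γ.comap fun q => q.1.1) mem fun q => ofBool (c q ^^ d q) := by
      intro c d hc hd
      refine hc.bool (f := fun q b => ofBool (b ^^ d q)) fun b => ?_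
      cases b
      · simpa using hd
      · simpa using hd.not
    exact h1.half.node (h2.half.node
      ((((h5 s).and h2.bodd).or (h3.and ((h5 s).or h2.bodd))).node
        ((hxor (hxor h1.bodd h2.bodd) h3).cons h4)))
  · rw [List.foldl_const, List.length_append, Nat.size_eq_bits_len, Nat.size_eq_bits_len]
    rfl

lemma foldlBit {w : A → List Bool} {b : A → Bool} (hw : Computes Γ x fun a => ofBits (w a))
    (hb : Computes Γ x fun a => ofBool (b a)) :
    Computes Γ x fun a => ofBin ((w a).foldl (fun n b => Nat.bit b n) (b a).toNat) := by
  have hbd := (hw.bdd_out.add (Scale.bdd_const (Γ := Γ) 2)).mul (Scale.bdd_const (Γ := Γ) 4)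
  refine fold (S := fun _ => ℕ) (T := fun _ => Bool) (e := fun _ => ofBool)
    (f := fun _ n b => Nat.bit b n) (eS := fun _ => ofBin) _ hbd hw
    (hb.bool (f := fun _ b => ofBin b.toNat) fun b => const _ hb.input) (fun a k => ?_)
    fun mem hm => hm.snd.fst.natBit hm.snd.snd
  have h1 := foldl_bit_lt ((w a).take k) (b a).toNat
  have h2 : ((b a).toNat + 1) * 2 ^ ((w a).take k).length ≤ 2 ^ ((w a).length + 1) := by
    rw [pow_succ']
    exact Nat.mul_le_mul (by cases b a <;> simp) (Nat.pow_le_pow_right (by norm_num) (by simp))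
  have h3 := Nat.size_le.2 (h1.trans_le h2)
  have h4 := length_lt_size_ofBits (w a)
  have h5 := size_ofBin_le (((w a).take k).foldl (fun n b => Nat.bit b n) (b a).toNat)
  omega

lemma add {m n : A → ℕ} (hm : Computes Γ x fun a => ofBin (m a))
    (hn : Computes Γ x fun a => ofBin (n a)) : Computes Γ x fun a => ofBin (m a + n a) :=
  have h := (hm.rippleEnd false hn).snd.snd
  (h.snd.foldlBit h.fst).congr fun _ => by rw [foldl_bit_rippleEnd_false]

lemma lt {m n : A → ℕ} (hm : Computes Γ x fun a => ofBin (m a))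
    (hn : Computes Γ x fun a => ofBin (n a)) : Computes Γ x fun a => ofBool (decide (m a < n a)) :=
  (hm.rippleEnd true hn).snd.snd.fst.congr fun _ => by rw [rippleEnd_true]

lemma intSub {m n : A → ℕ} (hm : Computes Γ x fun a => ofBin (m a))
    (hn : Computes Γ x fun a => ofBin (n a)) : Computes Γ x fun a => ofInt (m a - n a) := by
  have hf : Computes Γ x fun _ => ofBool false := const _ hm.input
  have h1 := (hm.rippleEnd true hn).snd.snd.snd.foldlBit hf
  have h2 := (hn.rippleEnd true hm).snd.snd.snd.foldlBit hf
  refine ((hm.lt hn).ite ((const (ofBool true) hm.input).node h2) (hf.node h1)).congr fun a => ?_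
  by_cases h : m a < n a
  · simp only [h, decide_true, if_true, Bool.toNat_false]
    rw [foldl_bit_rippleEnd_true h.le, ofInt_eq, decide_eq_true (by omega),
      show ((m a : ℤ) - n a).natAbs = n a - m a by omega]
  · simp only [h, decide_false, Bool.false_eq_true, if_false, Bool.toNat_false]
    rw [foldl_bit_rippleEnd_true (not_lt.1 h), ofInt_eq, decide_eq_false (by omega),
      show ((m a : ℤ) - n a).natAbs = m a - n a by omega]

lemma intIsZero {n : A → ℤ} (h : Computes Γ x fun a => ofInt (n a)) :
    Computes Γ x fun a => ofBool (decide (n a = 0)) :=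
  (h.congr fun a => ofInt_eq (n a)).snd.isNil.congr fun a => by
    simp [ofBin_eq_nil]

/-- A number or its negative, according to a bit. -/
lemma signed {n : A → ℤ} {s : A → Bool} (h : Computes Γ x fun a => ofInt (n a))
    (hs : Computes Γ x fun a => ofBool (s a)) :
    Computes Γ x fun a => ofInt (if s a = true then -n a else n a) := by
  refine (hs.ite ((h.intIsZero.not.and h.fst.not).node h.snd) h).congr fun a => ?_
  cases s a
  · rfl
  · simp only [if_true, ofInt_eq, Int.natAbs_neg]
    congr 2
    by_cases h0 : n a = 0
    · simp [h0]
    · by_cases h1 : n a < 0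
      · simp [h1, h1.le]
      · simp [h0, h1]
        omega

/-- The sum of a list of integers. -/
lemma intSum {l : A → List ℤ} (h : Computes Γ x fun a => ofList ((l a).map ofInt)) :
    Computes Γ x fun a => ofInt (l a).sum := by
  -- Positive and negative terms are added up separately, and are subtracted at the end.
  let f : ℕ × ℕ → ℤ → ℕ × ℕ := fun s z => (s.1 + z.toNat, s.2 + (-z).toNat)
  let eS : ℕ × ℕ → BTree := fun s => .node (ofBin s.1) (ofBin s.2)
  have hsum : ∀ (l : List ℤ) (s : ℕ × ℕ),
      ((l.foldl f s).1 : ℤ) - (l.foldl f s).2 = s.1 - s.2 + l.sum := by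
    intro l
    induction l with
    | nil => simp
    | cons z l ih =>
      intro s
      rw [List.foldl_cons, ih, List.sum_cons]
      simp only [f]
      omega
  have hbd : ∀ (l : List ℤ) (s : ℕ × ℕ),
      (l.foldl f s).1 + (l.foldl f s).2 = s.1 + s.2 + (l.map Int.natAbs).sum := by
    intro l
    induction l with
    | nil => simp
    | cons z l ih =>
      intro s
      rw [List.foldl_cons, ih, List.map_cons, List.sum_cons]
      simp only [f]
      omega
  have hpow : ∀ l : List ℤ, (l.map Int.natAbs).sum < 2 ^ (ofList (l.map ofInt)).size := by
    intro l
    induction l with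
    | nil => simp
    | cons z l ih =>
      rw [List.map_cons, List.map_cons, size_ofList_cons, List.sum_cons]
      have h1 := natAbs_lt_two_pow_size z
      have h2 : 2 ^ (ofInt z).size ≤ 2 ^ ((ofInt z).size + (ofList (l.map ofInt)).size) :=
        Nat.pow_le_pow_right (by norm_num) (by omega)
      have h3 : 2 ^ (ofList (l.map ofInt)).size ≤
          2 ^ ((ofInt z).size + (ofList (l.map ofInt)).size) :=
        Nat.pow_le_pow_right (by norm_num) (by omega)
      rw [pow_succ]
      omega
  have hb := (h.bdd_out.mul (Scale.bdd_const (Γ := Γ) 8)).add (Scale.bdd_const (Γ := Γ) 3)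
  have key := fold (S := fun _ => ℕ × ℕ) (T := fun _ => ℤ) (f := fun _ => f) (eS := fun _ => eS)
    (i := fun _ => (0, 0)) _ hb h (const (eS (0, 0)) h.input) (fun a k => ?_) fun mem hm => ?_
  · exact (key.fst.intSub key.snd).congr fun a => by rw [hsum]; simp
  · have h1 := hbd ((l a).take k) (0, 0)
    have h2 := hpow (l a)
    have h3 : (((l a).take k).map Int.natAbs).sum ≤ ((l a).map Int.natAbs).sum := by
      conv_rhs => rw [← List.take_append_drop k (l a), List.map_append, List.sum_append]
      exact Nat.le_add_right _ _
    have h4 : ∀ n, n < 2 ^ (ofList ((l a).map ofInt)).size →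
        (ofBin n).size ≤ 4 * (ofList ((l a).map ofInt)).size + 1 := fun n hn => by
      have := Nat.size_le.2 hn
      have := size_ofBin_le n
      omega
    have h5 := h4 (((l a).take k).foldl f (0, 0)).1 (by omega)
    have h6 := h4 (((l a).take k).foldl f (0, 0)).2 (by omega)
    simp only [eS, size]
    omega
  · have hz := hm.snd.fst
    have hs := hm.snd.snd
    refine ((hz.fst.ite hs.fst (hs.fst.add hz.snd)).node
      (hz.fst.ite (hs.snd.add hz.snd) hs.snd)).congr fun q => ?_
    have hA : ∀ z : ℤ, z < 0 → z.toNat = 0 ∧ (-z).toNat = z.natAbs := fun z hz => by omega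
    have hB : ∀ z : ℤ, ¬z < 0 → z.toNat = z.natAbs ∧ (-z).toNat = 0 := fun z hz => by omega
    by_cases hneg : q.1.2.1 < 0
    · simp only [eS, f, hneg, decide_true, if_true]
      rw [(hA _ hneg).1, (hA _ hneg).2]
      rfl
    · simp only [eS, f, hneg, decide_false, Bool.false_eq_true, if_false]
      rw [(hB _ hneg).1, (hB _ hneg).2]
      rfl

end Computes

/-! ### Computing with chains -/

/-- The chain given by a list of terms, in which basis elements may be repeated. -/
noncomputable def chainOf {B : Type*} (l : List (B × ℤ)) : B →₀ ℤ :=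
  (l.map fun p => Finsupp.single p.1 p.2).sum

section ChainOf

variable {B : Type*}

@[simp] lemma chainOf_nil : chainOf ([] : List (B × ℤ)) = 0 := rfl

@[simp] lemma chainOf_cons (p : B × ℤ) (l : List (B × ℤ)) :
    chainOf (p :: l) = Finsupp.single p.1 p.2 + chainOf l := rfl

@[simp] lemma chainOf_append (l l' : List (B × ℤ)) :
    chainOf (l ++ l') = chainOf l + chainOf l' := by
  simp [chainOf]

lemma chainOf_flatMap {T : Type*} (l : List T) (f : T → List (B × ℤ)) :
    chainOf (l.flatMap f) = (l.map fun t => chainOf (f t)).sum := by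
  induction l with
  | nil => rfl
  | cons t l ih => simp [ih]

open Classical in
lemma chainOf_apply (l : List (B × ℤ)) (b : B) :
    chainOf l b = ((l.filter fun p => p.1 = b).map Prod.snd).sum := by
  induction l with
  | nil => rfl
  | cons p l ih =>
    rw [chainOf_cons, Finsupp.add_apply, ih, List.filter_cons, Finsupp.single_apply]
    by_cases h : p.1 = b <;> simp [h]

lemma exists_mem_of_chainOf_ne_zero {l : List (B × ℤ)} {b : B} (h : chainOf l b ≠ 0) :
    b ∈ l.map Prod.fst := by
  classical
  rw [chainOf_apply] at h
  by_contra hb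
  refine h ?_
  rw [List.filter_eq_nil_iff.2]
  · rfl
  · intro p hp hpb
    exact hb (List.mem_map.2 ⟨p, hp, by simpa using hpb⟩)

lemma sum_map_of_nodup {M : Type*} [AddCommMonoid M] {l : List B} (hl : l.Nodup) {c : B →₀ ℤ}
    (h : ∀ b, b ∈ l ↔ c b ≠ 0) (f : B → M) : (l.map f).sum = ∑ b ∈ c.support, f b := by
  classical
  rw [← List.sum_toFinset f hl]
  congr 1
  ext b
  simp [h]

lemma chainOf_map_of_nodup {l : List B} (hl : l.Nodup) {c : B →₀ ℤ} (h : ∀ b, b ∈ l ↔ c b ≠ 0) :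
    chainOf (l.map fun b => (b, c b)) = c := by
  rw [chainOf, List.map_map]
  refine (sum_map_of_nodup hl h _).trans ?_
  exact c.sum_single

end ChainOf

/-- `t` lists the basis elements with nonzero coefficient in `c`, with their coefficients. -/
def Represents {B : Type*} (enc : B → List Bool) (c : B →₀ ℤ) (t : BTree) : Prop :=
  ∃ l : List B, l.Nodup ∧ (∀ b, b ∈ l ↔ c b ≠ 0) ∧
    t = .ofList (l.map fun b => .node (.ofBits (enc b)) (.ofInt (c b)))

namespace Represents

variable {B : Type*} {enc : B → List Bool} {c : B →₀ ℤ} {t : BTree}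

lemma eq_nil_iff (h : Represents enc c t) : t = .nil ↔ c = 0 := by
  obtain ⟨l, -, hl, rfl⟩ := h
  rcases l with _ | ⟨b, l⟩
  · simp only [List.map_nil, ofList, true_iff]
    ext b
    by_contra hb
    exact absurd ((hl b).2 hb) (by simp)
  · simp only [List.map_cons, ofList, reduceCtorEq, false_iff]
    rintro rfl
    exact absurd ((hl b).1 (by simp)) (by simp)

lemma size_eq (h : Represents enc c t) : t.size = 1 + ∑ b ∈ c.support,
    ((BTree.ofBits (enc b)).size + (ofInt (c b)).size + 2) := by
  obtain ⟨l, hl, hc, rfl⟩ := h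
  rw [← sum_map_of_nodup hl hc]
  clear hl hc
  induction l with
  | nil => simp [ofList, size]
  | cons b l ih =>
    rw [List.map_cons, size_ofList_cons, ih, List.map_cons, List.sum_cons, size]
    ring

lemma sum_length_le (h : Represents enc c t) : ∑ b ∈ c.support, ((enc b).length + 1) ≤ t.size := by
  rw [h.size_eq]
  refine (Finset.sum_le_sum fun b _ => ?_).trans (Nat.le_add_left _ 1)
  have := length_lt_size_ofBits (enc b)
  omega

lemma norm_lt (h : Represents enc c t) : ∑ b ∈ c.support, (c b).natAbs < 2 ^ t.size := by
  classical
  rw [h.size_eq]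
  induction c.support using Finset.induction_on with
  | empty => simp
  | insert b s hb ih =>
    rw [Finset.sum_insert hb, Finset.sum_insert hb]
    have h1 := natAbs_lt_two_pow_size (c b)
    generalize hu : (BTree.ofBits (enc b)).size = u at *
    generalize hv : ∑ b ∈ s, ((BTree.ofBits (enc b)).size + (ofInt (c b)).size + 2) = v at *
    have h2 : 2 ^ (ofInt (c b)).size ≤ 2 ^ (1 + v + (ofInt (c b)).size) :=
      Nat.pow_le_pow_right (by norm_num) (by omega)
    have h3 : 2 ^ (1 + v) ≤ 2 ^ (1 + v + (ofInt (c b)).size) :=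
      Nat.pow_le_pow_right (by norm_num) (by omega)
    have h4 : 2 ^ (1 + v + (ofInt (c b)).size + 1) ≤
        2 ^ (1 + (u + (ofInt (c b)).size + 2 + v)) :=
      Nat.pow_le_pow_right (by norm_num) (by omega)
    rw [pow_succ] at h4
    omega

/-- A bound on the size of a chain from a set that contains its support and a bound on the bits of
its coefficients. -/
lemma size_le (h : Represents enc c t) {s : Finset B} (hs : c.support ⊆ s) {q : ℕ}
    (hq : ∑ b ∈ c.support, (c b).natAbs < 2 ^ q) :
    t.size ≤ 1 + ∑ b ∈ s, (4 * (enc b).length + 4 * q + 8) := by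
  rw [h.size_eq]
  refine Nat.add_le_add_left ?_ 1
  refine (Finset.sum_le_sum fun b hb => ?_).trans (Finset.sum_le_sum_of_subset hs)
  have h1 := size_ofBits_le (enc b)
  have h2 : (ofInt (c b)).size ≤ 4 * q + 5 := size_ofInt_le
    ((Finset.single_le_sum (f := fun b => (c b).natAbs) (fun _ _ => Nat.zero_le _) hb).trans_lt hq)
  omega

end Represents

/-- A representation of the chain `c a` is computed from `x a`. -/
def ComputesChain {A : Type w} (Γ : Scale A) (x : A → BTree) {B : A → Type*}
    (enc : ∀ a, B a → List Bool) (c : ∀ a, B a →₀ ℤ) : Prop :=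
  ∃ y, Computes Γ x y ∧ ∀ a, Represents (enc a) (c a) (y a)

namespace ComputesChain

variable {A : Type w} {Γ : Scale A} {x : A → BTree} {B : A → Type*} {B' : A → Type*}
  {enc : ∀ a, B a → List Bool} {enc' : ∀ a, B' a → List Bool}

lemma congr {c c' : ∀ a, B a →₀ ℤ} (h : ComputesChain Γ x enc c) (e : ∀ a, c a = c' a) :
    ComputesChain Γ x enc c' := by
  rwa [← funext e]

lemma comap {A' : Type w'} {c : ∀ a, B a →₀ ℤ} (h : ComputesChain Γ x enc c) (φ : A' → A) :
    ComputesChain (Γ.comap φ) (fun b => x (φ b)) (fun b => enc (φ b)) (fun b => c (φ b)) := by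
  obtain ⟨y, hy, h⟩ := h
  exact ⟨_, hy.comap φ, fun b => h _⟩

/-- The term `z · b` of a chain. -/
def ofTerm {B : Type*} (enc : B → List Bool) (p : B × ℤ) : BTree :=
  .node (ofBits (enc p.1)) (ofInt p.2)

section Collect

open Classical in
/-- The list with `b` added in front, unless it contains `b`. -/
noncomputable def collectStep {T : Type*} (s : List T) (b : T) : List T :=
  if b ∈ s then s else b :: s

lemma nodup_collect {T : Type*} (l s : List T) (hs : s.Nodup) :
    (l.foldl collectStep s).Nodup := by
  induction l generalizing s with
  | nil => exact hs
  | cons b l ih =>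
    refine ih _ ?_
    rw [collectStep]
    split_ifs with h
    · exact hs
    · exact hs.cons h

lemma mem_collect {T : Type*} (l s : List T) (b : T) :
    b ∈ l.foldl collectStep s ↔ b ∈ s ∨ b ∈ l := by
  induction l generalizing s with
  | nil => simp
  | cons b' l ih =>
    rw [List.foldl_cons, ih, collectStep]
    split_ifs with h
    · simp only [List.mem_cons]
      constructor
      · tauto
      · rintro (h' | rfl | h') <;> tauto
    · simp only [List.mem_cons]
      tauto

lemma size_collect_le {T : Type*} (e : T → BTree) (l s : List T) :
    (ofList ((l.foldl collectStep s).map e)).size ≤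
      (ofList (s.map e)).size + (ofList (l.map e)).size := by
  induction l generalizing s with
  | nil => exact Nat.le_add_right _ _
  | cons b l ih =>
    refine (ih _).trans ?_
    rw [List.map_cons, size_ofList_cons, collectStep]
    split_ifs
    · omega
    · rw [List.map_cons, size_ofList_cons]
      omega

/-- Removing repetitions from a list of basis elements. -/
lemma collect (henc : ∀ a, Function.Injective (enc a)) {l : ∀ a, List (B a)}
    (h : Computes Γ x fun a => ofList ((l a).map fun b => ofBits (enc a b))) :
    Computes Γ x fun a =>
      ofList (((l a).foldl collectStep []).map fun b => ofBits (enc a b)) := by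
  classical
  refine Computes.fold (S := fun a => List (B a)) (f := fun _ => collectStep)
    (e := fun a b => ofBits (enc a b)) (i := fun _ => [])
    (eS := fun a s => ofList (s.map fun b => ofBits (enc a b))) _
    (h.bdd_out.add (Scale.bdd_const 1)) h h.input.nil (fun a n => ?_) fun mem hm => ?_
  · refine (size_collect_le _ _ _).trans ?_
    have h1 := size_ofList_append (((l a).take n).map fun b => ofBits (enc a b))
      (((l a).drop n).map fun b => ofBits (enc a b))
    rw [← List.map_append, List.take_append_drop] at h1
    have := (ofList (((l a).drop n).map fun b => ofBits (enc a b))).size_pos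
    simp only [List.map_nil, ofList, size]
    omega
  · have hs := hm.snd.snd
    have hany := Computes.any (l := fun q : Computes.FoldStep l
      (fun a (s : List (B a)) => ofList (s.map fun b => ofBits (enc a b))) _ => q.1.2.2)
      (p := fun q b => decide (b = q.1.2.1)) hs fun mem' hm' =>
        (hm'.snd.eqBits (hm.snd.fst.lift hm')).congr fun q => by
          simp [(henc q.1.1.1.1).eq_iff]
    refine (hany.ite hs (hm.snd.fst.cons hs)).congr fun q => ?_
    have : (q.1.2.2.any fun b => decide (b = q.1.2.1)) = decide (q.1.2.1 ∈ q.1.2.2) := by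
      rw [Bool.eq_iff_iff]
      simp
    simp only [this, collectStep, decide_eq_true_eq]
    split_ifs <;> rfl

end Collect

/-- Collecting the terms of a chain. -/
theorem of_list (henc : ∀ a, Function.Injective (enc a)) {l : ∀ a, List (B a × ℤ)}
    (h : Computes Γ x fun a => ofList ((l a).map (ofTerm (enc a)))) :
    ComputesChain Γ x enc fun a => chainOf (l a) := by
  classical
  have hkeys : Computes Γ x fun a =>
      ofList (((l a).map Prod.fst).map fun b => ofBits (enc a b)) :=
    (Computes.map (f := fun a p => ofBits (enc a p.1)) h fun mem hm => hm.snd.fst).congr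
      fun a => by rw [List.map_map]; rfl
  have hcoef : Computes Γ x fun a =>
      ofList ((((l a).map Prod.fst).foldl collectStep []).map fun b =>
      ofTerm (enc a) (b, chainOf (l a) b)) := by
    refine Computes.map (collect henc hkeys) fun mem hm => ?_
    have hfil := Computes.filter (l := fun q : Computes.Elem (fun a => ((l a).map Prod.fst).foldl
      collectStep []) => l q.1.1) (e := fun q => ofTerm (enc q.1.1))
      (p := fun q p => decide (p.1 = q.1.2)) (h.lift hm) fun mem' hm' =>
        (hm'.snd.fst.eqBits (hm.snd.lift hm')).congr fun q => by
          simp [(henc q.1.1.1.1).eq_iff]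
    have hsum := ((hfil.map (f := fun _ p => ofInt p.2) fun mem' hm' => hm'.snd.snd).congr
      (y' := fun q => ofList ((((l q.1.1).filter fun p => p.1 = q.1.2).map Prod.snd).map ofInt))
        (fun q => by rw [List.map_map]; rfl)).intSum
    exact (hm.snd.node hsum).congr fun q => by rw [ofTerm, chainOf_apply]
  refine ⟨_, Computes.filter (p := fun a b => !decide (chainOf (l a) b = 0)) hcoef fun mem hm =>
    hm.snd.snd.intIsZero.not, fun a => ⟨_, (nodup_collect _ [] List.nodup_nil).filter _, ?_, rfl⟩⟩
  intro b
  simp only [List.mem_filter, mem_collect, List.not_mem_nil, false_or, Bool.not_eq_true',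
    decide_eq_false_iff_not, and_iff_right_iff_imp]
  exact exists_mem_of_chainOf_ne_zero

/-- The instances for a computation on the basis elements that occur in the chains `c a`. -/
abbrev Term (c : ∀ a, B a →₀ ℤ) := {q : Σ a, B a // c q.1 q.2 ≠ 0}

/-- The term `± b` of a chain; the bit is set if the sign is negative. -/
def ofSigned {B : Type*} (enc : B → List Bool) (p : B × Bool) : BTree :=
  .node (ofBits (enc p.1)) (ofBool p.2)

/-- The chain given by a list of signed basis elements. -/
noncomputable def signedSum {B : Type*} (l : List (B × Bool)) : B →₀ ℤ :=
  chainOf (l.map fun p => (p.1, if p.2 = true then -1 else 1))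

/-- A linear map is computed on chains if it is computed on the basis elements, with coefficients
`±1`. -/
theorem linear (henc' : ∀ a, Function.Injective (enc' a)) {c : ∀ a, B a →₀ ℤ}
    (hc : ComputesChain Γ x enc c) (φ : ∀ a, (B a →₀ ℤ) →ₗ[ℤ] (B' a →₀ ℤ))
    (r : ∀ a, B a → List (B' a × Bool))
    (hφ : ∀ a b, c a b ≠ 0 → φ a (Finsupp.single b 1) = signedSum (r a b))
    (hr : ∀ (mem : Term c → BTree) (_ : Computes (Γ.comap fun q => q.1.1) mem fun q =>
      .node (x q.1.1) (ofBits (enc q.1.1 q.1.2))),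
      Computes (Γ.comap fun q => q.1.1) mem fun q =>
        ofList ((r q.1.1 q.1.2).map (ofSigned (enc' q.1.1)))) :
    ComputesChain Γ x enc' fun a => φ a (c a) := by
  obtain ⟨y, hy, hrep⟩ := hc
  choose l hnd hmem hly using hrep
  obtain rfl : y = fun a => ofList ((l a).map fun b => ofTerm (enc a) (b, c a b)) := funext hly
  have hlist : Computes Γ x fun a => ofList ((l a).flatMap fun b => (r a b).map fun p =>
      ofTerm (enc' a) (p.1, if p.2 = true then -c a b else c a b)) := by
    refine Computes.flatMap hy fun mem hm => ?_
    let ψ : Computes.Elem l → Term c := fun q => ⟨q.1, (hmem _ _).1 q.2⟩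
    have h1 := (hm.fst.node hm.snd.fst)
    have h0 : Computes (Γ.comap fun q : Term c => q.1.1)
        (fun q => .node (x q.1.1) (ofBits (enc q.1.1 q.1.2)))
        (fun q => .node (x q.1.1) (ofBits (enc q.1.1 q.1.2))) := by
      let ψ' : Term c → Computes.Elem l := fun q => ⟨q.1, (hmem _ _).2 q.2⟩
      exact .refl (h1.bdd_out.comap ψ')
    refine (h1.trans ((hr _ h0).comap ψ)).map (e := fun (q : Computes.Elem l) =>
      ofSigned (enc' q.1.1)) fun mem' hm' => ?_
    exact hm'.snd.fst.node ((hm.snd.snd.lift hm').signed hm'.snd.snd)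
  refine (of_list (l := fun a => (l a).flatMap fun b => (r a b).map fun p =>
    (p.1, if p.2 = true then -c a b else c a b)) henc' (hlist.congr fun a => ?_)).congr fun a => ?_
  · rw [List.map_flatMap]
    congr 2
    funext b
    rw [List.map_map]
    rfl
  · rw [chainOf_flatMap, sum_map_of_nodup (hnd a) (hmem a)]
    conv_rhs => rw [← (c a).sum_single]
    rw [Finsupp.sum, map_sum]
    refine Finset.sum_congr rfl fun b hb => ?_
    rw [← mul_one (c a b), ← smul_eq_mul, ← Finsupp.smul_single, map_smul,
      hφ a b (Finsupp.mem_support_iff.1 hb), signedSum]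
    induction r a b with
    | nil => simp
    | cons p r ih =>
      simp only [List.map_cons, chainOf_cons, smul_add, ih]
      congr 1
      cases p.2 <;> simp

lemma add (henc : ∀ a, Function.Injective (enc a)) {c c' : ∀ a, B a →₀ ℤ}
    (h : ComputesChain Γ x enc c) (h' : ComputesChain Γ x enc c') :
    ComputesChain Γ x enc fun a => c a + c' a := by
  obtain ⟨y, hy, hrep⟩ := h
  obtain ⟨y', hy', hrep'⟩ := h'
  choose l hnd hmem hly using hrep
  choose l' hnd' hmem' hly' using hrep'
  obtain rfl : y = fun a => ofList ((l a).map fun b => ofTerm (enc a) (b, c a b)) := funext hly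
  obtain rfl : y' = fun a => ofList ((l' a).map fun b => ofTerm (enc a) (b, c' a b)) := funext hly'
  refine (of_list (l := fun a => (l a).map (fun b => (b, c a b)) ++ (l' a).map fun b => (b, c' a b))
    henc ((hy.append hy').congr fun a => ?_)).congr fun a => ?_
  · simp only [List.map_append, List.map_map]
    rfl
  · rw [chainOf_append, chainOf_map_of_nodup (hnd a) (hmem a),
      chainOf_map_of_nodup (hnd' a) (hmem' a)]

lemma neg (henc : ∀ a, Function.Injective (enc a)) {c : ∀ a, B a →₀ ℤ}
    (h : ComputesChain Γ x enc c) : ComputesChain Γ x enc fun a => -c a := by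
  refine (h.linear henc (fun _ => -LinearMap.id) (fun a b => [(b, true)]) (fun a b _ => ?_)
    fun mem hm => ?_).congr fun a => by simp
  · simp [signedSum]
  · exact (hm.snd.node (.const (ofBool true) hm.input)).cons hm.input.nilList

lemma sub (henc : ∀ a, Function.Injective (enc a)) {c c' : ∀ a, B a →₀ ℤ}
    (h : ComputesChain Γ x enc c) (h' : ComputesChain Γ x enc c') :
    ComputesChain Γ x enc fun a => c a - c' a :=
  (h.add henc (h'.neg henc)).congr fun _ => (sub_eq_add_neg _ _).symm

end ComputesChain

/-! ### The reduction defined by a vector field -/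

namespace DiscreteVectorField

variable {X : SSet.{u}} (V : DiscreteVectorField X)

/-- The `k`-simplices reachable from the `k`-simplex `σ`. -/
def below (k : ℕ) (σ : X.nonDegenerate k) : Set (X.nonDegenerate k) :=
  {b | (⟨k, b⟩ : Σ k, X.nonDegenerate k) ∈ V.reach ⟨k, σ⟩}

/-- The number of `k`-simplices reachable from the `k`-simplex `σ`. It drops at each step of a
gradient path, and therefore bounds the number of steps. -/
noncomputable def rank {k : ℕ} (σ : X.nonDegenerate k) : ℕ := (V.below k σ).ncard

/-- The map `1 + ∂ V_#`. It replaces a source simplex `σ` by the other faces of `V(σ)`. -/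
noncomputable def flow (k : ℕ) : Module.End ℤ (X.nonDegenerate k →₀ ℤ) :=
  LinearMap.id + boundary X k ∘ₗ V.raise k

lemma flow_apply {k : ℕ} (c : X.nonDegenerate k →₀ ℤ) :
    V.flow k c = c + boundary X k (V.raise k c) := rfl

variable {V}

lemma IsSource.not_isTarget {k : ℕ} {σ : X.nonDegenerate k} (h : V.IsSource k σ) :
    ¬ V.IsTarget k σ := by
  obtain ⟨τ, hτ⟩ := h
  rcases k with _ | k
  · exact id
  · rintro ⟨σ', hσ'⟩
    exact V.source_ne_target hτ hσ' rfl

lemma isTarget_of_mem {k : ℕ} {σ : X.nonDegenerate k} {τ : X.nonDegenerate (k + 1)}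
    (h : (σ, τ) ∈ V.pairs k) : V.IsTarget (k + 1) τ := ⟨σ, h⟩

lemma isSource_or_mem_critical {k : ℕ} {σ : X.nonDegenerate k} (h : ¬ V.IsTarget k σ) :
    V.IsSource k σ ∨ σ ∈ V.critical k := by
  by_cases hs : V.IsSource k σ
  · exact .inl hs
  · exact .inr ⟨hs, h⟩

lemma raise_single {k : ℕ} {σ : X.nonDegenerate k} {τ : X.nonDegenerate (k + 1)}
    (h : (σ, τ) ∈ V.pairs k) {i : Fin (k + 2)} (hi : X.δ i τ.1 = σ.1) :
    V.raise k (Finsupp.single σ 1) = Finsupp.single τ ((-1 : ℤ) ^ ((i : ℕ) + 1)) := by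
  classical
  have hex : ∃ τ, (σ, τ) ∈ V.pairs k := ⟨τ, h⟩
  have e := V.target_unique hex.choose_spec h
  have aux : ∀ τ' (h' : (σ, τ') ∈ V.pairs k), τ' = τ →
      Finsupp.single τ' ((-1 : ℤ) ^ (((V.regular h').choose : ℕ) + 1)) =
        Finsupp.single τ ((-1 : ℤ) ^ ((i : ℕ) + 1)) := by
    rintro τ' h' rfl
    rw [(V.regular h').unique (V.regular h').choose_spec.1 hi]
  simp only [raise, Finsupp.linearCombination_single, one_smul]
  rw [dif_pos hex]
  exact aux _ hex.choose_spec e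

lemma raise_single_of_not_isSource {k : ℕ} {σ : X.nonDegenerate k} (h : ¬ V.IsSource k σ) (z : ℤ) :
    V.raise k (Finsupp.single σ z) = 0 := by
  classical
  simp only [raise, Finsupp.linearCombination_single]
  rw [dif_neg (show ¬∃ τ, (σ, τ) ∈ V.pairs k from h), smul_zero]

/-- A nonzero coefficient of the image of a chain under a linear map comes from a basis element. -/
lemma _root_.PolyTimeHomology.exists_of_apply_ne_zero {B B' : Type*}
    (φ : (B →₀ ℤ) →ₗ[ℤ] (B' →₀ ℤ)) {c : B →₀ ℤ} {b' : B'} (h : φ c b' ≠ 0) :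
    ∃ b, c b ≠ 0 ∧ φ (Finsupp.single b 1) b' ≠ 0 := by
  by_contra! hc
  refine h ?_
  conv_lhs => rw [← c.sum_single]
  rw [Finsupp.sum, map_sum, Finsupp.finsetSum_apply]
  refine Finset.sum_eq_zero fun b hb => ?_
  rw [← mul_one (c b), ← smul_eq_mul, ← Finsupp.smul_single, map_smul, Finsupp.smul_apply,
    hc b (Finsupp.mem_support_iff.1 hb), smul_zero]

lemma _root_.PolyTimeHomology.eq_zero_of_single {B M : Type*} [AddCommGroup M]
    (φ : (B →₀ ℤ) →ₗ[ℤ] M) {c : B →₀ ℤ} (h : ∀ b, c b ≠ 0 → φ (Finsupp.single b 1) = 0) :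
    φ c = 0 := by
  conv_lhs => rw [← c.sum_single]
  rw [Finsupp.sum, map_sum]
  refine Finset.sum_eq_zero fun b hb => ?_
  rw [← mul_one (c b), ← smul_eq_mul, ← Finsupp.smul_single, map_smul,
    h b (Finsupp.mem_support_iff.1 hb), smul_zero]

lemma raise_eq_zero {k : ℕ} {c : X.nonDegenerate k →₀ ℤ}
    (h : ∀ σ, c σ ≠ 0 → ¬ V.IsSource k σ) : V.raise k c = 0 :=
  eq_zero_of_single _ fun σ hσ => raise_single_of_not_isSource (h σ hσ) 1

lemma exists_of_raise_apply_ne_zero {k : ℕ} {c : X.nonDegenerate k →₀ ℤ}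
    {τ : X.nonDegenerate (k + 1)} (h : V.raise k c τ ≠ 0) :
    ∃ σ, c σ ≠ 0 ∧ (σ, τ) ∈ V.pairs k := by
  obtain ⟨σ, hσ, h⟩ := exists_of_apply_ne_zero _ h
  refine ⟨σ, hσ, ?_⟩
  by_cases hs : V.IsSource k σ
  · obtain ⟨τ', hτ'⟩ := hs
    obtain ⟨i, hi, -⟩ := V.regular hτ'
    rw [raise_single hτ' hi, Finsupp.single_apply_ne_zero] at h
    rw [h.1]
    exact hτ'
  · rw [raise_single_of_not_isSource hs] at h
    exact absurd rfl h

lemma raise_raise {k : ℕ} (c : X.nonDegenerate k →₀ ℤ) : V.raise (k + 1) (V.raise k c) = 0 := by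
  refine raise_eq_zero fun τ hτ hs => ?_
  obtain ⟨σ, -, h⟩ := exists_of_raise_apply_ne_zero hτ
  exact hs.not_isTarget (isTarget_of_mem h)

lemma boundary_single {k : ℕ} (τ : X.nonDegenerate (k + 1)) :
    boundary X k (Finsupp.single τ 1) =
      ∑ i : Fin (k + 2), (-1 : ℤ) ^ (i : ℕ) • simplexChain X k (X.δ i τ.1) := by
  rw [boundary, Finsupp.linearCombination_single, one_smul]

open Simplicial in
lemma simplexChain_apply_ne_zero {k : ℕ} {σ : X _⦋k⦌} {σ' : X.nonDegenerate k}
    (h : simplexChain X k σ σ' ≠ 0) : σ = σ'.1 := by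
  rw [simplexChain] at h
  split_ifs at h with hσ
  · rw [Finsupp.single_apply_ne_zero] at h
    rw [h.1]
  · exact absurd rfl h

lemma simplexChain_val {k : ℕ} (σ : X.nonDegenerate k) :
    simplexChain X k σ.1 = Finsupp.single σ 1 := by
  rw [simplexChain, dif_pos σ.2]

/-- The non-target simplices that occur in `flow σ` are reached from `σ` by a gradient path with one
step; a source `σ` itself does not occur, as the two contributions to its coefficient cancel. -/
lemma exists_of_flow_single_apply_ne_zero {k : ℕ} {σ σ' : X.nonDegenerate k}
    (h : V.flow k (Finsupp.single σ 1) σ' ≠ 0) (ht : ¬ V.IsTarget k σ') :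
    (σ' = σ ∧ ¬ V.IsSource k σ) ∨ (V.IsSource k σ ∧ ∃ τ, (σ, τ) ∈ V.pairs k ∧
      V.Edge ⟨k, σ⟩ ⟨k + 1, τ⟩ ∧ V.Edge ⟨k + 1, τ⟩ ⟨k, σ'⟩) := by
  classical
  by_cases hs : V.IsSource k σ
  · right
    refine ⟨hs, ?_⟩
    obtain ⟨τ, hτ⟩ := hs
    obtain ⟨i, hi, hu⟩ := V.regular hτ
    have hbd : boundary X k (V.raise k (Finsupp.single σ 1)) = (-1 : ℤ) ^ ((i : ℕ) + 1) •
        ∑ j : Fin (k + 2), (-1 : ℤ) ^ (j : ℕ) • simplexChain X k (X.δ j τ.1) := by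
      rw [raise_single hτ hi, ← mul_one ((-1 : ℤ) ^ ((i : ℕ) + 1)), ← smul_eq_mul,
        ← Finsupp.smul_single, map_smul, boundary_single]
      simp
    rw [flow_apply, hbd, ← Finset.sum_erase_add _ _ (Finset.mem_univ i), hi, simplexChain_val,
      smul_add, smul_smul, ← pow_add, show (i : ℕ) + 1 + i = 2 * i + 1 by ring,
      (odd_two_mul_add_one (i : ℕ)).neg_one_pow, neg_one_smul] at h
    rw [← add_assoc, add_comm (Finsupp.single σ 1), add_neg_cancel_right, Finsupp.smul_apply,
      Finsupp.finsetSum_apply, smul_eq_mul] at h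
    obtain ⟨j, hj, hne⟩ := Finset.exists_ne_zero_of_sum_ne_zero (right_ne_zero_of_mul h)
    rw [Finsupp.smul_apply, smul_eq_mul] at hne
    have hj' := simplexChain_apply_ne_zero (right_ne_zero_of_mul hne)
    refine ⟨τ, hτ, .up hτ, .down (isTarget_of_mem hτ) ⟨j, hj'⟩ (isSource_or_mem_critical ht)
      fun h' => ?_⟩
    rw [V.source_unique h' hτ] at hj'
    exact Finset.ne_of_mem_erase hj (hu j hj')
  · left
    rw [flow_apply, raise_single_of_not_isSource hs, map_zero, add_zero,
      Finsupp.single_apply_ne_zero] at h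
    exact ⟨h.1, hs⟩

lemma flow_of_raise_eq_zero {k : ℕ} {c : X.nonDegenerate k →₀ ℤ} (h : V.raise k c = 0) (n : ℕ) :
    (V.flow k ^ n) c = c := by
  induction n with
  | zero => rfl
  | succ n ih => rw [pow_succ', Module.End.mul_apply, ih, flow_apply, h, map_zero, add_zero]

lemma mem_below_self {k : ℕ} (σ : X.nonDegenerate k) : σ ∈ V.below k σ := .refl

section Finite

variable (hV : V.Admissible) (hfin : ∀ k σ, (V.reach ⟨k, σ⟩).Finite)

include hfin in
lemma finite_below {k : ℕ} (σ : X.nonDegenerate k) : (V.below k σ).Finite :=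
  (hfin k σ).preimage (f := fun b => (⟨k, b⟩ : Σ k, X.nonDegenerate k))
    (fun _ _ _ _ h => eq_of_heq (Sigma.mk.inj h).2)

include hfin in
lemma rank_pos {k : ℕ} (σ : X.nonDegenerate k) : 0 < V.rank σ :=
  (Set.ncard_pos (finite_below hfin σ)).2 ⟨σ, mem_below_self σ⟩

include hV hfin in
/-- As there are no directed cycles, `σ` is not reachable from `σ'`. -/
lemma rank_lt {k : ℕ} {σ σ' : X.nonDegenerate k} {τ : X.nonDegenerate (k + 1)}
    (h : V.Edge ⟨k, σ⟩ ⟨k + 1, τ⟩) (h' : V.Edge ⟨k + 1, τ⟩ ⟨k, σ'⟩) : V.rank σ' < V.rank σ := by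
  refine Set.ncard_lt_ncard ⟨fun b hb => ?_, fun hsub => ?_⟩ (finite_below hfin σ)
  · exact .head h (.head h' hb)
  · have h1 : Relation.ReflTransGen V.Edge ⟨k, σ'⟩ ⟨k, σ⟩ := hsub (mem_below_self σ)
    exact hV.1 ⟨⟨k, σ⟩, .head h (.head' h' h1)⟩

include hV hfin in
/-- The simplices that occur in the iterates of `flow` are reachable from the chain, and the number
of further steps of a gradient path decreases. -/
lemma exists_of_flow_pow_apply_ne_zero {k : ℕ} {c : X.nonDegenerate k →₀ ℤ} (n : ℕ)
    {σ' : X.nonDegenerate k} (h : (V.flow k ^ n) c σ' ≠ 0) (ht : ¬ V.IsTarget k σ') :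
    ∃ σ, c σ ≠ 0 ∧ σ' ∈ V.below k σ ∧ (V.IsSource k σ' → V.rank σ' + n ≤ V.rank σ) := by
  induction n generalizing σ' with
  | zero => exact ⟨σ', h, mem_below_self _, fun _ => le_rfl⟩
  | succ n ih =>
    rw [pow_succ', Module.End.mul_apply] at h
    obtain ⟨σ₁, h₁, h⟩ := exists_of_apply_ne_zero _ h
    rcases exists_of_flow_single_apply_ne_zero h ht with ⟨rfl, hs⟩ | ⟨hs, τ, -, e₁, e₂⟩
    · obtain ⟨σ, hσ, hb, -⟩ := ih h₁ ht
      exact ⟨σ, hσ, hb, fun hs' => absurd hs' hs⟩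
    · obtain ⟨σ, hσ, hb, hr⟩ := ih h₁ hs.not_isTarget
      refine ⟨σ, hσ, .trans hb (.head e₁ (.single e₂)), fun _ => ?_⟩
      have h1 := hr hs
      have h2 := rank_lt hV hfin e₁ e₂
      omega

/-- A number of steps after which a chain contains no more source simplices. -/
noncomputable def rankSup {k : ℕ} (V : DiscreteVectorField X) (c : X.nonDegenerate k →₀ ℤ) : ℕ :=
  c.support.sup V.rank

include hV hfin in
lemma not_isSource_of_flow_pow {k : ℕ} {c : X.nonDegenerate k →₀ ℤ} {n : ℕ} (hn : V.rankSup c ≤ n)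
    {σ : X.nonDegenerate k} (h : (V.flow k ^ n) c σ ≠ 0) : ¬ V.IsSource k σ := fun hs => by
  obtain ⟨σ', hσ', -, hr⟩ := exists_of_flow_pow_apply_ne_zero hV hfin n h hs.not_isTarget
  have h1 := hr hs
  have h2 := rank_pos hfin σ
  have h3 : V.rank σ' ≤ V.rankSup c := Finset.le_sup (Finsupp.mem_support_iff.2 hσ')
  omega

include hV hfin in
lemma raise_flow_pow_eq_zero {k : ℕ} {c : X.nonDegenerate k →₀ ℤ} {n : ℕ} (hn : V.rankSup c ≤ n) :
    V.raise k ((V.flow k ^ n) c) = 0 :=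
  raise_eq_zero fun _ h => not_isSource_of_flow_pow hV hfin hn h

/-- The homotopy `h = - ∑ V_# (1 + ∂ V_#)^n`. On a simplex `σ` the terms with `n ≥ rank σ` vanish,
so that the sum is finite. -/
noncomputable def homotopy (V : DiscreteVectorField X) (k : ℕ) :
    (X.nonDegenerate k →₀ ℤ) →ₗ[ℤ] (X.nonDegenerate (k + 1) →₀ ℤ) :=
  Finsupp.linearCombination ℤ fun σ : X.nonDegenerate k =>
    -∑ n ∈ Finset.range (V.rank σ), V.raise k ((V.flow k ^ n) (Finsupp.single σ 1))

include hV hfin in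
lemma homotopy_eq {k : ℕ} {c : X.nonDegenerate k →₀ ℤ} {N : ℕ} (hN : V.rankSup c ≤ N) :
    V.homotopy k c = -∑ n ∈ Finset.range N, V.raise k ((V.flow k ^ n) c) := by
  classical
  have h1 : ∀ σ, c σ ≠ 0 → V.homotopy k (Finsupp.single σ 1) =
      (-∑ n ∈ Finset.range N, V.raise k ∘ₗ (V.flow k ^ n)) (Finsupp.single σ 1) := by
    intro σ hσ
    have hle : V.rank σ ≤ N :=
      (Finset.le_sup (f := V.rank) (Finsupp.mem_support_iff.2 hσ)).trans hN
    rw [homotopy, Finsupp.linearCombination_single, one_smul, LinearMap.neg_apply,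
      LinearMap.sum_apply]
    congr 1
    refine Finset.sum_subset (Finset.range_subset_range.2 hle) fun n _ hn => ?_
    refine raise_flow_pow_eq_zero hV hfin ?_
    rw [rankSup]
    refine (Finset.sup_mono Finsupp.support_single_subset).trans ?_
    rw [Finset.sup_singleton]
    simpa using hn
  have h2 := eq_zero_of_single (c := c)
    (V.homotopy k - (-∑ n ∈ Finset.range N, V.raise k ∘ₗ (V.flow k ^ n)))
    fun σ hσ => by rw [LinearMap.sub_apply, h1 σ hσ, sub_self]
  rw [LinearMap.sub_apply, sub_eq_zero] at h2
  rw [h2]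
  simp

include hV hfin in
lemma exists_homotopy_eq {k : ℕ} (c : X.nonDegenerate k →₀ ℤ) :
    ∃ s, V.homotopy k c = V.raise k s :=
  ⟨-∑ n ∈ Finset.range (V.rankSup c), (V.flow k ^ n) c, by
    rw [homotopy_eq hV hfin le_rfl, map_neg, map_sum]⟩

include hV hfin in
lemma flow_pow_eq {k : ℕ} {c : X.nonDegenerate k →₀ ℤ} {N : ℕ} (hN : V.rankSup c ≤ N) :
    (V.flow k ^ N) c = c - boundary X k (V.homotopy k c) := by
  have h : ∀ n, boundary X k (V.raise k ((V.flow k ^ n) c)) =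
      (V.flow k ^ (n + 1)) c - (V.flow k ^ n) c := fun n => by
    rw [pow_succ', Module.End.mul_apply, flow_apply, add_sub_cancel_left]
  rw [homotopy_eq hV hfin hN, map_neg, map_sum, Finset.sum_congr rfl fun n _ => h n,
    Finset.sum_range_sub (fun n => (V.flow k ^ n) c)]
  simp

include hV hfin in
/-- The key identity `h ∂ V_# = V_#`: the sums for `(1 + ∂ V_#) c` and for `c` differ by the first
term only. -/
lemma homotopy_boundary_raise {k : ℕ} (c : X.nonDegenerate k →₀ ℤ) :
    V.homotopy k (boundary X k (V.raise k c)) = V.raise k c := by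
  have e : boundary X k (V.raise k c) = V.flow k c - c := by rw [flow_apply, add_sub_cancel_left]
  let N := max (V.rankSup c) (V.rankSup (V.flow k c))
  rw [e, map_sub, homotopy_eq hV hfin (N := N) (le_max_right _ _),
    homotopy_eq hV hfin (c := c) (N := N + 1) ((le_max_left _ _).trans (Nat.le_succ _)),
    Finset.sum_range_succ']
  have : ∀ n, (V.flow k ^ n) (V.flow k c) = (V.flow k ^ (n + 1)) c := fun n => by
    rw [pow_succ, Module.End.mul_apply]
  simp only [this, pow_zero, Module.End.one_apply]
  abel

include hV hfin in
lemma homotopy_raise {k : ℕ} (c : X.nonDegenerate k →₀ ℤ) :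
    V.homotopy (k + 1) (V.raise k c) = 0 := by
  rw [homotopy_eq hV hfin le_rfl]
  simp [flow_of_raise_eq_zero (raise_raise c), raise_raise]

include hV hfin in
lemma homotopy_homotopy {k : ℕ} (c : X.nonDegenerate k →₀ ℤ) :
    V.homotopy (k + 1) (V.homotopy k c) = 0 := by
  obtain ⟨s, hs⟩ := exists_homotopy_eq hV hfin c
  rw [hs, homotopy_raise hV hfin]

include hV hfin in
lemma homotopy_boundary_homotopy {k : ℕ} (c : X.nonDegenerate k →₀ ℤ) :
    V.homotopy k (boundary X k (V.homotopy k c)) = V.homotopy k c := by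
  obtain ⟨s, hs⟩ := exists_homotopy_eq hV hfin c
  rw [hs, homotopy_boundary_raise hV hfin]

/-! ### Critical chains -/

/-- The restriction of a chain to the critical simplices. -/
noncomputable def toCrit (V : DiscreteVectorField X) (k : ℕ) :
    (X.nonDegenerate k →₀ ℤ) →ₗ[ℤ] (V.critical k →₀ ℤ) :=
  Finsupp.lsubtypeDomain (R := ℤ) (V.critical k)

/-- The inclusion of the critical chains. -/
noncomputable def ofCrit (V : DiscreteVectorField X) (k : ℕ) :
    (V.critical k →₀ ℤ) →ₗ[ℤ] (X.nonDegenerate k →₀ ℤ) :=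
  Finsupp.lmapDomain ℤ ℤ Subtype.val

lemma ofCrit_single {k : ℕ} (σ : V.critical k) (z : ℤ) :
    V.ofCrit k (Finsupp.single σ z) = Finsupp.single σ.1 z := by
  simp [ofCrit]

lemma toCrit_apply {k : ℕ} (c : X.nonDegenerate k →₀ ℤ) (σ : V.critical k) :
    V.toCrit k c σ = c σ.1 := rfl

lemma toCrit_ofCrit {k : ℕ} (s : V.critical k →₀ ℤ) : V.toCrit k (V.ofCrit k s) = s := by
  ext σ
  rw [toCrit_apply, ofCrit, Finsupp.lmapDomain_apply,
    Finsupp.mapDomain_apply Subtype.val_injective]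

lemma ofCrit_apply_ne_zero {k : ℕ} {s : V.critical k →₀ ℤ} {σ : X.nonDegenerate k}
    (h : V.ofCrit k s σ ≠ 0) : σ ∈ V.critical k := by
  obtain ⟨b, -, h⟩ := exists_of_apply_ne_zero _ h
  rw [ofCrit_single, Finsupp.single_apply_ne_zero] at h
  rw [h.1]
  exact b.2

lemma toCrit_single_of_notMem {k : ℕ} {σ : X.nonDegenerate k} (h : σ ∉ V.critical k) (z : ℤ) :
    V.toCrit k (Finsupp.single σ z) = 0 := by
  classical
  ext b
  rw [toCrit_apply, Finsupp.single_apply, if_neg]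
  · rfl
  · rintro rfl
    exact h b.2

lemma toCrit_single {k : ℕ} (σ : V.critical k) (z : ℤ) :
    V.toCrit k (Finsupp.single σ.1 z) = Finsupp.single σ z := by
  rw [← ofCrit_single, toCrit_ofCrit]

lemma raise_ofCrit {k : ℕ} (s : V.critical k →₀ ℤ) : V.raise k (V.ofCrit k s) = 0 :=
  raise_eq_zero fun _ h => (ofCrit_apply_ne_zero h).1

include hV hfin in
lemma homotopy_ofCrit {k : ℕ} (s : V.critical k →₀ ℤ) : V.homotopy k (V.ofCrit k s) = 0 := by
  rw [homotopy_eq hV hfin le_rfl]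
  simp [flow_of_raise_eq_zero (raise_ofCrit s), raise_ofCrit]

lemma toCrit_raise {k : ℕ} (c : X.nonDegenerate k →₀ ℤ) :
    V.toCrit (k + 1) (V.raise k c) = 0 := by
  ext τ
  rw [toCrit_apply]
  by_contra h
  obtain ⟨σ, -, hσ⟩ := exists_of_raise_apply_ne_zero h
  exact τ.2.2 (isTarget_of_mem hσ)

include hV hfin in
lemma toCrit_homotopy {k : ℕ} (c : X.nonDegenerate k →₀ ℤ) :
    V.toCrit (k + 1) (V.homotopy k c) = 0 := by
  obtain ⟨s, hs⟩ := exists_homotopy_eq hV hfin c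
  rw [hs, toCrit_raise]

/-- The composition `h ∂`, which is `0` in degree `0`. -/
noncomputable def homotopyBoundary (V : DiscreteVectorField X) :
    ∀ k, Module.End ℤ (X.nonDegenerate k →₀ ℤ)
  | 0 => 0
  | k + 1 => V.homotopy k ∘ₗ boundary X k

lemma homotopyBoundary_succ {k : ℕ} (c : X.nonDegenerate (k + 1) →₀ ℤ) :
    V.homotopyBoundary (k + 1) c = V.homotopy k (boundary X k c) := rfl

lemma boundary_boundary {k : ℕ} (c : X.nonDegenerate (k + 2) →₀ ℤ) :
    boundary X k (boundary X (k + 1) c) = 0 :=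
  LinearMap.congr_fun (boundary_comp_boundary X k) c

lemma homotopyBoundary_boundary {k : ℕ} (c : X.nonDegenerate (k + 1) →₀ ℤ) :
    V.homotopyBoundary k (boundary X k c) = 0 := by
  rcases k with _ | k
  · rfl
  · rw [homotopyBoundary_succ, boundary_boundary, map_zero]

include hV hfin in
lemma homotopy_homotopyBoundary {k : ℕ} (c : X.nonDegenerate k →₀ ℤ) :
    V.homotopy k (V.homotopyBoundary k c) = 0 := by
  rcases k with _ | k
  · exact map_zero _
  · rw [homotopyBoundary_succ, homotopy_homotopy hV hfin]

include hV hfin in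
lemma toCrit_homotopyBoundary {k : ℕ} (c : X.nonDegenerate k →₀ ℤ) :
    V.toCrit k (V.homotopyBoundary k c) = 0 := by
  rcases k with _ | k
  · exact map_zero _
  · rw [homotopyBoundary_succ, toCrit_homotopy hV hfin]

include hV hfin in
/-- A chain without source simplices is the sum of a critical chain and a chain of targets, and
`h ∂` is the identity on the latter. -/
lemma homotopyBoundary_sub_of_not_isSource {k : ℕ} {e : X.nonDegenerate k →₀ ℤ}
    (h : ∀ σ, e σ ≠ 0 → ¬ V.IsSource k σ) :
    V.homotopyBoundary k (e - V.ofCrit k (V.toCrit k e)) = e - V.ofCrit k (V.toCrit k e) := by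
  have key := eq_zero_of_single (c := e)
    ((LinearMap.id - V.homotopyBoundary k) ∘ₗ (LinearMap.id - V.ofCrit k ∘ₗ V.toCrit k))
    fun σ hσ => by
      by_cases hc : σ ∈ V.critical k
      · have h1 := toCrit_single (V := V) ⟨σ, hc⟩ 1
        simp only [LinearMap.comp_apply, LinearMap.sub_apply, LinearMap.id_apply]
        simp only at h1
        rw [h1, ofCrit_single]
        simp
      · have ht : V.IsTarget k σ := by
          by_contra ht
          exact hc ⟨h σ hσ, ht⟩
        rcases k with _ | k
        · exact ht.elim
        · obtain ⟨σ', hσ'⟩ := ht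
          obtain ⟨i, hi, -⟩ := V.regular hσ'
          have h1 := raise_single hσ' hi
          have h2 : Finsupp.single σ (1 : ℤ) =
              V.raise k ((-1 : ℤ) ^ ((i : ℕ) + 1) • Finsupp.single σ' 1) := by
            rw [map_smul, h1, Finsupp.smul_single, smul_eq_mul, ← pow_add, ← two_mul, pow_mul]
            simp
          simp only [LinearMap.comp_apply, LinearMap.sub_apply, LinearMap.id_apply]
          rw [toCrit_single_of_notMem hc, map_zero, sub_zero, h2, homotopyBoundary_succ,
            homotopy_boundary_raise hV hfin, sub_self]
  simp only [LinearMap.comp_apply, LinearMap.sub_apply, LinearMap.id_apply] at key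
  exact (sub_eq_zero.1 key).symm

/-- The projection `f` onto the critical complex: the critical part of `1 - ∂ h`, which is the
stabilization of the powers of `1 + ∂ V_#`. -/
noncomputable def proj (V : DiscreteVectorField X) (k : ℕ) :
    (X.nonDegenerate k →₀ ℤ) →ₗ[ℤ] (V.critical k →₀ ℤ) :=
  V.toCrit k ∘ₗ (LinearMap.id - boundary X k ∘ₗ V.homotopy k)

/-- The map `g` from the critical complex, which is `1 - h ∂` on critical chains. -/
noncomputable def incl (V : DiscreteVectorField X) (k : ℕ) :
    (V.critical k →₀ ℤ) →ₗ[ℤ] (X.nonDegenerate k →₀ ℤ) :=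
  (LinearMap.id - V.homotopyBoundary k) ∘ₗ V.ofCrit k

/-- The differential of the critical complex, in the form `f ∂` on critical chains. -/
noncomputable def critD (V : DiscreteVectorField X) (k : ℕ) :
    (V.critical (k + 1) →₀ ℤ) →ₗ[ℤ] (V.critical k →₀ ℤ) :=
  V.proj k ∘ₗ boundary X k ∘ₗ V.ofCrit (k + 1)

lemma proj_apply {k : ℕ} (c : X.nonDegenerate k →₀ ℤ) :
    V.proj k c = V.toCrit k (c - boundary X k (V.homotopy k c)) := rfl

lemma incl_apply {k : ℕ} (s : V.critical k →₀ ℤ) :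
    V.incl k s = V.ofCrit k s - V.homotopyBoundary k (V.ofCrit k s) := rfl

include hV hfin in
lemma proj_incl {k : ℕ} (s : V.critical k →₀ ℤ) : V.proj k (V.incl k s) = s := by
  rw [proj_apply, incl_apply, map_sub, map_sub (V.homotopy k), homotopy_ofCrit hV hfin,
    homotopy_homotopyBoundary hV hfin, map_sub, toCrit_homotopyBoundary hV hfin, toCrit_ofCrit]
  simp

include hV hfin in
lemma incl_proj {k : ℕ} (c : X.nonDegenerate k →₀ ℤ) :
    V.incl k (V.proj k c) = c - boundary X k (V.homotopy k c) - V.homotopyBoundary k c := by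
  have h := homotopyBoundary_sub_of_not_isSource hV hfin (k := k)
    (e := c - boundary X k (V.homotopy k c)) fun σ hσ => by
      rw [← flow_pow_eq hV hfin (le_refl (V.rankSup c))] at hσ
      exact not_isSource_of_flow_pow hV hfin le_rfl hσ
  rw [map_sub, map_sub (V.homotopyBoundary k), homotopyBoundary_boundary, sub_zero] at h
  rw [incl_apply, proj_apply]
  generalize V.ofCrit k (V.toCrit k (c - boundary X k (V.homotopy k c))) = e at *
  rw [sub_eq_iff_eq_add] at h
  rw [h]
  abel

include hV hfin in
lemma sub_incl_proj_zero (c : X.nonDegenerate 0 →₀ ℤ) :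
    c - V.incl 0 (V.proj 0 c) = boundary X 0 (V.homotopy 0 c) := by
  rw [incl_proj hV hfin, homotopyBoundary, LinearMap.zero_apply]
  abel

include hV hfin in
lemma sub_incl_proj_succ {k : ℕ} (c : X.nonDegenerate (k + 1) →₀ ℤ) :
    c - V.incl (k + 1) (V.proj (k + 1) c) =
      boundary X (k + 1) (V.homotopy (k + 1) c) + V.homotopy k (boundary X k c) := by
  rw [incl_proj hV hfin, homotopyBoundary_succ]
  abel

include hV hfin in
lemma proj_homotopy {k : ℕ} (c : X.nonDegenerate k →₀ ℤ) :
    V.proj (k + 1) (V.homotopy k c) = 0 := by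
  rw [proj_apply, homotopy_homotopy hV hfin, map_zero, sub_zero, toCrit_homotopy hV hfin]

include hV hfin in
lemma homotopy_incl {k : ℕ} (s : V.critical k →₀ ℤ) : V.homotopy k (V.incl k s) = 0 := by
  rw [incl_apply, map_sub, homotopy_ofCrit hV hfin, homotopy_homotopyBoundary hV hfin, sub_zero]

include hV hfin in
lemma critD_eq_proj {k : ℕ} (s : V.critical (k + 1) →₀ ℤ) :
    V.critD k s = V.proj k (boundary X k (V.incl (k + 1) s)) := by
  have h : V.proj k (boundary X k (V.homotopyBoundary (k + 1) (V.ofCrit (k + 1) s))) = 0 := by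
    rw [proj_apply, homotopyBoundary_succ, homotopy_boundary_homotopy hV hfin, sub_self, map_zero]
  rw [incl_apply, map_sub, map_sub, h, sub_zero]
  rfl

include hV hfin in
lemma critD_eq_toCrit {k : ℕ} (s : V.critical (k + 1) →₀ ℤ) :
    V.critD k s = V.toCrit k (boundary X k (V.incl (k + 1) s)) := by
  have h : V.homotopy k (boundary X k (V.incl (k + 1) s)) = 0 := by
    rw [incl_apply, homotopyBoundary_succ, map_sub, map_sub, homotopy_boundary_homotopy hV hfin,
      sub_self]
  rw [critD_eq_proj hV hfin, proj_apply, h, map_zero, sub_zero]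

include hV hfin in
lemma boundary_incl_proj {k : ℕ} (c : X.nonDegenerate (k + 1) →₀ ℤ) :
    boundary X k (V.incl (k + 1) (V.proj (k + 1) c)) = V.incl k (V.proj k (boundary X k c)) := by
  rw [incl_proj hV hfin, incl_proj hV hfin, map_sub, map_sub, boundary_boundary, sub_zero,
    homotopyBoundary_boundary, sub_zero, homotopyBoundary_succ]

include hV hfin in
lemma proj_boundary {k : ℕ} (c : X.nonDegenerate (k + 1) →₀ ℤ) :
    V.proj k (boundary X k c) = V.critD k (V.proj (k + 1) c) := by
  rw [critD_eq_proj hV hfin, boundary_incl_proj hV hfin, proj_incl hV hfin]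

include hV hfin in
lemma incl_critD {k : ℕ} (s : V.critical (k + 1) →₀ ℤ) :
    V.incl k (V.critD k s) = boundary X k (V.incl (k + 1) s) := by
  rw [critD_eq_proj hV hfin, ← boundary_incl_proj hV hfin, proj_incl hV hfin]

include hV hfin in
lemma critD_critD {k : ℕ} (s : V.critical (k + 2) →₀ ℤ) : V.critD k (V.critD (k + 1) s) = 0 := by
  rw [critD_eq_proj hV hfin, incl_critD hV hfin, boundary_boundary, map_zero]

include hV hfin in
/-- The powers of `Φ` stabilize on critical simplices, with limit `g`. -/
lemma Phi_pow_eq_incl {k : ℕ} (s : V.critical (k + 1) →₀ ℤ) {N : ℕ}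
    (hN : V.rankSup (boundary X k (V.ofCrit (k + 1) s)) ≤ N) :
    (V.Phi (k + 1) ^ N) (V.ofCrit (k + 1) s) = V.incl (k + 1) s := by
  have h : ∀ n, (V.Phi (k + 1) ^ n) (V.ofCrit (k + 1) s) = V.ofCrit (k + 1) s +
      V.raise k (∑ i ∈ Finset.range n, (V.flow k ^ i) (boundary X k (V.ofCrit (k + 1) s))) := by
    intro n
    induction n with
    | zero => simp
    | succ n ih =>
      rw [pow_succ', Module.End.mul_apply, ih, Finset.sum_range_succ']
      simp only [Phi, LinearMap.add_apply, LinearMap.comp_apply, LinearMap.id_apply, map_add,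
        raise_raise, raise_ofCrit, pow_succ', Module.End.mul_apply]
      rw [← map_sum (V.flow k), flow_apply]
      simp only [map_add, pow_zero, Module.End.one_apply, map_zero]
      abel
  rw [h, incl_apply, homotopyBoundary_succ, homotopy_eq hV hfin hN, sub_neg_eq_add, map_sum]

/-- The critical complex of an admissible vector field with finite reachable sets. -/
noncomputable def toCriticalComplex (hV : V.Admissible)
    (hfin : ∀ k σ, (V.reach ⟨k, σ⟩).Finite) : V.CriticalComplex where
  d := V.critD
  d_comp_d _ := LinearMap.ext fun s => critD_critD hV hfin s
  d_single k σ := by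
    refine Filter.eventually_atTop.2 ⟨V.rankSup (boundary X k (V.ofCrit (k + 1)
      (Finsupp.single σ 1))), fun N hN => ?_⟩
    rw [critD_eq_toCrit hV hfin, ← Phi_pow_eq_incl hV hfin _ hN, ofCrit_single]
    rfl

/-- The reduction of the normalized chain complex to the critical complex. -/
noncomputable def reduction (hV : V.Admissible) (hfin : ∀ k σ, (V.reach ⟨k, σ⟩).Finite) :
    Reduction (normalizedComplex X) (toCriticalComplex hV hfin).toFreeComplex where
  f := V.proj
  g := V.incl
  h := V.homotopy
  f_comm _ := LinearMap.ext fun c => proj_boundary hV hfin c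
  g_comm _ := LinearMap.ext fun s => incl_critD hV hfin s
  f_comp_g _ := LinearMap.ext fun s => proj_incl hV hfin s
  homotopy_zero := LinearMap.ext fun c => sub_incl_proj_zero hV hfin c
  homotopy_succ _ := LinearMap.ext fun c => sub_incl_proj_succ hV hfin c
  f_comp_h _ := LinearMap.ext fun c => proj_homotopy hV hfin c
  h_comp_g _ := LinearMap.ext fun s => homotopy_incl hV hfin s
  h_comp_h _ := LinearMap.ext fun c => homotopy_homotopy hV hfin c

end Finite

end DiscreteVectorField

/-! ### Computing with simplices -/

/-- A polynomial-time problem is solved inside a computation. -/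
lemma PolyTime.computes {A₀ : ℕ → Type*} {inp out : ∀ k, A₀ k → BTree → Prop}
    (h : PolyTime inp out) {A : Type w} {Γ : Scale A} {κ : A → ℕ} (hκ : Γ.DimBdd κ)
    (α : ∀ a, A₀ (κ a)) {x t : A → BTree} (hx : Computes Γ x t)
    (ht : ∀ a, inp (κ a) (α a) (t a)) :
    ∃ y, Computes Γ x y ∧ ∀ a, out (κ a) (α a) (y a) := by
  obtain ⟨p, hp⟩ := h
  choose P hP using hp
  choose y m hrun hm hout using fun a => hP (κ a) (α a) (t a) (ht a)
  exact ⟨y, hx.trans (.of_le (hκ.eval hx.bdd_out P) fun a => ⟨_, hm a, hrun a⟩), hout⟩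

/-- The family of all inputs of a problem, measured by their dimension and their size. -/
def inputScale {A₀ : ℕ → Type w} (inp : ∀ k, A₀ k → BTree → Prop) :
    Scale (Σ k, Σ a : A₀ k, {t // inp k a t}) := ⟨fun q => q.1, fun q => q.2.2.1.size⟩

lemma PolyTime.of_computes {A₀ : ℕ → Type w} {inp out : ∀ k, A₀ k → BTree → Prop}
    {y : (Σ k, Σ a : A₀ k, {t // inp k a t}) → BTree}
    (h : Computes (inputScale inp) (fun q => q.2.2.1) y) (hy : ∀ q, out q.1 q.2.1 (y q)) :
    PolyTime inp out := by
  obtain ⟨p, m, hm, hrun⟩ := h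
  refine ⟨p, fun k => ?_⟩
  obtain ⟨P, hP⟩ := hm k
  exact ⟨P, fun a t ht => ⟨_, _, hrun ⟨k, a, t, ht⟩, hP ⟨k, a, t, ht⟩ rfl, hy ⟨k, a, t, ht⟩⟩⟩

lemma computes_inputScale {A₀ : ℕ → Type w} (inp : ∀ k, A₀ k → BTree → Prop) :
    Computes (inputScale inp) (fun q => q.2.2.1) fun q => q.2.2.1 := .refl Scale.bdd_size

variable {ι : Type v}

/-- A parameter `I a` and a dimension `κ a` are available in a computation. -/
structure Ambient (eI : Computability.Encoding ι Bool) {A : Type w} (Γ : Scale A) (x : A → BTree)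
    (I : A → ι) (κ : A → ℕ) : Prop where
  dimBdd : Γ.DimBdd κ
  dim : Computes Γ x fun a => ofNat (κ a)
  param : Computes Γ x fun a => ofBits (eI.encode (I a))

namespace Ambient

variable {eI : Computability.Encoding ι Bool} {A : Type w} {Γ : Scale A} {x : A → BTree}
  {I : A → ι} {κ : A → ℕ}

lemma comap {A' : Type w'} (h : Ambient eI Γ x I κ) (φ : A' → A) :
    Ambient eI (Γ.comap φ) (fun b => x (φ b)) (fun b => I (φ b)) (fun b => κ (φ b)) :=
  ⟨h.dimBdd.comap φ, h.dim.comap φ, h.param.comap φ⟩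

lemma trans {z : A → BTree} (hz : Computes Γ z x) (h : Ambient eI Γ x I κ) : Ambient eI Γ z I κ :=
  ⟨h.dimBdd, hz.trans h.dim, hz.trans h.param⟩

lemma lift {A' : Type w'} {φ : A' → A} {e mem : A' → BTree} (h : Ambient eI Γ x I κ)
    (he : Computes (Γ.comap φ) mem fun b => .node (x (φ b)) (e b)) :
    Ambient eI (Γ.comap φ) mem (fun b => I (φ b)) (fun b => κ (φ b)) :=
  (h.comap φ).trans he.fst

lemma congr {κ' : A → ℕ} (h : Ambient eI Γ x I κ) (e : ∀ a, κ a = κ' a) : Ambient eI Γ x I κ' := by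
  rwa [← funext e]

lemma succ (h : Ambient eI Γ x I κ) : Ambient eI Γ x I (fun a => κ a + 1) :=
  ⟨h.dimBdd.map fun _ _ h => Nat.succ_le_succ h, h.dim.input.nil.node h.dim, h.param⟩

lemma pred (h : Ambient eI Γ x I (fun a => κ a + 1)) : Ambient eI Γ x I κ := by
  refine ⟨?_, h.dim.right, h.param⟩
  obtain ⟨g, hg⟩ := h.dimBdd
  exact ⟨g, fun a => (Nat.le_succ _).trans (hg a)⟩

lemma input {t : A → BTree} (h : Ambient eI Γ x I κ) (ht : Computes Γ x t) :
    Computes Γ x fun a => input eI (κ a) (I a) (t a) := h.dim.node (h.param.node ht)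

end Ambient

namespace EncSSet

variable (X : EncSSet.{v, u} ι)

/-- The encoding of the nondegenerate simplices. -/
def encND (I : ι) (k : ℕ) (σ : (X.sset I).nonDegenerate k) : List Bool := (X.enc I k).encode σ.1

lemma _root_.PolyTimeHomology.encode_injective {α : Type*} (e : Computability.Encoding α Bool) :
    Function.Injective e.encode := fun a b h => by
  have := e.decode_encode a
  rw [h, e.decode_encode, Option.some_inj] at this
  exact this.symm

lemma encND_injective (I : ι) (k : ℕ) : Function.Injective (X.encND I k) := fun _ _ h =>
  Subtype.ext (encode_injective _ h)

/-- The encoding of the critical simplices. -/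
def encCrit (V : ∀ I, DiscreteVectorField (X.sset I)) (I : ι) (k : ℕ) (σ : (V I).critical k) :
    List Bool := X.encND I k σ.1

lemma encCrit_injective (V : ∀ I, DiscreteVectorField (X.sset I)) (I : ι) (k : ℕ) :
    Function.Injective (X.encCrit V I k) := fun _ _ h => Subtype.ext (X.encND_injective I k h)

variable {X} {eI : Computability.Encoding ι Bool} {A : Type w} {Γ : Scale A} {x : A → BTree}
  {I : A → ι} {κ : A → ℕ}

section Faces

variable (hX : X.LocallyPolyTime eI) (hA : Ambient eI Γ x I κ)

include hX hA

open Simplicial in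
lemma computes_face {i : ∀ a, Fin (κ a + 2)} {σ : ∀ a, (X.sset (I a)) _⦋κ a + 1⦌}
    (hi : Computes Γ x fun a => ofNat (i a)) (hσ : Computes Γ x fun a => X.code (σ a)) :
    Computes Γ x fun a => X.code ((X.sset (I a)).δ (i a) (σ a)) := by
  obtain ⟨y, hy, h⟩ := hX.1.computes hA.dimBdd (fun a => ⟨I a, i a, σ a⟩)
    (hA.succ.input (hi.node hσ)) fun _ => rfl
  exact hy.congr h

open Simplicial in
lemma computes_degeneracy {i : ∀ a, Fin (κ a + 1)} {σ : ∀ a, (X.sset (I a)) _⦋κ a⦌}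
    (hi : Computes Γ x fun a => ofNat (i a)) (hσ : Computes Γ x fun a => X.code (σ a)) :
    Computes Γ x fun a => X.code ((X.sset (I a)).σ (i a) (σ a)) := by
  obtain ⟨y, hy, h⟩ := hX.2.computes hA.dimBdd (fun a => ⟨I a, i a, σ a⟩)
    (hA.input (hi.node hσ)) fun _ => rfl
  exact hy.congr h

omit hX hA in
open Simplicial in
lemma mem_degenerate_iff_exists {Y : SSet.{u}} {k : ℕ} (σ : Y _⦋k + 1⦌) :
    σ ∈ Y.degenerate (k + 1) ↔ ∃ j : Fin (k + 1), Y.σ j (Y.δ j.castSucc σ) = σ := by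
  rw [SSet.degenerate_eq_iUnion_range_σ]
  constructor
  · intro h
    obtain ⟨j, τ, rfl⟩ := Set.mem_iUnion.1 h
    exact ⟨j, by simp⟩
  · rintro ⟨j, hj⟩
    exact Set.mem_iUnion.2 ⟨j, _, hj⟩

open Classical Simplicial in
/-- In positive dimensions a simplex `σ` is degenerate if it agrees with some `s_j (∂_j σ)`. -/
lemma computes_nonDegenerate_succ {σ : ∀ a, (X.sset (I a)) _⦋κ a + 1⦌}
    (hσ : Computes Γ x fun a => X.code (σ a)) : Computes Γ x fun a =>
      ofBool (decide (σ a ∈ (X.sset (I a)).nonDegenerate (κ a + 1))) := by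
  have hany := Computes.any (p := fun a j => decide (∃ h : j < κ a + 1,
      (X.sset (I a)).σ ⟨j, h⟩ ((X.sset (I a)).δ (Fin.castSucc ⟨j, h⟩) (σ a)) = σ a))
    (Computes.range hA.succ.dim) fun mem hm => ?_
  · refine hany.not.congr fun a => ?_
    congr 1
    rw [SSet.mem_nonDegenerate_iff_notMem_degenerate, mem_degenerate_iff_exists,
      Bool.eq_iff_iff, Bool.not_eq_true', List.any_eq_false]
    simp only [List.mem_range, decide_eq_true_eq, not_exists]
    exact ⟨fun h j => h j.1 j.2 j.2, fun h j hj hj' => h ⟨j, hj'⟩⟩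
  · have hlt : ∀ q : Computes.Elem (fun a => List.range (κ a + 1)), q.1.2 < κ q.1.1 + 1 :=
      fun q => List.mem_range.1 q.2
    have hface := computes_face hX (hA.lift hm) (i := fun q => Fin.castSucc ⟨q.1.2, hlt q⟩)
      hm.snd.fst (hσ.lift hm)
    have hdeg := computes_degeneracy hX (hA.lift hm) (i := fun q => ⟨q.1.2, hlt q⟩)
      hm.snd.fst hface
    refine (hdeg.eqBits (hσ.lift hm)).congr fun q => ?_
    simp only [(encode_injective _).eq_iff, hlt q, exists_true_left]

open Classical Simplicial in
lemma computes_nonDegenerate {σ : ∀ a, (X.sset (I a)) _⦋κ a⦌}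
    (hσ : Computes Γ x fun a => X.code (σ a)) : Computes Γ x fun a =>
      ofBool (decide (σ a ∈ (X.sset (I a)).nonDegenerate (κ a))) := by
  let φ : {q : A × ℕ // κ q.1 = q.2 + 1} → A := fun q => q.1.1
  have hcode : ∀ (J : ι) (m n : ℕ) (h : m = n) (τ : (X.sset J) _⦋m⦌),
      X.code (h ▸ τ) = X.code τ := by
    rintro J m _ rfl τ; rfl
  have hnd : ∀ (J : ι) (m n : ℕ) (h : m = n) (τ : (X.sset J) _⦋m⦌),
      h ▸ τ ∈ (X.sset J).nonDegenerate n ↔ τ ∈ (X.sset J).nonDegenerate m := by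
    rintro J m _ rfl τ; rfl
  refine Computes.cond (φ₀ := (Subtype.val : {a // κ a = 0} → A)) (φ₁ := φ) hA.dim ?_ ?_
    fun a => ?_
  · refine (Computes.const (ofBool true) (hσ.input.comap _)).congr fun b => ?_
    rw [decide_eq_true]
    rw [← hnd _ _ _ b.2, SSet.nondegenerate_zero]
    trivial
  · have hA' : Ambient eI (Γ.comap φ) (fun q => x (φ q)) (fun q => I (φ q)) fun q => q.1.2 :=
      ((hA.comap φ).congr fun q => q.2).pred
    refine (computes_nonDegenerate_succ hX hA' (σ := fun q => q.2 ▸ σ q.1.1)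
      ((hσ.comap φ).congr fun q => (hcode _ _ _ _ _).symm)).congr fun q => ?_
    simp only [hnd]
    rfl
  · rcases h : κ a with _ | n
    · exact .inl ⟨rfl, ⟨a, h⟩, rfl⟩
    · exact .inr ⟨by simp [ofNat], ⟨(a, n), h⟩, rfl⟩

open Classical in
/-- The nondegenerate faces of `τ`, with their signs in the boundary of `τ`. -/
noncomputable def _root_.PolyTimeHomology.faceTerms {Y : SSet.{u}} {k : ℕ}
    (τ : Y.nonDegenerate (k + 1)) : List (Y.nonDegenerate k × Bool) :=
  (List.range (k + 2)).flatMap fun i =>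
    if h : ∃ hi : i < k + 2, Y.δ ⟨i, hi⟩ τ.1 ∈ Y.nonDegenerate k then [(⟨_, h.2⟩, i.bodd)] else []

omit hX hA in
lemma _root_.PolyTimeHomology.sum_map_range {M : Type*} [AddCommMonoid M] (f : ℕ → M) (n : ℕ) :
    ((List.range n).map f).sum = ∑ i ∈ Finset.range n, f i := by
  induction n with
  | zero => rfl
  | succ n ih => rw [List.range_succ, List.map_append, List.sum_append, ih,
      Finset.sum_range_succ]; simp

omit hX hA in
lemma _root_.PolyTimeHomology.signedSum_faceTerms {Y : SSet.{u}} {k : ℕ}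
    (τ : Y.nonDegenerate (k + 1)) :
    ComputesChain.signedSum (faceTerms τ) = boundary Y k (Finsupp.single τ 1) := by
  classical
  rw [DiscreteVectorField.boundary_single, ComputesChain.signedSum, faceTerms, List.map_flatMap,
    chainOf_flatMap, sum_map_range, Finset.sum_range]
  refine Finset.sum_congr rfl fun i _ => ?_
  by_cases h : Y.δ i τ.1 ∈ Y.nonDegenerate k
  · rw [dif_pos ⟨i.2, h⟩, simplexChain, dif_pos h]
    have hi : (if (i : ℕ).bodd = true then (-1 : ℤ) else 1) = (-1) ^ (i : ℕ) := by
      rcases Nat.even_or_odd (i : ℕ) with h' | h'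
      · rw [h'.neg_one_pow, if_neg]
        obtain ⟨m, hm⟩ := h'
        rw [hm]
        simp
      · rw [h'.neg_one_pow, if_pos]
        obtain ⟨m, hm⟩ := h'
        rw [hm]
        simp [show Nat.bodd 2 = false from rfl]
    simp [hi]
  · rw [dif_neg (by rintro ⟨_, h'⟩; exact h h'), simplexChain, dif_neg h]
    simp

lemma computes_boundary {c : ∀ a, (X.sset (I a)).nonDegenerate (κ a + 1) →₀ ℤ}
    (hc : ComputesChain Γ x (fun a => X.encND (I a) (κ a + 1)) c) :
    ComputesChain Γ x (fun a => X.encND (I a) (κ a))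
      fun a => boundary (X.sset (I a)) (κ a) (c a) := by
  classical
  refine hc.linear (fun a => X.encND_injective _ _) (fun a => boundary _ _)
    (fun a => faceTerms) (fun a b _ => (signedSum_faceTerms b).symm) fun mem hm => ?_
  refine (Computes.flatMap (Computes.range (hA.lift hm).succ.succ.dim) (f := fun q i =>
    (if h : ∃ hi : i < κ q.1.1 + 2, (X.sset (I q.1.1)).δ ⟨i, hi⟩ q.1.2.1 ∈
        (X.sset (I q.1.1)).nonDegenerate (κ q.1.1) then
      [((⟨_, h.2⟩ : (X.sset (I q.1.1)).nonDegenerate (κ q.1.1)), i.bodd)] else []).map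
      (ComputesChain.ofSigned (X.encND (I q.1.1) (κ q.1.1)))) fun mem' hm' => ?_).congr fun q => ?_
  · have hlt : ∀ q : Computes.Elem (fun q : ComputesChain.Term c => List.range (κ q.1.1 + 1 + 1)),
        q.1.2 < κ q.1.1.1.1 + 2 := fun q => List.mem_range.1 q.2
    have hface := computes_face hX ((hA.lift hm).lift hm') (i := fun q => ⟨q.1.2, hlt q⟩)
      (σ := fun q => q.1.1.1.2.1) hm'.snd.fst (hm.snd.lift hm')
    refine ((computes_nonDegenerate hX ((hA.lift hm).lift hm') hface).ite
      ((hface.node hm'.snd.snd).cons hm'.input.nilList) hm'.input.nilList).congr fun q => ?_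
    by_cases h : (X.sset (I q.1.1.1.1)).δ ⟨q.1.2, hlt q⟩ q.1.1.1.2.1 ∈
        (X.sset (I q.1.1.1.1)).nonDegenerate (κ q.1.1.1.1)
    · rw [dif_pos ⟨hlt q, h⟩, decide_eq_true h]
      rfl
    · rw [dif_neg (by rintro ⟨_, h'⟩; exact h h'), decide_eq_false h]
      rfl
  · rw [faceTerms, List.map_flatMap]

end Faces

end EncSSet

/-! ### Computing with a vector field -/

namespace DiscreteVectorField

variable {Y : SSet.{u}} (V : DiscreteVectorField Y)

open Classical in
/-- The image of a simplex under `V_#`, as a list of at most one signed simplex. -/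
noncomputable def raiseTerms {k : ℕ} (σ : Y.nonDegenerate k) :
    List (Y.nonDegenerate (k + 1) × Bool) :=
  if h : V.IsSource k σ then
    [(h.choose, !Nat.bodd ((V.regular h.choose_spec).choose : ℕ))] else []

variable {V} in
lemma raiseTerms_of_mem {k : ℕ} {σ : Y.nonDegenerate k} {τ : Y.nonDegenerate (k + 1)}
    (h : (σ, τ) ∈ V.pairs k) {i : Fin (k + 2)} (hi : Y.δ i τ.1 = σ.1) :
    V.raiseTerms σ = [(τ, !Nat.bodd (i : ℕ))] := by
  have hs : V.IsSource k σ := ⟨τ, h⟩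
  have aux : ∀ τ' (h' : (σ, τ') ∈ V.pairs k), τ' = τ →
      [(τ', !Nat.bodd ((V.regular h').choose : ℕ))] = [(τ, !Nat.bodd (i : ℕ))] := by
    rintro τ' h' rfl
    rw [(V.regular h').unique (V.regular h').choose_spec.1 hi]
  rw [raiseTerms, dif_pos hs]
  exact aux _ hs.choose_spec (V.target_unique hs.choose_spec h)

lemma signedSum_raiseTerms {k : ℕ} (σ : Y.nonDegenerate k) :
    ComputesChain.signedSum (V.raiseTerms σ) = V.raise k (Finsupp.single σ 1) := by
  by_cases h : V.IsSource k σ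
  · obtain ⟨τ, h⟩ := h
    obtain ⟨i, hi, -⟩ := V.regular h
    rw [raiseTerms_of_mem h hi, raise_single h hi]
    have : (if (!Nat.bodd (i : ℕ)) = true then (-1 : ℤ) else 1) = (-1) ^ ((i : ℕ) + 1) := by
      rw [pow_succ]
      rcases Nat.even_or_odd (i : ℕ) with h' | h'
      · rw [h'.neg_one_pow]
        obtain ⟨m, hm⟩ := h'
        rw [hm]
        simp
      · rw [h'.neg_one_pow]
        obtain ⟨m, hm⟩ := h'
        rw [hm]
        simp [show Nat.bodd 2 = false from rfl]
    rw [← this]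
    simp [ComputesChain.signedSum]
  · rw [raiseTerms, dif_neg h, raise_single_of_not_isSource h]
    rfl

open Classical in
/-- Removing the target simplices from a chain. -/
noncomputable def dropTargets (k : ℕ) : Module.End ℤ (Y.nonDegenerate k →₀ ℤ) :=
  Finsupp.linearCombination ℤ fun σ => if V.IsTarget k σ then 0 else Finsupp.single σ 1

open Classical in
lemma dropTargets_single {k : ℕ} (σ : Y.nonDegenerate k) :
    V.dropTargets k (Finsupp.single σ 1) =
      if V.IsTarget k σ then 0 else Finsupp.single σ 1 := by
  rw [dropTargets, Finsupp.linearCombination_single, one_smul]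

end DiscreteVectorField

namespace EncSSet

variable {ι : Type v} {X : EncSSet.{v, u} ι} {V : ∀ I, DiscreteVectorField (X.sset I)}
  {eI : Computability.Encoding ι Bool} {A : Type w} {Γ : Scale A} {x : A → BTree}
  {I : A → ι} {κ : A → ℕ}

section Classify

variable (hV : ClassifyPolyTime eI V) (hA : Ambient eI Γ x I κ)
  {σ : ∀ a, (X.sset (I a)).nonDegenerate (κ a)}

include hV hA

lemma exists_classify (hσ : Computes Γ x fun a => X.code (σ a).1) :
    ∃ y, Computes Γ x y ∧ ∀ a,
      (∃ τ, (σ a, τ) ∈ (V (I a)).pairs (κ a) ∧ y a = .node (.ofNat 0) (X.code τ.1)) ∨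
      ((V (I a)).IsTarget (κ a) (σ a) ∧ y a = .node (.ofNat 1) .nil) ∨
      (σ a ∈ (V (I a)).critical (κ a) ∧ y a = .node (.ofNat 2) .nil) :=
  hV.computes hA.dimBdd (fun a => ⟨I a, σ a⟩) (hA.input hσ) fun _ => rfl

open Classical in
lemma computes_isSource (hσ : Computes Γ x fun a => X.code (σ a).1) : Computes Γ x fun a =>
    ofBool (decide ((V (I a)).IsSource (κ a) (σ a))) := by
  obtain ⟨y, hy, h⟩ := exists_classify hV hA hσ
  refine hy.left.isNil.congr fun a => ?_
  rcases h a with ⟨τ, hτ, e⟩ | ⟨ht, e⟩ | ⟨hc, e⟩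
  · rw [e, decide_eq_true, decide_eq_true]
    · exact ⟨τ, hτ⟩
    · rfl
  · rw [e, decide_eq_false, decide_eq_false]
    · exact fun hs => hs.not_isTarget ht
    · simp [BTree.left, ofNat]
  · rw [e, decide_eq_false, decide_eq_false]
    · exact hc.1
    · simp [BTree.left, ofNat]

open Classical in
lemma computes_mem_critical (hσ : Computes Γ x fun a => X.code (σ a).1) : Computes Γ x fun a =>
    ofBool (decide (σ a ∈ (V (I a)).critical (κ a))) := by
  obtain ⟨y, hy, h⟩ := exists_classify hV hA hσ
  refine hy.left.right.isNil.not.congr fun a => ?_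
  rcases h a with ⟨τ, hτ, e⟩ | ⟨ht, e⟩ | ⟨hc, e⟩
  · rw [e, decide_eq_true, decide_eq_false]
    · rfl
    · exact fun hc => hc.1 ⟨τ, hτ⟩
    · rfl
  · rw [e, decide_eq_true, decide_eq_false]
    · rfl
    · exact fun hc => hc.2 ht
    · rfl
  · rw [e, decide_eq_false, decide_eq_true hc]
    · rfl
    · simp [BTree.left, BTree.right, ofNat]

open Classical in
lemma computes_isTarget (hσ : Computes Γ x fun a => X.code (σ a).1) : Computes Γ x fun a =>
    ofBool (decide ((V (I a)).IsTarget (κ a) (σ a))) := by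
  refine ((computes_isSource hV hA hσ).or (computes_mem_critical hV hA hσ)).not.congr fun a => ?_
  congr 1
  by_cases ht : (V (I a)).IsTarget (κ a) (σ a)
  · have h1 : ¬(V (I a)).IsSource (κ a) (σ a) := fun hs => hs.not_isTarget ht
    have h2 : σ a ∉ (V (I a)).critical (κ a) := fun hc => hc.2 ht
    simp [ht, h1, h2]
  · rcases DiscreteVectorField.isSource_or_mem_critical ht with h | h <;> simp [ht, h]

lemma computes_target {τ : ∀ a, (X.sset (I a)).nonDegenerate (κ a + 1)}
    (hσ : Computes Γ x fun a => X.code (σ a).1) (hτ : ∀ a, (σ a, τ a) ∈ (V (I a)).pairs (κ a)) :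
    Computes Γ x fun a => X.code (τ a).1 := by
  obtain ⟨y, hy, h⟩ := exists_classify hV hA hσ
  refine hy.right.congr fun a => ?_
  have hs : (V (I a)).IsSource (κ a) (σ a) := ⟨_, hτ a⟩
  rcases h a with ⟨τ', hτ', e⟩ | ⟨ht, e⟩ | ⟨hc, e⟩
  · rw [e, (V (I a)).target_unique hτ' (hτ a)]
    rfl
  · exact absurd ht hs.not_isTarget
  · exact absurd hs hc.1

end Classify

section Chains

variable (hV : ClassifyPolyTime eI V) (hA : Ambient eI Γ x I κ)

include hV hA

lemma computes_raise (hX : X.LocallyPolyTime eI) {c : ∀ a, (X.sset (I a)).nonDegenerate (κ a) →₀ ℤ}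
    (hc : ComputesChain Γ x (fun a => X.encND (I a) (κ a)) c) :
    ComputesChain Γ x (fun a => X.encND (I a) (κ a + 1))
      fun a => (V (I a)).raise (κ a) (c a) := by
  classical
  refine hc.linear (fun a => X.encND_injective _ _) (fun a => (V (I a)).raise (κ a))
    (fun a => (V (I a)).raiseTerms) (fun a b _ => ((V (I a)).signedSum_raiseTerms b).symm)
    fun mem hm => ?_
  have hA' := hA.lift hm
  refine (computes_isSource hV hA' (σ := fun q => q.1.2) hm.snd).bcond
    ((hm.input.nilList.comap _).congr fun q => ?_) ?_
  · rw [DiscreteVectorField.raiseTerms, dif_neg (of_decide_eq_false q.2)]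
    rfl
  · have hs : ∀ q : {q : ComputesChain.Term c //
        decide ((V (I q.1.1)).IsSource (κ q.1.1) q.1.2) = true},
        (V (I q.1.1.1)).IsSource (κ q.1.1.1) q.1.1.2 := fun q => of_decide_eq_true q.2
    choose τ hτ using hs
    choose i hi hu using fun q => (V _).regular (hτ q)
    have hA₁ := hA'.comap (Subtype.val : {q : ComputesChain.Term c //
        decide ((V (I q.1.1)).IsSource (κ q.1.1) q.1.2) = true} → ComputesChain.Term c)
    have hσ₁ := hm.snd.comap (Subtype.val : {q : ComputesChain.Term c //
        decide ((V (I q.1.1)).IsSource (κ q.1.1) q.1.2) = true} → ComputesChain.Term c)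
    have hτ₁ := computes_target hV hA₁ hσ₁ hτ
    -- The parity of the index `i` with `σ = ∂_i τ` is found by trying all faces of `τ`.
    have hpar := Computes.any (p := fun q j => Nat.bodd j && decide (∃ h : j < κ q.1.1.1 + 2,
      (X.sset (I q.1.1.1)).δ ⟨j, h⟩ (τ q).1 = q.1.1.2.1)) (Computes.range hA₁.succ.succ.dim)
      fun mem' hm' => by
        have hlt : ∀ p : Computes.Elem (fun q : {q : ComputesChain.Term c //
            decide ((V (I q.1.1)).IsSource (κ q.1.1) q.1.2) = true} =>
              List.range (κ q.1.1.1 + 1 + 1)), p.1.2 < κ p.1.1.1.1.1 + 2 :=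
          fun p => List.mem_range.1 p.2
        have hface := computes_face hX (hA₁.lift hm') (i := fun p => ⟨p.1.2, hlt p⟩)
          (σ := fun p => (τ p.1.1).1) hm'.snd.fst (hτ₁.lift hm')
        refine (hm'.snd.snd.and (hface.eqBits (hσ₁.lift hm'))).congr fun p => ?_
        simp only [encND, (encode_injective _).eq_iff, hlt p, exists_true_left]
    refine ((hτ₁.node hpar.not).cons hpar.input.nilList).congr fun q => ?_
    rw [DiscreteVectorField.raiseTerms_of_mem (hτ q) (hi q)]
    have : ((List.range (κ q.1.1.1 + 1 + 1)).any fun j => Nat.bodd j &&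
        decide (∃ h : j < κ q.1.1.1 + 2, (X.sset (I q.1.1.1)).δ ⟨j, h⟩ (τ q).1 = q.1.1.2.1)) =
        Nat.bodd (i q : ℕ) := by
      rw [Bool.eq_iff_iff, List.any_eq_true]
      simp only [List.mem_range, Bool.and_eq_true, decide_eq_true_eq]
      constructor
      · rintro ⟨j, -, hj, hj', e⟩
        rw [← hu q _ e]
        exact hj
      · intro h
        exact ⟨i q, (i q).2, h, (i q).2, hi q⟩
    simp only [this]
    rfl

lemma computes_dropTargets {c : ∀ a, (X.sset (I a)).nonDegenerate (κ a) →₀ ℤ}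
    (hc : ComputesChain Γ x (fun a => X.encND (I a) (κ a)) c) :
    ComputesChain Γ x (fun a => X.encND (I a) (κ a))
      fun a => (V (I a)).dropTargets (κ a) (c a) := by
  classical
  refine hc.linear (fun a => X.encND_injective _ _) (fun a => (V (I a)).dropTargets (κ a))
    (fun a σ => if (V (I a)).IsTarget (κ a) σ then [] else [(σ, false)]) (fun a b _ => ?_)
    fun mem hm => ?_
  · rw [DiscreteVectorField.dropTargets_single]
    split_ifs <;> simp [ComputesChain.signedSum]
  · refine ((computes_isTarget hV (hA.lift hm) (σ := fun q => q.1.2) hm.snd).ite hm.input.nilList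
      ((hm.snd.node hm.input.nil).cons hm.input.nilList)).congr fun q => ?_
    by_cases h : (V (I q.1.1)).IsTarget (κ q.1.1) q.1.2 <;> simp only [h] <;> rfl

lemma computes_toCrit {c : ∀ a, (X.sset (I a)).nonDegenerate (κ a) →₀ ℤ}
    (hc : ComputesChain Γ x (fun a => X.encND (I a) (κ a)) c) :
    ComputesChain Γ x (fun a => X.encCrit V (I a) (κ a))
      fun a => (V (I a)).toCrit (κ a) (c a) := by
  classical
  refine hc.linear (fun a => X.encCrit_injective V _ _) (fun a => (V (I a)).toCrit (κ a))
    (fun a σ => if h : σ ∈ (V (I a)).critical (κ a) then [(⟨σ, h⟩, false)] else [])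
    (fun a b _ => ?_) fun mem hm => ?_
  · by_cases h : b ∈ (V (I a)).critical (κ a)
    · rw [dif_pos h]
      exact (DiscreteVectorField.toCrit_single ⟨b, h⟩ 1).trans (by simp [ComputesChain.signedSum])
    · rw [dif_neg h, DiscreteVectorField.toCrit_single_of_notMem h]
      rfl
  · refine ((computes_mem_critical hV (hA.lift hm) (σ := fun q => q.1.2) hm.snd).ite
      ((hm.snd.node hm.input.nil).cons hm.input.nilList) hm.input.nilList).congr fun q => ?_
    by_cases h : q.1.2 ∈ (V (I q.1.1)).critical (κ q.1.1)
    · rw [decide_eq_true h, dif_pos h]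
      rfl
    · rw [decide_eq_false h, dif_neg h]
      rfl

omit hV hA in
lemma computes_ofCrit {s : ∀ a, (V (I a)).critical (κ a) →₀ ℤ}
    (hs : ComputesChain Γ x (fun a => X.encCrit V (I a) (κ a)) s) :
    ComputesChain Γ x (fun a => X.encND (I a) (κ a))
      fun a => (V (I a)).ofCrit (κ a) (s a) := by
  refine hs.linear (fun a => X.encND_injective _ _) (fun a => (V (I a)).ofCrit (κ a))
    (fun a σ => [(σ.1, false)]) (fun a b _ => ?_) fun mem hm =>
      (hm.snd.node hm.input.nil).cons hm.input.nilList
  rw [DiscreteVectorField.ofCrit_single]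
  simp [ComputesChain.signedSum]

end Chains

end EncSSet

/-! ### Bounds for the iterates -/

/-- The sum of the absolute values of the coefficients of a chain. -/
def l1Norm {B : Type*} (c : B →₀ ℤ) : ℕ := ∑ b ∈ c.support, (c b).natAbs

section Norm

variable {B B' : Type*}

lemma l1Norm_eq_sum {c : B →₀ ℤ} {s : Finset B} (h : c.support ⊆ s) :
    l1Norm c = ∑ b ∈ s, (c b).natAbs :=
  Finset.sum_subset h fun b _ hb => by simpa using hb

@[simp] lemma l1Norm_zero : l1Norm (0 : B →₀ ℤ) = 0 := rfl

lemma l1Norm_add_le (c c' : B →₀ ℤ) : l1Norm (c + c') ≤ l1Norm c + l1Norm c' := by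
  classical
  rw [l1Norm_eq_sum (Finsupp.support_add (g₁ := c) (g₂ := c')),
    l1Norm_eq_sum (Finset.subset_union_left (s₁ := c.support) (s₂ := c'.support)),
    l1Norm_eq_sum (Finset.subset_union_right (s₁ := c.support) (s₂ := c'.support)),
    ← Finset.sum_add_distrib]
  exact Finset.sum_le_sum fun b _ => Int.natAbs_add_le _ _

lemma l1Norm_neg (c : B →₀ ℤ) : l1Norm (-c) = l1Norm c := by
  simp [l1Norm, Finsupp.support_neg]

lemma l1Norm_smul_le (z : ℤ) (c : B →₀ ℤ) : l1Norm (z • c) ≤ z.natAbs * l1Norm c := by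
  rw [l1Norm_eq_sum (Finsupp.support_smul (b := z) (g := c)), l1Norm, Finset.mul_sum]
  exact Finset.sum_le_sum fun b _ => by simp [Int.natAbs_mul]

lemma l1Norm_sum_le {T : Type*} (s : Finset T) (f : T → B →₀ ℤ) :
    l1Norm (∑ t ∈ s, f t) ≤ ∑ t ∈ s, l1Norm (f t) :=
  Finset.le_sum_of_subadditive _ l1Norm_zero.le l1Norm_add_le s f

lemma l1Norm_single (b : B) (z : ℤ) : l1Norm (Finsupp.single b z) = z.natAbs := by
  rw [l1Norm_eq_sum Finsupp.support_single_subset]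
  simp

lemma l1Norm_map_le (φ : (B →₀ ℤ) →ₗ[ℤ] (B' →₀ ℤ)) {K : ℕ}
    (h : ∀ b, l1Norm (φ (Finsupp.single b 1)) ≤ K) (c : B →₀ ℤ) :
    l1Norm (φ c) ≤ K * l1Norm c := by
  conv_lhs => rw [← c.sum_single]
  rw [Finsupp.sum, map_sum]
  refine (l1Norm_sum_le _ _).trans ?_
  rw [l1Norm, Finset.mul_sum]
  refine Finset.sum_le_sum fun b _ => ?_
  rw [← mul_one (c b), ← smul_eq_mul, ← Finsupp.smul_single, map_smul, mul_comm K, smul_eq_mul,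
    mul_one]
  exact (l1Norm_smul_le _ _).trans (Nat.mul_le_mul_left _ (h b))

end Norm

namespace DiscreteVectorField

variable {Y : SSet.{u}} {V : DiscreteVectorField Y}

lemma l1Norm_boundary_le {k : ℕ} (c : Y.nonDegenerate (k + 1) →₀ ℤ) :
    l1Norm (boundary Y k c) ≤ (k + 2) * l1Norm c := by
  refine l1Norm_map_le _ (fun τ => ?_) c
  rw [boundary_single]
  refine (l1Norm_sum_le _ _).trans ((Finset.sum_le_card_nsmul _ _ 1 fun i _ => ?_).trans (by simp))
  refine (l1Norm_smul_le _ _).trans ?_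
  rw [Int.natAbs_pow, Int.natAbs_neg, Int.natAbs_one, one_pow, one_mul, simplexChain]
  split_ifs <;> simp [l1Norm_single]

lemma l1Norm_raise_le {k : ℕ} (c : Y.nonDegenerate k →₀ ℤ) :
    l1Norm (V.raise k c) ≤ l1Norm c := by
  refine (l1Norm_map_le (K := 1) _ (fun σ => ?_) c).trans (one_mul _).le
  by_cases h : V.IsSource k σ
  · obtain ⟨τ, h⟩ := h
    obtain ⟨i, hi, -⟩ := V.regular h
    rw [raise_single h hi, l1Norm_single]
    simp
  · rw [raise_single_of_not_isSource h, l1Norm_zero]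
    exact zero_le_one

lemma l1Norm_dropTargets_le {k : ℕ} (c : Y.nonDegenerate k →₀ ℤ) :
    l1Norm (V.dropTargets k c) ≤ l1Norm c := by
  refine (l1Norm_map_le (K := 1) _ (fun σ => ?_) c).trans (one_mul _).le
  rw [dropTargets_single]
  split_ifs <;> simp [l1Norm_single]

lemma l1Norm_flow_pow_le {k : ℕ} (c : Y.nonDegenerate k →₀ ℤ) (n : ℕ) :
    l1Norm ((V.flow k ^ n) c) ≤ (k + 3) ^ n * l1Norm c := by
  induction n with
  | zero => simp
  | succ n ih =>
    rw [pow_succ', Module.End.mul_apply, flow_apply, pow_succ', mul_assoc]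
    refine (l1Norm_add_le _ _).trans ?_
    have h1 := l1Norm_boundary_le (V.raise k ((V.flow k ^ n) c))
    have h2 := Nat.mul_le_mul_left (k + 2) (l1Norm_raise_le (V := V) ((V.flow k ^ n) c))
    have h3 := Nat.mul_le_mul_left (k + 3) ih
    have h4 : (k + 3) * l1Norm ((V.flow k ^ n) c) =
      l1Norm ((V.flow k ^ n) c) + (k + 2) * l1Norm ((V.flow k ^ n) c) := by ring
    omega

lemma dropTargets_apply_ne_zero {k : ℕ} {c : Y.nonDegenerate k →₀ ℤ} {σ : Y.nonDegenerate k}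
    (h : V.dropTargets k c σ ≠ 0) : c σ ≠ 0 ∧ ¬V.IsTarget k σ := by
  obtain ⟨σ', hσ', h⟩ := exists_of_apply_ne_zero _ h
  rw [dropTargets_single] at h
  split_ifs at h with ht
  · exact absurd rfl h
  · rw [Finsupp.single_apply_ne_zero] at h
    rw [h.1]
    exact ⟨hσ', ht⟩

lemma raise_dropTargets {k : ℕ} (c : Y.nonDegenerate k →₀ ℤ) :
    V.raise k (V.dropTargets k c) = V.raise k c := by
  have := eq_zero_of_single (c := c) (V.raise k ∘ₗ V.dropTargets k - V.raise k) fun σ _ => by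
    rw [LinearMap.sub_apply, LinearMap.comp_apply, dropTargets_single]
    split_ifs with ht
    · rw [map_zero, raise_single_of_not_isSource fun hs => hs.not_isTarget ht, sub_zero]
    · rw [sub_self]
  exact sub_eq_zero.1 this

lemma toCrit_dropTargets {k : ℕ} (c : Y.nonDegenerate k →₀ ℤ) :
    V.toCrit k (V.dropTargets k c) = V.toCrit k c := by
  have := eq_zero_of_single (c := c) (V.toCrit k ∘ₗ V.dropTargets k - V.toCrit k) fun σ _ => by
    rw [LinearMap.sub_apply, LinearMap.comp_apply, dropTargets_single]
    split_ifs with ht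
    · rw [map_zero, toCrit_single_of_notMem fun hc => hc.2 ht, sub_zero]
    · rw [sub_self]
  exact sub_eq_zero.1 this

lemma dropTargets_dropTargets {k : ℕ} (c : Y.nonDegenerate k →₀ ℤ) :
    V.dropTargets k (V.dropTargets k c) = V.dropTargets k c := by
  have := eq_zero_of_single (c := c) (V.dropTargets k ∘ₗ V.dropTargets k - V.dropTargets k)
    fun σ _ => by
      rw [LinearMap.sub_apply, LinearMap.comp_apply, dropTargets_single]
      split_ifs with ht
      · rw [map_zero, sub_zero]
      · rw [dropTargets_single, if_neg ht, sub_self]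
  exact sub_eq_zero.1 this

/-- The non-target part of an iterate of `flow` is determined by the one of its predecessor. -/
lemma dropTargets_flow_pow_succ {k : ℕ} (c : Y.nonDegenerate k →₀ ℤ) (n : ℕ) :
    V.dropTargets k ((V.flow k ^ (n + 1)) c) = V.dropTargets k (V.dropTargets k
      ((V.flow k ^ n) c) + boundary Y k (V.raise k ((V.flow k ^ n) c))) := by
  rw [pow_succ', Module.End.mul_apply, flow_apply, map_add, map_add, dropTargets_dropTargets]

section Finite

variable (hV : V.Admissible) (hfin : ∀ k σ, (V.reach ⟨k, σ⟩).Finite)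

/-- The `j`-simplices reachable from a simplex that occurs in the chain `c`. -/
noncomputable def reachFinset (hfin : ∀ k σ, (V.reach ⟨k, σ⟩).Finite) {k : ℕ}
    (c : Y.nonDegenerate k →₀ ℤ) (j : ℕ) : Finset (Y.nonDegenerate j) := by
  classical
  exact c.support.biUnion fun σ =>
    ((hfin k σ).preimage (f := fun b => (⟨j, b⟩ : Σ k, Y.nonDegenerate k))
      (fun _ _ _ _ h => eq_of_heq (Sigma.mk.inj h).2)).toFinset

lemma mem_reachFinset {k : ℕ} {c : Y.nonDegenerate k →₀ ℤ} {j : ℕ} {b : Y.nonDegenerate j} :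
    b ∈ reachFinset hfin c j ↔
      ∃ σ, c σ ≠ 0 ∧ (⟨j, b⟩ : Σ k, Y.nonDegenerate k) ∈ V.reach ⟨k, σ⟩ := by
  classical
  simp [reachFinset]

include hV in
lemma support_dropTargets_subset {k : ℕ} (c : Y.nonDegenerate k →₀ ℤ) (n : ℕ) :
    (V.dropTargets k ((V.flow k ^ n) c)).support ⊆ reachFinset hfin c k := fun σ hσ => by
  obtain ⟨h1, h2⟩ := dropTargets_apply_ne_zero (Finsupp.mem_support_iff.1 hσ)
  obtain ⟨σ', h, hb, -⟩ := exists_of_flow_pow_apply_ne_zero hV hfin n h1 h2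
  exact (mem_reachFinset hfin).2 ⟨σ', h, hb⟩

include hV in
lemma support_raise_subset {k : ℕ} (c : Y.nonDegenerate k →₀ ℤ) (n : ℕ) :
    (V.raise k ((V.flow k ^ n) c)).support ⊆ reachFinset hfin c (k + 1) := fun τ hτ => by
  obtain ⟨σ, h1, h2⟩ := exists_of_raise_apply_ne_zero (Finsupp.mem_support_iff.1 hτ)
  obtain ⟨σ', h, hb, -⟩ := exists_of_flow_pow_apply_ne_zero hV hfin n h1
    (IsSource.not_isTarget ⟨τ, h2⟩)
  exact (mem_reachFinset hfin).2 ⟨σ', h, .tail hb (.up h2)⟩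

/-- The partial sums of the homotopy. -/
noncomputable def partialHomotopy (V : DiscreteVectorField Y) {k : ℕ}
    (c : Y.nonDegenerate k →₀ ℤ) (n : ℕ) : Y.nonDegenerate (k + 1) →₀ ℤ :=
  -∑ m ∈ Finset.range n, V.raise k ((V.flow k ^ m) c)

include hV in
lemma support_partialHomotopy_subset {k : ℕ} (c : Y.nonDegenerate k →₀ ℤ) (n : ℕ) :
    (V.partialHomotopy c n).support ⊆ reachFinset hfin c (k + 1) := fun τ hτ => by
  have h := Finsupp.mem_support_iff.1 hτ
  rw [partialHomotopy, Finsupp.neg_apply, neg_ne_zero, Finsupp.finsetSum_apply] at h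
  obtain ⟨m, -, hm⟩ := Finset.exists_ne_zero_of_sum_ne_zero h
  exact support_raise_subset hV hfin c m (Finsupp.mem_support_iff.2 hm)

lemma l1Norm_partialHomotopy_le {k : ℕ} (c : Y.nonDegenerate k →₀ ℤ) (n : ℕ) :
    l1Norm (V.partialHomotopy c n) ≤ (k + 3) ^ n * l1Norm c := by
  rw [partialHomotopy, l1Norm_neg]
  refine (l1Norm_sum_le _ _).trans ((Finset.sum_le_sum fun m _ =>
    (l1Norm_raise_le _).trans (l1Norm_flow_pow_le c m)).trans ?_)
  rw [← Finset.sum_mul]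
  refine Nat.mul_le_mul_right _ ?_
  induction n with
  | zero => simp
  | succ n ih =>
    rw [Finset.sum_range_succ, pow_succ]
    nlinarith [Nat.zero_le ((k + 3) ^ n)]

include hV hfin in
lemma exists_raise_flow_pow_eq_zero {k : ℕ} (c : Y.nonDegenerate k →₀ ℤ) :
    ∃ n, V.raise k ((V.flow k ^ n) c) = 0 := ⟨_, raise_flow_pow_eq_zero hV hfin le_rfl⟩

open Classical in
/-- The number of steps after which the chain contains no more source simplices. -/
noncomputable def steps (hV : V.Admissible) (hfin : ∀ k σ, (V.reach ⟨k, σ⟩).Finite) {k : ℕ}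
    (c : Y.nonDegenerate k →₀ ℤ) : ℕ := Nat.find (exists_raise_flow_pow_eq_zero hV hfin c)

lemma raise_flow_pow_steps {k : ℕ} (c : Y.nonDegenerate k →₀ ℤ) :
    V.raise k ((V.flow k ^ steps hV hfin c) c) = 0 := by
  classical
  exact Nat.find_spec (exists_raise_flow_pow_eq_zero hV hfin c)

lemma steps_le_rankSup {k : ℕ} (c : Y.nonDegenerate k →₀ ℤ) : steps hV hfin c ≤ V.rankSup c := by
  classical
  exact Nat.find_min' _ (raise_flow_pow_eq_zero hV hfin le_rfl)

lemma raise_flow_pow_eq_zero_iff {k : ℕ} (c : Y.nonDegenerate k →₀ ℤ) {n : ℕ}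
    (hn : n ≤ steps hV hfin c) :
    V.raise k ((V.flow k ^ n) c) = 0 ↔ n = steps hV hfin c := by
  classical
  constructor
  · intro h
    exact le_antisymm hn (Nat.find_min' _ h)
  · rintro rfl
    exact raise_flow_pow_steps hV hfin c

lemma flow_pow_of_steps_le {k : ℕ} (c : Y.nonDegenerate k →₀ ℤ) {n : ℕ}
    (hn : steps hV hfin c ≤ n) : (V.flow k ^ n) c = (V.flow k ^ steps hV hfin c) c := by
  obtain ⟨m, rfl⟩ := Nat.exists_eq_add_of_le' hn
  rw [pow_add, Module.End.mul_apply, flow_of_raise_eq_zero (raise_flow_pow_steps hV hfin c)]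

lemma proj_eq_of_steps {k : ℕ} (c : Y.nonDegenerate k →₀ ℤ) :
    V.proj k c = V.toCrit k (V.dropTargets k ((V.flow k ^ steps hV hfin c) c)) := by
  rw [toCrit_dropTargets, proj_apply, ← flow_pow_eq hV hfin le_rfl,
    flow_pow_of_steps_le hV hfin c (steps_le_rankSup hV hfin c)]

lemma homotopy_eq_of_steps {k : ℕ} (c : Y.nonDegenerate k →₀ ℤ) :
    V.homotopy k c = V.partialHomotopy c (steps hV hfin c) := by
  rw [homotopy_eq hV hfin le_rfl, partialHomotopy]
  congr 1
  symm
  refine Finset.sum_subset (Finset.range_subset_range.2 (steps_le_rankSup hV hfin c))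
    fun n _ hn => ?_
  rw [flow_pow_of_steps_le hV hfin c (by simpa using hn), raise_flow_pow_steps]

end Finite

end DiscreteVectorField

/-- An injectively encoded set has at most one element of size `0`, so that its cardinality is
bounded by the sum of the sizes. -/
lemma card_le_sum_length {B : Type*} {enc : B → List Bool} (h : Function.Injective enc)
    (s : Finset B) : s.card ≤ ∑ b ∈ s, (enc b).length + 1 := by
  classical
  rw [← Finset.card_filter_add_card_filter_not (s := s) (fun b => enc b = [])]
  have h1 : (s.filter fun b => enc b = []).card ≤ 1 := by
    refine Finset.card_le_one.2 fun a ha b hb => h ?_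
    rw [(Finset.mem_filter.1 ha).2, (Finset.mem_filter.1 hb).2]
  have h2 : (s.filter fun b => ¬enc b = []).card ≤ ∑ b ∈ s, (enc b).length := by
    rw [Finset.card_eq_sum_ones]
    refine (Finset.sum_le_sum fun b hb => ?_).trans
      (Finset.sum_le_sum_of_subset (Finset.filter_subset _ _))
    exact List.length_pos_iff.2 (Finset.mem_filter.1 hb).2
  omega

namespace EncSSet

variable {ι : Type v} {X : EncSSet.{v, u} ι} {V : ∀ I, DiscreteVectorField (X.sset I)}
  {eI : Computability.Encoding ι Bool}

lemma PolyBounded.finite_reach (hV : PolyBounded eI V) (I : ι) (k : ℕ)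
    (σ : (X.sset I).nonDegenerate k) : ((V I).reach ⟨k, σ⟩).Finite := by
  obtain ⟨P, hP⟩ := hV.2.2 k
  exact (hP I σ).1

lemma _root_.PolyTimeHomology.sum_biUnion_le {S T : Type*} [DecidableEq T] (s : Finset S)
    (t : S → Finset T) (f : T → ℕ) : ∑ b ∈ s.biUnion t, f b ≤ ∑ a ∈ s, ∑ b ∈ t a, f b := by
  classical
  induction s using Finset.induction_on with
  | empty => simp
  | insert a s ha ih =>
    rw [Finset.biUnion_insert, Finset.sum_insert ha]
    have := Finset.sum_union_inter (s₁ := t a) (s₂ := s.biUnion t) (f := f)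
    omega

/-- The total size of the simplices of a dimension `j` that are reachable from a chain `c`, in terms
of bounds for the simplices that occur in `c`. -/
lemma sum_reachFinset_le {I : ι} (hfin : ∀ k σ, ((V I).reach ⟨k, σ⟩).Finite) {k : ℕ}
    (c : (X.sset I).nonDegenerate k →₀ ℤ) (j : ℕ) {M : ℕ}
    (hM : ∀ σ, c σ ≠ 0 → ∑ᶠ y ∈ (V I).reach ⟨k, σ⟩, X.size y.2.1 ≤ M) :
    ∑ b ∈ DiscreteVectorField.reachFinset hfin c j, ((X.encND I j b).length + 1) ≤
      c.support.card * (2 * M + 1) := by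
  classical
  rw [DiscreteVectorField.reachFinset]
  refine (sum_biUnion_le _ _ _).trans (Finset.sum_le_card_nsmul _ _ _ fun σ hσ => ?_)
  set T := ((hfin k σ).preimage (f := fun b => (⟨j, b⟩ : Σ k, (X.sset I).nonDegenerate k))
      (fun _ _ _ _ h => eq_of_heq (Sigma.mk.inj h).2)).toFinset with hT
  have h1 : ∑ b ∈ T, (X.encND I j b).length ≤ M := by
    refine le_trans ?_ (hM σ (Finsupp.mem_support_iff.1 hσ))
    rw [finsum_mem_eq_finite_toFinset_sum _ (hfin k σ)]
    have h2 : ∑ b ∈ T, (X.encND I j b).length =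
        ∑ y ∈ T.map ⟨fun b => (⟨j, b⟩ : Σ k, (X.sset I).nonDegenerate k),
          fun _ _ h => eq_of_heq (Sigma.mk.inj h).2⟩, X.size y.2.1 := by
      rw [Finset.sum_map]
      rfl
    rw [h2]
    refine Finset.sum_le_sum_of_subset fun y hy => ?_
    obtain ⟨b, hb, rfl⟩ := Finset.mem_map.1 hy
    have hb' : (⟨j, b⟩ : Σ k, (X.sset I).nonDegenerate k) ∈ (V I).reach ⟨k, σ⟩ := by
      simpa [hT] using hb
    exact (hfin k σ).mem_toFinset.2 hb'
  have h3 := card_le_sum_length (X.encND_injective I j) T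
  rw [Finset.sum_add_distrib, Finset.sum_const, smul_eq_mul, mul_one]
  omega

end EncSSet

namespace EncSSet

variable {ι : Type v} {X : EncSSet.{v, u} ι} {V : ∀ I, DiscreteVectorField (X.sset I)}
  {eI : Computability.Encoding ι Bool} {A : Type w} {Γ : Scale A} {x : A → BTree}
  {I : A → ι} {κ : A → ℕ}

/-! ### Computing the projection and the homotopy -/

/-- The reachable simplices have polynomial total size. -/
lemma exists_bdd_reachFinset (hV : PolyBounded eI V) (hA : Ambient eI Γ x I κ)
    {c : ∀ a, (X.sset (I a)).nonDegenerate (κ a) →₀ ℤ} {y : A → BTree} (hy : Computes Γ x y)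
    (hrep : ∀ a, Represents (X.encND (I a) (κ a)) (c a) (y a)) :
    ∃ M, Γ.Bdd M ∧ ∀ a j, ∑ b ∈ DiscreteVectorField.reachFinset (hV.finite_reach (I a)) (c a) j,
      ((X.encND (I a) j b).length + 1) ≤ M a := by
  choose P hP using hV.2.2
  let M : A → ℕ := fun a => (P (κ a)).eval ((ofBits (eI.encode (I a))).size + (y a).size)
  have hM : Γ.Bdd M := hA.dimBdd.eval (hA.param.bdd_out.add hy.bdd_out) P
  refine ⟨_, hy.bdd_out.mul (((Scale.bdd_const 2).mul hM).add (Scale.bdd_const 1)), fun a j => ?_⟩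
  have hlen := (hrep a).sum_length_le
  refine (sum_reachFinset_le _ (c a) j (M := M a) fun σ hσ => ?_).trans
    (Nat.mul_le_mul_right _ ?_)
  · refine (hP _ _ σ).2.trans (Scale.eval_le_eval _ ?_)
    have h1 := length_lt_size_ofBits (eI.encode (I a))
    have h2 := Finset.single_le_sum (f := fun b => (X.encND (I a) (κ a) b).length + 1)
      (fun _ _ => Nat.zero_le _) (Finsupp.mem_support_iff.2 hσ)
    have h3 : X.size σ.1 = (X.encND (I a) (κ a) σ).length := rfl
    omega
  · refine le_trans ?_ hlen
    rw [Finset.card_eq_sum_ones]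
    exact Finset.sum_le_sum fun _ _ => Nat.le_add_left _ _

/-- The number of steps is at most the number of reachable simplices. -/
lemma steps_le {J : ι} (hV : (V J).Admissible) (hfin : ∀ k σ, ((V J).reach ⟨k, σ⟩).Finite) {k : ℕ}
    (c : (X.sset J).nonDegenerate k →₀ ℤ) : DiscreteVectorField.steps hV hfin c ≤
      ∑ b ∈ DiscreteVectorField.reachFinset hfin c k, ((X.encND J k b).length + 1) := by
  classical
  refine (DiscreteVectorField.steps_le_rankSup hV hfin c).trans (Finset.sup_le fun σ hσ => ?_)
  have h : (V J).below k σ ⊆ DiscreteVectorField.reachFinset hfin c k := fun b hb =>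
    (DiscreteVectorField.mem_reachFinset hfin).2 ⟨σ, Finsupp.mem_support_iff.1 hσ, hb⟩
  refine (Set.ncard_le_ncard h (Finset.finite_toSet _)).trans ?_
  rw [Set.ncard_coe_finset, Finset.card_eq_sum_ones]
  exact Finset.sum_le_sum fun _ _ => Nat.le_add_left _ _

/-- The states of the loop that removes the source simplices from the chain `c`: besides the memory,
they hold the raised simplices, the remaining chain, and the part of the homotopy that has been
found. The loop ends when there is nothing to raise. -/
def IsState (V : ∀ I, DiscreteVectorField (X.sset I)) (J : ι) {k : ℕ}
    (c : (X.sset J).nonDegenerate k →₀ ℤ) (m : BTree) (n : ℕ) (t : BTree) : Prop :=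
  ∃ r s h, t = .node m (.node r (.node s h)) ∧
    Represents (X.encND J (k + 1)) ((V J).raise k (((V J).flow k ^ n) c)) r ∧
    Represents (X.encND J k) ((V J).dropTargets k (((V J).flow k ^ n) c)) s ∧
    Represents (X.encND J (k + 1)) ((V J).partialHomotopy c n) h

/-- A bound for the sizes of the states. The coefficients may grow exponentially with the number of
rounds, but the number of their bits then grows linearly. -/
lemma IsState.size_le {J : ι} (hV : (V J).Admissible)
    (hfin : ∀ k σ, ((V J).reach ⟨k, σ⟩).Finite) {k : ℕ} {c : (X.sset J).nonDegenerate k →₀ ℤ}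
    {m t : BTree} {n M q : ℕ} (h : IsState V J c m n t) (hq : l1Norm c < 2 ^ q)
    (hM : ∀ j, ∑ b ∈ DiscreteVectorField.reachFinset hfin c j,
      ((X.encND J j b).length + 1) ≤ M) (hn : n ≤ M) :
    t.size ≤ m.size + 3 * (1 + M * (4 * ((k + 3) * M + q) + 8)) + 3 := by
  obtain ⟨r, s, h, rfl, hr, hs, hh⟩ := h
  have hpow : (k + 3) ^ n * l1Norm c < 2 ^ ((k + 3) * M + q) := by
    rw [pow_add]
    have h1 : (k + 3) ^ n ≤ 2 ^ ((k + 3) * M) := by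
      rw [pow_mul]
      exact (Nat.pow_le_pow_left Nat.lt_two_pow_self.le n).trans
        (Nat.pow_le_pow_right (by positivity) hn)
    exact (Nat.mul_le_mul_right _ h1).trans_lt
      (Nat.mul_lt_mul_of_pos_left hq (by positivity))
  have hsum : ∀ j, 1 + ∑ b ∈ DiscreteVectorField.reachFinset hfin c j,
      (4 * (X.encND J j b).length + 4 * ((k + 3) * M + q) + 8) ≤
      1 + M * (4 * ((k + 3) * M + q) + 8) := fun j => by
    refine Nat.add_le_add_left ?_ 1
    refine le_trans ?_ (Nat.mul_le_mul_right _ (hM j))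
    rw [Finset.sum_mul]
    refine Finset.sum_le_sum fun b _ => ?_
    nlinarith [Nat.zero_le ((X.encND J j b).length * (4 * ((k + 3) * M + q)))]
  have h1 := (hr.size_le (DiscreteVectorField.support_raise_subset hV hfin c n)
    (((DiscreteVectorField.l1Norm_raise_le _).trans
      (DiscreteVectorField.l1Norm_flow_pow_le c n)).trans_lt hpow)).trans (hsum _)
  have h2 := (hs.size_le (DiscreteVectorField.support_dropTargets_subset hV hfin c n)
    (((DiscreteVectorField.l1Norm_dropTargets_le _).trans
      (DiscreteVectorField.l1Norm_flow_pow_le c n)).trans_lt hpow)).trans (hsum _)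
  have h3 := (hh.size_le (DiscreteVectorField.support_partialHomotopy_subset hV hfin c n)
    ((DiscreteVectorField.l1Norm_partialHomotopy_le c n).trans_lt hpow)).trans (hsum _)
  simp only [BTree.size]
  omega

/-- The projection to the critical complex and the homotopy are computed by removing all source
simplices of the chain at once, until none is left. Removing them in parallel keeps the number of
rounds below the length of the longest gradient path, while there may be exponentially many gradient
paths. -/
theorem computes_proj_homotopy (hX : X.LocallyPolyTime eI) (hV : PolyBounded eI V)
    (hA : Ambient eI Γ x I κ) {c : ∀ a, (X.sset (I a)).nonDegenerate (κ a) →₀ ℤ}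
    (hc : ComputesChain Γ x (fun a => X.encND (I a) (κ a)) c) :
    ComputesChain Γ x (fun a => X.encCrit V (I a) (κ a)) (fun a => (V (I a)).proj (κ a) (c a)) ∧
      ComputesChain Γ x (fun a => X.encND (I a) (κ a + 1))
        (fun a => (V (I a)).homotopy (κ a) (c a)) := by
  obtain ⟨y, hy, hrep⟩ := id hc
  obtain ⟨M, hMb, hM⟩ := exists_bdd_reachFinset hV hA hy hrep
  let N : A → ℕ := fun a => DiscreteVectorField.steps (hV.1 (I a)) (hV.finite_reach (I a)) (c a)
  have hN : ∀ a, N a ≤ M a := fun a => (steps_le _ _ _).trans (hM a (κ a))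
  let R : A → ℕ → BTree → Prop := fun a n t => IsState V (I a) (c a) (x a) n t
  have hb : Γ.Bdd fun a => (x a).size +
      3 * (1 + M a * (4 * ((κ a + 3) * M a + (y a).size) + 8)) + 3 := by
    have hc := fun n => Scale.bdd_const (Γ := Γ) n
    exact (hA.dim.bdd_in.add ((hc 3).mul ((hc 1).add (hMb.mul (((hc 4).mul
      (((hA.dimBdd.bdd.add (hc 3)).mul hMb).add hy.bdd_out)).add (hc 8)))))).add (hc 3)
  have hR : ∀ a n t, R a n t → n ≤ N a → t.size ≤ (x a).size +
      3 * (1 + M a * (4 * ((κ a + 3) * M a + (y a).size) + 8)) + 3 := fun a n t h hn =>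
    h.size_le (hV.1 _) (hV.finite_reach _) (hrep a).norm_lt (hM a) (hn.trans (hN a))
  -- the initial state
  have hdrop := computes_dropTargets hV.2.1 hA hc
  obtain ⟨s₀, hs₀, hs₀r⟩ := hdrop
  obtain ⟨r₀, hr₀, hr₀r⟩ := computes_raise hV.2.1 hA hX hc
  -- the body of the loop
  have hbody : ∃ z, Computes (Γ.comap fun q : {q : A × ℕ × BTree //
      R q.1 q.2.1 q.2.2 ∧ q.2.1 < N q.1} => q.1.1) (fun q => q.1.2.2) z ∧
      ∀ q, R q.1.1 (q.1.2.1 + 1) (z q) := by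
    choose r s h ht hr hs hh using fun q : {q : A × ℕ × BTree //
      R q.1 q.2.1 q.2.2 ∧ q.2.1 < N q.1} => q.2.1
    have hmem := (Computes.refl (Γ := Γ.comap fun q : {q : A × ℕ × BTree //
      R q.1 q.2.1 q.2.2 ∧ q.2.1 < N q.1} => q.1.1) (x := fun q => q.1.2.2)
      ((hb.comap _).mono fun q => hR _ _ _ q.2.1 q.2.2.le)).congr ht
    have hA' := hA.lift hmem
    have hraise : ComputesChain _ _ (fun q => X.encND _ _) _ := ⟨r, hmem.snd.fst, hr⟩
    have hrest : ComputesChain _ _ (fun q => X.encND _ _) _ := ⟨s, hmem.snd.snd.fst, hs⟩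
    have hhom : ComputesChain _ _ (fun q => X.encND _ _) _ := ⟨h, hmem.snd.snd.snd, hh⟩
    have hrest' := computes_dropTargets hV.2.1 hA' (hrest.add (fun q => X.encND_injective _ _)
      (computes_boundary hX hA' hraise))
    obtain ⟨r', hr', hr'r⟩ := computes_raise hV.2.1 hA' hX hrest'
    obtain ⟨h', hh', hh'r⟩ := hhom.sub (fun q => X.encND_injective _ _) hraise
    obtain ⟨s', hs', hs'r⟩ := hrest'
    refine ⟨_, hmem.fst.node (hr'.node (hs'.node hh')), fun q => ⟨_, _, _, rfl, ?_, ?_, ?_⟩⟩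
    · have := hr'r q
      beta_reduce at this
      rwa [← DiscreteVectorField.dropTargets_flow_pow_succ,
        DiscreteVectorField.raise_dropTargets] at this
    · have := hs'r q
      beta_reduce at this
      rwa [← DiscreteVectorField.dropTargets_flow_pow_succ] at this
    · have := hh'r q
      beta_reduce at this
      rw [DiscreteVectorField.partialHomotopy, ← neg_add', ← Finset.sum_range_succ] at this
      exact this
  obtain ⟨z, hz, hzR⟩ := hbody
  obtain ⟨o, ho, hoR⟩ := Computes.loop (R := R) (N := N) (c := fun t => t.right.left)
    (hMb.mono hN) hb hR
    (Computes.refl ((hb.comap _).mono fun q => hR _ _ _ q.2.1 q.2.2)).right.left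
    (fun a n t h hn => by
      obtain ⟨r, s, h, rfl, hr, -⟩ := h
      exact hr.eq_nil_iff.trans
        (DiscreteVectorField.raise_flow_pow_eq_zero_iff (hV.1 _) (hV.finite_reach _) _ hn))
    (hs₀.input.node (hr₀.node (hs₀.node hs₀.input.nil)))
    (fun a => ⟨_, _, _, rfl, hr₀r a, hs₀r a, [], List.nodup_nil,
      by simp [DiscreteVectorField.partialHomotopy], rfl⟩) hz hzR
  choose r s h ht hr hs hh using hoR
  have ho' := ho.congr ht
  have hrest : ComputesChain Γ x (fun a => X.encND (I a) (κ a)) _ := ⟨s, ho'.snd.snd.fst, hs⟩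
  refine ⟨(computes_toCrit hV.2.1 hA hrest).congr fun a => ?_, ⟨h, ho'.snd.snd.snd, fun a => ?_⟩⟩
  · rw [DiscreteVectorField.proj_eq_of_steps (hV.1 _) (hV.finite_reach _)]
  · beta_reduce
    rw [DiscreteVectorField.homotopy_eq_of_steps (hV.1 _) (hV.finite_reach _)]
    exact hh a

end EncSSet

/-- The inclusion of the positive dimensions into a family indexed by the dimension. -/
abbrev succDim {T : ℕ → Type w} (b : Σ k, T (k + 1)) : Σ k, T k := ⟨b.1 + 1, b.2⟩

/-- A family of chains indexed by the dimension is computed by treating dimension `0` and positive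
dimensions separately. -/
lemma ComputesChain.cases_dim {T : ℕ → Type w} {Γ : Scale (Σ k, T k)} {x : (Σ k, T k) → BTree}
    {B : (Σ k, T k) → Type*} {enc : ∀ a, B a → List Bool} {d : ∀ a, B a →₀ ℤ}
    (hc : Computes Γ x fun a => ofNat a.1)
    (h₀ : ComputesChain (Γ.comap (Sigma.mk 0)) (fun b => x ⟨0, b⟩) (fun b => enc ⟨0, b⟩)
      fun b => d ⟨0, b⟩)
    (h₁ : ComputesChain (Γ.comap succDim) (fun b => x (succDim b)) (fun b => enc (succDim b))
      fun b => d (succDim b)) :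
    ComputesChain Γ x enc d := by
  obtain ⟨y₀, hy₀, r₀⟩ := h₀
  obtain ⟨y₁, hy₁, r₁⟩ := h₁
  let y : (Σ k, T k) → BTree := fun a => match a with
    | ⟨0, b⟩ => y₀ b
    | ⟨k + 1, b⟩ => y₁ ⟨k, b⟩
  refine ⟨y, Computes.cond (φ₀ := Sigma.mk 0) (φ₁ := succDim) hc hy₀ hy₁ ?_, ?_⟩
  · rintro ⟨_ | k, b⟩
    · exact .inl ⟨rfl, b, rfl⟩
    · exact .inr ⟨by simp [ofNat], ⟨k, b⟩, rfl⟩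
  · rintro ⟨_ | k, b⟩
    · exact r₀ b
    · exact r₁ ⟨k, b⟩

/-! ### Polynomial-time maps of chain complexes -/

namespace EncComplex

variable {ι : Type v} {eI : Computability.Encoding ι Bool} {E F : EncComplex.{v, u} ι} {a b : ℕ → ℕ}

/-- The inputs of a family of homomorphisms defined on the `a k`-chains of `E`. -/
abbrev chainScale (eI : Computability.Encoding ι Bool) (E : EncComplex.{v, u} ι) (a : ℕ → ℕ) :=
  inputScale (A₀ := fun k => Σ I, (E.cx I).Chain (a k)) fun k x t =>
    ∃ s, E.Represents x.2 s ∧ t = PolyTimeHomology.input eI (a k) x.1 s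

lemma ambient_chainScale : Ambient eI (chainScale eI E a) (fun q => q.2.2.1) (fun q => q.2.1.1)
    fun q => a q.1 := by
  have h := computes_inputScale (A₀ := fun k => Σ I, (E.cx I).Chain (a k)) fun k x t =>
    ∃ s, E.Represents x.2 s ∧ t = PolyTimeHomology.input eI (a k) x.1 s
  refine ⟨⟨a, fun q => le_rfl⟩, h.left.congr fun q => ?_, h.right.left.congr fun q => ?_⟩
  all_goals
    obtain ⟨s, -, e⟩ := q.2.2.2
    rw [e]
    rfl

lemma computesChain_chainScale : ComputesChain (chainScale eI E a) (fun q => q.2.2.1)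
    (fun q => (E.enc q.2.1.1 (a q.1)).encode) fun q => q.2.1.2 := by
  have h := computes_inputScale (A₀ := fun k => Σ I, (E.cx I).Chain (a k)) fun k x t =>
    ∃ s, E.Represents x.2 s ∧ t = PolyTimeHomology.input eI (a k) x.1 s
  refine ⟨_, h.right.right, fun q => ?_⟩
  obtain ⟨s, hs, e⟩ := q.2.2.2
  rw [e]
  exact hs

lemma mapPolyTime_of_computesChain {φ : ∀ I k, (E.cx I).Chain (a k) →ₗ[ℤ] (F.cx I).Chain (b k)}
    (h : ComputesChain (chainScale eI E a) (fun q => q.2.2.1)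
      (fun q => (F.enc q.2.1.1 (b q.1)).encode) fun q => φ q.2.1.1 q.1 q.2.1.2) :
    MapPolyTime eI φ := by
  obtain ⟨y, hy, h⟩ := h
  exact PolyTime.of_computes hy h

end EncComplex

namespace EncSSet

variable {ι : Type v} {X : EncSSet.{v, u} ι} {V : ∀ I, DiscreteVectorField (X.sset I)}
  {eI : Computability.Encoding ι Bool}

section Main

variable (hX : X.LocallyPolyTime eI) (hV : PolyBounded eI V)

/-- The critical complexes. -/
noncomputable def criticalComplex (hV : PolyBounded eI V) (I : ι) : (V I).CriticalComplex :=
  DiscreteVectorField.toCriticalComplex (hV.1 I) (hV.finite_reach I)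

include hX

lemma mapPolyTime_proj : EncComplex.MapPolyTime eI (E := X.chains)
    (F := critComplex (criticalComplex hV)) (a := fun k => k) (b := fun k => k)
    fun I k => (V I).proj k :=
  EncComplex.mapPolyTime_of_computesChain (computes_proj_homotopy hX hV
    (EncComplex.ambient_chainScale (E := X.chains))
    (EncComplex.computesChain_chainScale (E := X.chains))).1

include hV in
lemma mapPolyTime_homotopy : EncComplex.MapPolyTime eI (E := X.chains) (F := X.chains)
    (a := fun k => k) (b := fun k => k + 1) fun I k => (V I).homotopy k :=
  EncComplex.mapPolyTime_of_computesChain (computes_proj_homotopy hX hV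
    (EncComplex.ambient_chainScale (E := X.chains))
    (EncComplex.computesChain_chainScale (E := X.chains))).2

lemma locallyPolyTime_critComplex : (critComplex (criticalComplex hV)).LocallyPolyTime eI := by
  refine EncComplex.mapPolyTime_of_computesChain ?_
  have hA := (EncComplex.ambient_chainScale (eI := eI) (E := critComplex (criticalComplex hV))
    (a := fun k => k + 1))
  have hc := computes_ofCrit (V := V) (EncComplex.computesChain_chainScale (eI := eI)
    (E := critComplex (criticalComplex hV)) (a := fun k => k + 1))
  exact (computes_proj_homotopy hX hV hA.pred (computes_boundary hX hA.pred hc)).1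

lemma mapPolyTime_incl : EncComplex.MapPolyTime eI (E := critComplex (criticalComplex hV))
    (F := X.chains) (a := fun k => k) (b := fun k => k) fun I k => (V I).incl k := by
  refine EncComplex.mapPolyTime_of_computesChain ?_
  have hA := (EncComplex.ambient_chainScale (eI := eI) (E := critComplex (criticalComplex hV))
    (a := fun k => k))
  have hc := computes_ofCrit (V := V) (EncComplex.computesChain_chainScale (eI := eI)
    (E := critComplex (criticalComplex hV)) (a := fun k => k))
  refine ComputesChain.cases_dim hA.dim ?_ ?_
  · exact (hc.comap _).congr fun q => (sub_zero _).symm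
  · have hA₁ := hA.comap succDim
    have hc₁ := hc.comap succDim
    have h := (computes_proj_homotopy hX hV hA₁.pred (computes_boundary hX hA₁.pred hc₁)).2
    exact hc₁.sub (fun q => X.encND_injective _ _) h

lemma polyTimeReducible_critComplex :
    X.chains.PolyTimeReducible eI (critComplex (criticalComplex hV)) :=
  ⟨fun I => DiscreteVectorField.reduction (hV.1 I) (hV.finite_reach I), mapPolyTime_proj hX hV,
    mapPolyTime_incl hX hV, mapPolyTime_homotopy hX hV⟩

omit hX

lemma rankPolyBounded_critComplex (hC : CriticalPolyBounded eI V) :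
    (critComplex (criticalComplex hV)).RankPolyBounded eI := fun k => by
  obtain ⟨P, hP⟩ := hC k
  refine ⟨P + 1, fun I => ⟨(hP I).1.to_subtype, ?_⟩⟩
  have h1 : Nat.card ((V I).critical k) = (hP I).1.toFinset.card :=
    Nat.card_eq_card_finite_toFinset (hP I).1
  have h2 := card_le_sum_length (X.encND_injective I k) (hP I).1.toFinset
  have h3 := (hP I).2
  rw [finsum_mem_eq_finite_toFinset_sum _ (hP I).1] at h3
  rw [Polynomial.eval_add, Polynomial.eval_one]
  refine (h1.trans_le h2).trans ?_
  exact Nat.add_le_add_right h3 1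

lemma basisPolyTime_critComplex (h : CriticalPolyTime eI V) :
    (critComplex (criticalComplex hV)).BasisPolyTime eI := by
  obtain ⟨p, hp⟩ := h
  refine ⟨p, fun k => ?_⟩
  obtain ⟨P, hP⟩ := hp k
  refine ⟨P, fun I t ht => ?_⟩
  obtain ⟨t', m, hrun, hm, l, hnd, hl, e⟩ := hP I t ht
  refine ⟨t', m, hrun, hm, l.pmap Subtype.mk fun σ hσ => (hl σ).1 hσ, ?_, ?_, ?_⟩
  · exact hnd.pmap fun _ _ _ _ h => congrArg Subtype.val h
  · intro b
    exact List.mem_pmap.2 ⟨b.1, (hl _).2 b.2, rfl⟩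
  · rw [e]
    congr 1
    change _ = List.map (fun b : (V I).critical k => X.code b.1.1)
      (l.pmap (Subtype.mk (p := (· ∈ (V I).critical k))) fun σ hσ => (hl σ).1 hσ)
    rw [List.map_pmap]
    exact (List.pmap_eq_map _).symm

end Main

end EncSSet

end PolyTimeHomology

theorem theorem1 {ι : Type*} (eI : Computability.Encoding ι Bool)
    (X : PolyTimeHomology.EncSSet ι)
    (V : ∀ I, PolyTimeHomology.DiscreteVectorField (X.sset I))
    (hX : X.LocallyPolyTime eI)
    (hV : PolyTimeHomology.EncSSet.PolyBounded eI V)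
    (hC : PolyTimeHomology.EncSSet.CriticalPolyBounded eI V) :
    ∃ K : ∀ I, (V I).CriticalComplex,
      (PolyTimeHomology.EncSSet.critComplex K).LocallyPolyTime eI ∧
      (PolyTimeHomology.EncSSet.critComplex K).RankPolyBounded eI ∧
      X.chains.PolyTimeReducible eI (PolyTimeHomology.EncSSet.critComplex K) ∧
      (PolyTimeHomology.EncSSet.CriticalPolyTime eI V →
        (PolyTimeHomology.EncSSet.critComplex K).BasisPolyTime eI ∧
        X.HasPolyTimeHomology eI) :=
  ⟨PolyTimeHomology.EncSSet.criticalComplex hV,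
    PolyTimeHomology.EncSSet.locallyPolyTime_critComplex hX hV,
    PolyTimeHomology.EncSSet.rankPolyBounded_critComplex hV hC,
    PolyTimeHomology.EncSSet.polyTimeReducible_critComplex hX hV, fun h =>
      ⟨PolyTimeHomology.EncSSet.basisPolyTime_critComplex hV h, hX, _,
        PolyTimeHomology.EncSSet.locallyPolyTime_critComplex hX hV,
        PolyTimeHomology.EncSSet.basisPolyTime_critComplex hV h,
        PolyTimeHomology.EncSSet.polyTimeReducible_critComplex hX hV⟩⟩
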